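/- Setting. Let $\omega$ be the standard symplectic form on $\mathbb R^4$, with symplectic group $\mathrm{Sp}(4,\mathbb R)$ and $\mathrm{PSp}(4,\mathbb R)=\mathrm{Sp}(4,\mathbb R)/\{\pm \mathrm{Id}\}$. Let $\mathcal X=\{X+iY : X\in \mathrm{Sym}(2,\mathbb R),\ Y\in \mathrm{Sym}^+(2,\mathbb R)\}$ be the Siegel space, with the action $\begin{pmatrix}A&B\\C&D\end{pmatrix}\cdot Z=(AZ+B)(CZ+D)^{-1}$ and the invariant Riemannian metric $\langle U,V\rangle_{X+iY}=\mathrm{Re}\,\mathrm{tr}(Y^{-1}UY^{-1}\overline V)$. A (real or complex) symmetric matrix $Z$ is identified with the Lagrangian spanned by the columns of $\begin{pmatrix}Z\\ \mathrm{Id}\end{pmatrix}$, and $\infty$ denotes the real Lagrangian $\langle e_1,e_2\rangle$. A triple of real Lagrangians is maximal if it is in the $\mathrm{Sp}(4,\mathbb R)$-orbit of $(\infty,0,\mathrm{Id})$; a tuple $(l_1,\dots,l_m)$ is maximal if $(l_i,l_j,l_k)$ is maximal for all $i<j<k$. For transverse real Lagrangians $a,b$, the $\mathbb R$-tube $\mathcal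 Y_{a,b}\subset\mathcal X$ is the set of $l\in\mathcal X$ with $R(a,l,\overline l,b)=-\mathrm{Id}$, where the cross-ratio $R(l_1,l_2,l_3,l_4)$ is the endomorphism of $l_1$ obtained by projecting to $l_4$ parallel to $l_3$ and then to $l_1$ parallel to $l_2$. Two tubes are orthogonal if they intersect and their tangent spaces at every common point are orthogonal. An ordered right-angled hexagon is a cyclic sequence of six tubes with a chosen first one, $(\mathcal Y_1,\dots,\mathcal Y_6)$, any two cyclically consecutive ones being orthogonal, such that $$\mathcal Y_1=\mathcal Y_{P_1,P_2},\ \mathcal Y_2=\mathcal Y_{Q_1,Q_2},\ \mathcal Y_3=\mathcal Y_{P_3,P_4},\ \mathcal Y_4=\mathcal Y_{Q_3,Q_4},\ \mathcal Y_5=\mathcal Y_{P_5,P_6},\ \mathcal Y_6=\mathcal Y_{Q_5,Q_6}$$ for a maximal 12-tuple $(P_1,Q_6,Q_1,P_2,P_3,Q_2,Q_3,P_4,P_5,Q_4,Q_5,P_6)$. Let $\mathcal H$ be the set of ordered right-angled hexagons; $\mathrm{PSp}(4,\mathbb R)$ acts on it. We say that a hexagon has 6-tuple $(P_2,Q_2,P_4,P_5,Q_5,P_1)$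 if these Lagrangians are members of such a maximal 12-tuple. Let $\overline{\mathfrak a}=\{(x_1,x_2)\in\mathbb R^2: x_1\ge x_2>0\}$ and $\mathfrak d=\{x_1=x_2\}$. Let $\mathcal A$ be the quotient of $\overline{\mathfrak a}^3\times[0,2\pi)^2$ by the equivalence relation generated by the following identifications, where all operations on angles are modulo $2\pi$: (0) $(\underline b,\underline c,\underline d,\alpha_1,\alpha_2)\sim(\underline b,\underline c,\underline d,2\pi-\alpha_1,2\pi-\alpha_2)$; (i) if $\underline b\in\mathfrak d$: $(\underline b,\underline c,\underline d,\alpha_1,\alpha_2)\sim(\underline b,\underline c,\underline d,\overline\alpha_1,\alpha_2)$ for all $\overline\alpha_1$; (ii) if $\underline c\in\mathfrak d$: $(\underline b,\underline c,\underline d,\alpha_1,\alpha_2)\sim(\underline b,\underline c,\underline d,\overline\alpha_1,\overline\alpha_2)$ whenever $\overline\alpha_1+\overline\alpha_2\equiv\alpha_1+\alpha_2 \pmod{2\pi}$; (iii) if $\underline d\in\mathfrak d$: $(\underline b,\underline c,\underline d,\alpha_1,\alpha_2)\sim(\underline b,\underline c,\underline d,\alpha_1,\overline\alpha_2)$ for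 all $\overline\alpha_2$. Given $(\underline b,\underline c,\underline d,\alpha_1,\alpha_2)\in\overline{\mathfrak a}^3\times[0,2\pi)^2$, put $S_i=\begin{pmatrix}\cos\frac{\alpha_i}2&-\sin\frac{\alpha_i}2\\ \sin\frac{\alpha_i}2&\cos\frac{\alpha_i}2\end{pmatrix}$, $M=\begin{pmatrix}0&\sqrt{e^{c_1}}\\-\sqrt{e^{c_2}}&0\end{pmatrix}$ and $$A=S_1^T\begin{pmatrix}e^{-b_2}&0\\0&e^{-b_1}\end{pmatrix}S_1,\quad C=\begin{pmatrix}e^{c_1}&0\\0&e^{c_2}\end{pmatrix},\quad D=M S_2\begin{pmatrix}e^{d_1}&0\\0&e^{d_2}\end{pmatrix}S_2^TM^T.$$ Theorem. For every $(\underline b,\underline c,\underline d,\alpha_1,\alpha_2)\in\overline{\mathfrak a}^3\times[0,2\pi)^2$ there is exactly one ordered right-angled hexagon $H(\underline b,\underline c,\underline d,\alpha_1,\alpha_2)$ with 6-tuple $(0,A,\mathrm{Id},C,D,\infty)$, and the map $(\underline b,\underline c,\underline d,\alpha_1,\alpha_2)\mapsto[H(\underline b,\underline c,\underline d,\alpha_1,\alpha_2)]$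 induces a well-defined bijection $$\mathcal A\;\longrightarrow\;\mathcal H/\mathrm{PSp}(4,\mathbb R).$$ -/

import Mathlib

noncomputable section

namespace SiegelHexagon

open scoped Matrix

/-! ### The Siegel space of `Sp(4, ℝ)` -/

/-- Two-by-two matrices. -/
abbrev Mat2 (K : Type) := Matrix (Fin 2) (Fin 2) K

/-- `K⁴`, written as `K² ⊕ K²`; `Sum.inl` indexes `e₁, e₂` and `Sum.inr` indexes `e₃, e₄`. -/
abbrev Vec4 (K : Type) := Fin 2 ⊕ Fin 2 → K

/-- Entrywise real part. -/
def reMat (Z : Mat2 ℂ) : Mat2 ℝ := Z.map Complex.re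

/-- Entrywise imaginary part. -/
def imMat (Z : Mat2 ℂ) : Mat2 ℝ := Z.map Complex.im

/-- Entrywise complex conjugate. -/
def conjMat (Z : Mat2 ℂ) : Mat2 ℂ := Z.map (starRingEnd ℂ)

/-- A real matrix (of any shape) seen as a complex one. -/
def toComplex {m n : Type} (M : Matrix m n ℝ) : Matrix m n ℂ := M.map Complex.ofReal

/-- The Siegel space (upper half-space model): matrices `X + iY` with `X` real symmetric and `Y`
real symmetric positive definite. -/
def siegelSpace : Set (Mat2 ℂ) := {Z | (reMat Z).IsSymm ∧ (imMat Z).PosDef}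

/-- The real symplectic group `Sp(4, ℝ)`. -/
abbrev Sp4 := Matrix.symplecticGroup (Fin 2) ℝ

/-- The action by fractional linear transformations `Z ↦ (AZ + B)(CZ + D)⁻¹`. -/
def moebius (g : Sp4) (Z : Mat2 ℂ) : Mat2 ℂ :=
  (toComplex g.1.toBlocks₁₁ * Z + toComplex g.1.toBlocks₁₂) *
    (toComplex g.1.toBlocks₂₁ * Z + toComplex g.1.toBlocks₂₂)⁻¹

/-! ### Lagrangians and maximal tuples -/

/-- The affine chart of the Lagrangian Grassmannian: the span of the columns of `(Z ; Id)`. -/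
def graphLag {K : Type} [Field K] (Z : Mat2 K) : Submodule K (Vec4 K) :=
  LinearMap.range (Matrix.fromRows Z (1 : Mat2 K)).mulVecLin

/-- The Lagrangian `l_∞ = ⟨e₁, e₂⟩`. -/
def lagInf : Submodule ℝ (Vec4 ℝ) :=
  LinearMap.range (Matrix.fromRows (1 : Mat2 ℝ) (0 : Mat2 ℝ)).mulVecLin

/-- The action of `Sp(4, ℝ)` on linear subspaces of `ℝ⁴`. -/
def actLag (g : Sp4) (l : Submodule ℝ (Vec4 ℝ)) : Submodule ℝ (Vec4 ℝ) :=
  l.map g.1.mulVecLin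

/-- A triple is maximal if it lies in the `Sp(4, ℝ)`-orbit of `(l_∞, 0, Id)`. In particular its
members are pairwise transverse Lagrangians. -/
def IsMaximalTriple (a b c : Submodule ℝ (Vec4 ℝ)) : Prop :=
  ∃ g : Sp4, a = actLag g lagInf ∧ b = actLag g (graphLag 0) ∧ c = actLag g (graphLag 1)

/-- A tuple is maximal if all its triples with increasing indices are. -/
def IsMaximalTuple {m : ℕ} (l : Fin m → Submodule ℝ (Vec4 ℝ)) : Prop :=
  ∀ i j k : Fin m, i < j → j < k → IsMaximalTriple (l i) (l j) (l k)

/-! ### Cross-ratio and `ℝ`-tubes -/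

/-- The complexification of a real linear subspace. -/
def complexify (l : Submodule ℝ (Vec4 ℝ)) : Submodule ℂ (Vec4 ℂ) :=
  Submodule.span ℂ ((fun v : Vec4 ℝ => fun i => (v i : ℂ)) '' (l : Set (Vec4 ℝ)))

/-- The endomorphism-valued cross-ratio `R(l₁, l₂, l₃, l₄)` of `l₁`: project to `l₄` parallel to
`l₃`, then to `l₁` parallel to `l₂`. -/
def crossRatio (l₁ l₂ l₃ l₄ : Submodule ℂ (Vec4 ℂ)) (h₁₂ : IsCompl l₁ l₂) (h₄₃ : IsCompl l₄ l₃) :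
    l₁ →ₗ[ℂ] l₁ :=
  (l₁.projectionOnto l₂ h₁₂) ∘ₗ (l₄.projection l₃ h₄₃) ∘ₗ l₁.subtype

/-- The `ℝ`-tube with endpoints `a, b`: the points `Z` of the Siegel space, identified with
Lagrangians `l` of `ℂ⁴` through the chart `graphLag`, such that `R(a, l, σ(l), b) = -Id`.
The conjugate `σ(l)` of the Lagrangian of `Z` is the Lagrangian of the conjugate of `Z`. -/
def tube (a b : Submodule ℝ (Vec4 ℝ)) : Set (Mat2 ℂ) :=
  {Z | Z ∈ siegelSpace ∧
    ∃ (h₁₂ : IsCompl (complexify a) (graphLag Z))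
      (h₄₃ : IsCompl (complexify b) (graphLag (conjMat Z))),
      crossRatio (complexify a) (graphLag Z) (graphLag (conjMat Z)) (complexify b) h₁₂ h₄₃ =
        -LinearMap.id}

/-! ### Orthogonality of tubes -/

/-- The `Sp(4, ℝ)`-invariant Riemannian metric at `Z = X + iY` of the Siegel space,
`⟨U, V⟩ = Re tr(Y⁻¹ U Y⁻¹ V̄)`, on complex symmetric matrices `U, V`. -/
def siegelMetric (Z U V : Mat2 ℂ) : ℝ :=
  (Matrix.trace (toComplex (imMat Z)⁻¹ * U * toComplex (imMat Z)⁻¹ * conjMat V)).re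

/-- `V` is tangent to `S` at `Z`: it is the velocity at time `0` of a curve in `S` starting
at `Z`. -/
def IsTangentTo (S : Set (Mat2 ℂ)) (Z V : Mat2 ℂ) : Prop :=
  ∃ γ : ℝ → Mat2 ℂ, γ 0 = Z ∧ (∀ t, γ t ∈ S) ∧
    ∀ i j, HasDerivAt (fun t => γ t i j) (V i j) 0

/-- Two submanifolds of the Siegel space are orthogonal: they meet, and at every common point
their tangent spaces are orthogonal for the invariant metric. -/
def AreOrthogonal (S T : Set (Mat2 ℂ)) : Prop :=
  (S ∩ T).Nonempty ∧
    ∀ Z ∈ S ∩ T, ∀ U V, IsTangentTo S Z U → IsTangentTo T Z V → siegelMetric Z U V = 0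

/-! ### Ordered right-angled hexagons -/

/-- The tuple `(P₁, Q₆, Q₁, P₂, P₃, Q₂, Q₃, P₄, P₅, Q₄, Q₅, P₆)`; the six members of `P` and of
`Q` are numbered from `0` in the code. -/
def boundaryTuple (P Q : Fin 6 → Submodule ℝ (Vec4 ℝ)) : Fin 12 → Submodule ℝ (Vec4 ℝ) :=
  ![P 0, Q 5, Q 0, P 1, P 2, Q 1, Q 2, P 3, P 4, Q 3, Q 4, P 5]

/-- The tubes with endpoints `{P₁, P₂}, {Q₁, Q₂}, {P₃, P₄}, {Q₃, Q₄}, {P₅, P₆}, {Q₅, Q₆}`. -/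
def hexagonTubes (P Q : Fin 6 → Submodule ℝ (Vec4 ℝ)) : Fin 6 → Set (Mat2 ℂ) :=
  ![tube (P 0) (P 1), tube (Q 0) (Q 1), tube (P 2) (P 3), tube (Q 2) (Q 3), tube (P 4) (P 5),
    tube (Q 4) (Q 5)]

/-- An ordered right-angled hexagon `(H, 𝒴₁)`: a cyclic sequence of six tubes together with its
first member, that is, the sequence `(𝒴₁, …, 𝒴₆)`. Cyclically consecutive tubes are orthogonal
(`i + 1` is taken in `Fin 6`, so that the last tube is orthogonal to the first), and the tubes are
those of a maximal 12-tuple. -/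
structure OrderedHexagon where
  tubes : Fin 6 → Set (Mat2 ℂ)
  orthogonal : ∀ i, AreOrthogonal (tubes i) (tubes (i + 1))
  maximal : ∃ P Q, IsMaximalTuple (boundaryTuple P Q) ∧ tubes = hexagonTubes P Q

/-- `H = (P₂, Q₂, P₄, P₅, Q₅, P₁)` : the given 6-tuple consists of these members of a maximal
12-tuple of the ordered hexagon `H`. -/
def OrderedHexagon.HasSixTuple (H : OrderedHexagon) (l : Fin 6 → Submodule ℝ (Vec4 ℝ)) : Prop :=
  ∃ P Q, IsMaximalTuple (boundaryTuple P Q) ∧ H.tubes = hexagonTubes P Q ∧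
    l = ![P 1, Q 1, P 3, P 4, Q 4, P 0]

/-- Two ordered hexagons are isometric if an element of `Sp(4, ℝ)` carries the tubes of one to
the tubes of the other, in order. (`-Id` acts trivially on the Siegel space, so this is the same
as an element of `PSp(4, ℝ) = Sp(4, ℝ)/{±Id}`.) -/
def OrderedHexagon.Isometric (H H' : OrderedHexagon) : Prop :=
  ∃ g : Sp4, ∀ i, H'.tubes i = moebius g '' H.tubes i

/-- The space of ordered right-angled hexagons up to `PSp(4, ℝ)`. -/
def HexagonClasses := Quot OrderedHexagon.Isometric

/-! ### Arc coordinates -/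

/-- The chamber `{(x₁, x₂) | x₁ ≥ x₂ > 0}`. -/
abbrev Chamber := {x : ℝ × ℝ // x.1 ≥ x.2 ∧ x.2 > 0}

/-- The vector lies on the diagonal `{x₁ = x₂}`. -/
def Chamber.OnDiagonal (x : Chamber) : Prop := x.1.1 = x.1.2

/-- Angles in `[0, 2π)`. -/
abbrev AngleParam := Set.Ico (0 : ℝ) (2 * Real.pi)

/-- The class modulo `2π` of an angle parameter. -/
def angleMod (α : AngleParam) : Real.Angle := ((α : ℝ) : Real.Angle)

/-- Three length parameters and two angle parameters. -/
structure DecoratedArcCoordinates where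
  b : Chamber
  c : Chamber
  d : Chamber
  α₁ : AngleParam
  α₂ : AngleParam

/-- The identifications of arc coordinates; operations on angles are modulo `2π`. -/
inductive ArcRel : DecoratedArcCoordinates → DecoratedArcCoordinates → Prop
  /-- `(α₁, α₂) ∼ (2π - α₁, 2π - α₂)` -/
  | reflect (b c d : Chamber) (α₁ α₂ β₁ β₂ : AngleParam)
      (h₁ : angleMod β₁ = -angleMod α₁) (h₂ : angleMod β₂ = -angleMod α₂) :
      ArcRel ⟨b, c, d, α₁, α₂⟩ ⟨b, c, d, β₁, β₂⟩
  /-- if `b` is on the diagonal, the first angle is collapsed -/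
  | diag_b (b c d : Chamber) (α₁ α₂ β₁ : AngleParam) (hb : b.OnDiagonal) :
      ArcRel ⟨b, c, d, α₁, α₂⟩ ⟨b, c, d, β₁, α₂⟩
  /-- if `c` is on the diagonal, only the sum of the angles matters -/
  | diag_c (b c d : Chamber) (α₁ α₂ β₁ β₂ : AngleParam) (hc : c.OnDiagonal)
      (h : angleMod β₁ + angleMod β₂ = angleMod α₁ + angleMod α₂) :
      ArcRel ⟨b, c, d, α₁, α₂⟩ ⟨b, c, d, β₁, β₂⟩
  /-- if `d` is on the diagonal, the second angle is collapsed -/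
  | diag_d (b c d : Chamber) (α₁ α₂ β₂ : AngleParam) (hd : d.OnDiagonal) :
      ArcRel ⟨b, c, d, α₁, α₂⟩ ⟨b, c, d, α₁, β₂⟩

/-- The space `𝒜` of arc coordinates: the quotient by the equivalence relation generated by the
identifications. -/
def ArcCoordinates := Quot ArcRel

/-! ### The hexagon with given arc coordinates -/

/-- The rotation matrix of angle `α / 2`. -/
def rot (α : ℝ) : Mat2 ℝ :=
  !![Real.cos (α / 2), -Real.sin (α / 2); Real.sin (α / 2), Real.cos (α / 2)]

/-- `A = S₁ᵀ diag(e^{-b₂}, e^{-b₁}) S₁`. -/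
def matA (p : DecoratedArcCoordinates) : Mat2 ℝ :=
  (rot p.α₁)ᵀ * !![Real.exp (-p.b.1.2), 0; 0, Real.exp (-p.b.1.1)] * rot p.α₁

/-- `C = diag(e^{c₁}, e^{c₂})`. -/
def matC (p : DecoratedArcCoordinates) : Mat2 ℝ :=
  !![Real.exp p.c.1.1, 0; 0, Real.exp p.c.1.2]

/-- `D = M S₂ diag(e^{d₁}, e^{d₂}) S₂ᵀ Mᵀ` where `M` has rows `(0, √e^{c₁})`, `(-√e^{c₂}, 0)`. -/
def matD (p : DecoratedArcCoordinates) : Mat2 ℝ :=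
  !![0, √(Real.exp p.c.1.1); -√(Real.exp p.c.1.2), 0] * rot p.α₂ *
    !![Real.exp p.d.1.1, 0; 0, Real.exp p.d.1.2] * (rot p.α₂)ᵀ *
    !![0, -√(Real.exp p.c.1.2); √(Real.exp p.c.1.1), 0]

/-- The 6-tuple `(0, A, Id, C, D, ∞)` with arc coordinates `p`. -/
def sixTuple (p : DecoratedArcCoordinates) : Fin 6 → Submodule ℝ (Vec4 ℝ) :=
  ![graphLag 0, graphLag (matA p), graphLag 1, graphLag (matC p), graphLag (matD p), lagInf]

end SiegelHexagon

end

/-!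
A boundary 12-tuple of a right-angled hexagon is recovered from six of its members by reflections,
and six Lagrangians in maximal position are classified by the coordinates of the space `𝒜`.

*Tubes.* The tube with endpoints `l_∞, 0` is the set of purely imaginary points
(`mem_tube_lagInf_zero`), and the symplectic group carries tubes to tubes (`moebius_image_tube`).
A matrix preserving `{iT}` is block diagonal or block antidiagonal, so a tube determines its
endpoints up to order (`endpoints_of_tube_eq`); in a maximal 12-tuple the order is forced, whence
the sides of a hexagon determine the 12-tuple (`boundary_unique`).

*Orthogonality.* Maximal triples form a partial cyclic order, which around `l_∞` is the order on
symmetric matrices given by positive definite differences. For endpoints in the position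
`a, x, b, y`, orthogonality of the tubes `a, b` and `x, y` means that `(a, x, b, y)` lies in the
orbit of `(∞, -Id, 0, Id)` (`IsHarmonic.areOrthogonal`, `IsHarmonic.of_areOrthogonal`). For the
second implication one moves a common point to `i`: the tangent vectors of `{iT}` at `i` are all
imaginary symmetric matrices, so orthogonality forces the radial direction of the other tube to
be real, and this already pins down its endpoints.

*Hexagons.* A harmonic quadruple is determined by three of its members, and two sides in maximal
position have exactly one common perpendicular: in the normal form `(∞, 0, Id, S)` its endpoints
are `±√S` (`exists_common_perpendicular`, `common_perpendicular_unique`). Hence a 12-tuple is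
determined by `(P₂, Q₂, P₄, P₅, Q₅, P₁)` (`IsHarmonicHexagon.unique`). Conversely every tuple
`(0, A, Id, C, D, ∞)` with `0 < A < Id < C < D` extends to a hexagon (`exists_hexagon`): reflect,
and take the common perpendicular; its endpoints lie in the correct intervals because reflections
reverse the cyclic order (`common_perpendicular_position`).

*Coordinates.* Hexagons therefore correspond, up to isometry, to triples `0 < A < Id < C < D` up to
conjugation by the stabiliser `O(2)` of `(∞, 0, Id)`. Diagonalising `C` and writing `A` and
`C^{-1/2} D C^{-1/2}` in polar form `polarMat m ρ φ`, on which the rotation of angle `θ / 2` acts by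
`φ ↦ φ + θ` and the axis reflection by `φ ↦ -φ`, gives the lengths and angles, and the residual
conjugations are exactly the identifications defining `𝒜` (`sixTuple_equiv_iff`).
-/

noncomputable section

namespace SiegelHexagon

open scoped Matrix ComplexOrder

open Filter Topology

/-! ### Positive definite two-by-two matrices -/

theorem conjTranspose_eq_transpose_real {m n : Type*} (M : Matrix m n ℝ) : Mᴴ = Mᵀ :=
  Matrix.conjTranspose_eq_transpose_of_trivial M

theorem posDef_symm {S : Mat2 ℝ} (hS : S.PosDef) : Sᵀ = S := by
  have := hS.isHermitian.eq
  rwa [conjTranspose_eq_transpose_real] at this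

theorem posDef_isUnit_det {S : Mat2 ℝ} (hS : S.PosDef) : IsUnit S.det :=
  (Matrix.isUnit_iff_isUnit_det _).1 hS.isUnit

theorem posDef_congr {S B : Mat2 ℝ} (hS : S.PosDef) (hB : IsUnit B.det) :
    (B * S * Bᵀ).PosDef := by
  have h := (Matrix.IsUnit.posDef_star_right_conjugate_iff (x := S)
    ((Matrix.isUnit_iff_isUnit_det B).2 hB)).2 hS
  rwa [Matrix.star_eq_conjTranspose, conjTranspose_eq_transpose_real] at h

theorem posDef_two_iff {S : Mat2 ℝ} :
    S.PosDef ↔ S 0 1 = S 1 0 ∧ 0 < S 0 0 ∧ 0 < S 0 0 * S 1 1 - S 0 1 * S 0 1 := by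
  constructor
  · intro h
    have h0 : S 0 1 = S 1 0 := by
      have := congrFun (congrFun (posDef_symm h) 1) 0
      simpa using this
    have hd := h.det_pos
    rw [Matrix.det_fin_two, ← h0] at hd
    exact ⟨h0, h.diag_pos, hd⟩
  · rintro ⟨h0, h1, h2⟩
    refine Matrix.PosDef.of_dotProduct_mulVec_pos ?_ ?_
    · ext i j
      fin_cases i <;> fin_cases j <;> simp [h0]
    · intro x hx
      have hx' : x 0 ≠ 0 ∨ x 1 ≠ 0 := by
        by_contra hcon
        push Not at hcon
        exact hx (by ext i; fin_cases i <;> simp [hcon])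
      have key : 0 < S 0 0 * (x 0 * (S 0 0 * x 0 + S 0 1 * x 1)
          + x 1 * (S 0 1 * x 0 + S 1 1 * x 1)) := by
        have e : S 0 0 * (x 0 * (S 0 0 * x 0 + S 0 1 * x 1)
          + x 1 * (S 0 1 * x 0 + S 1 1 * x 1)) = (S 0 0 * x 0 + S 0 1 * x 1) ^ 2 +
            (S 0 0 * S 1 1 - S 0 1 * S 0 1) * x 1 ^ 2 := by ring
        rw [e]
        by_cases hx1 : x 1 = 0
        · have hx0 : x 0 ≠ 0 := by tauto
          have : 0 < (S 0 0 * x 0) ^ 2 := by positivity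
          simpa [hx1] using this
        · have : 0 < (S 0 0 * S 1 1 - S 0 1 * S 0 1) * x 1 ^ 2 := by positivity
          positivity
      have := pos_of_mul_pos_right key h1.le
      simpa [Matrix.mulVec, dotProduct, Fin.sum_univ_two, ← h0] using this

theorem exists_mul_transpose {S : Mat2 ℝ} (hS : S.PosDef) :
    ∃ B : Mat2 ℝ, IsUnit B.det ∧ B * Bᵀ = S := by
  obtain ⟨h0, h1, h2⟩ := posDef_two_iff.1 hS
  have ha : √(S 0 0) ≠ 0 := by positivity
  have hb : √(S 0 0) * √(S 0 0) = S 0 0 := Real.mul_self_sqrt h1.le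
  have hq : 0 < (S 0 0 * S 1 1 - S 0 1 * S 0 1) / S 0 0 := by positivity
  have hc := Real.mul_self_sqrt hq.le
  set q := (S 0 0 * S 1 1 - S 0 1 * S 0 1) / S 0 0 with hqdef
  have hq0 : √q ≠ 0 := (Real.sqrt_pos.2 hq).ne'
  refine ⟨!![√(S 0 0), 0; S 0 1 / √(S 0 0), √q], ?_, ?_⟩
  · rw [Matrix.det_fin_two_of, isUnit_iff_ne_zero]
    simp [ha, hq0]
  · ext i j
    fin_cases i <;> fin_cases j
    · simp [Matrix.mul_apply, hb]
    · simp [Matrix.mul_apply]; field_simp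
    · simp [Matrix.mul_apply]; field_simp; exact h0
    · have : S 0 1 / √(S 0 0) * (S 0 1 / √(S 0 0)) = S 0 1 * S 0 1 / S 0 0 := by
        rw [div_mul_div_comm, hb]
      have e : S 0 1 / √(S 0 0) * (S 0 1 / √(S 0 0)) + √q * √q = S 1 1 := by
        rw [this, hc, hqdef]
        field_simp
        ring
      simpa [Matrix.mul_apply, Fin.sum_univ_two] using e

/-- Uniqueness of the positive definite square root, from the Cayley–Hamilton identity
`X² = (tr X) X - det X`. -/
theorem posDef_sq_injective {X Y : Mat2 ℝ} (hX : X.PosDef) (hY : Y.PosDef) (h : X * X = Y * Y) :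
    X = Y := by
  obtain ⟨x0, x1, x2⟩ := posDef_two_iff.1 hX
  obtain ⟨y0, y1, y2⟩ := posDef_two_iff.1 hY
  have x3 : 0 < X 1 1 := hX.diag_pos
  have y3 : 0 < Y 1 1 := hY.diag_pos
  have hd : X.det = Y.det := by
    have h' := congrArg Matrix.det h
    rw [Matrix.det_mul, Matrix.det_mul] at h'
    nlinarith [hX.det_pos, hY.det_pos]
  rw [Matrix.det_fin_two, Matrix.det_fin_two] at hd
  have e00 := congrFun (congrFun h 0) 0
  have e01 := congrFun (congrFun h 0) 1
  have e11 := congrFun (congrFun h 1) 1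
  simp only [Matrix.mul_apply, Fin.sum_univ_two] at e00 e01 e11
  have ht : X 0 0 + X 1 1 = Y 0 0 + Y 1 1 := by
    have : (X 0 0 + X 1 1) ^ 2 = (Y 0 0 + Y 1 1) ^ 2 := by linear_combination e00 + e11 + 2 * hd
    nlinarith
  have htp : Y 0 0 + Y 1 1 ≠ 0 := by positivity
  have k00 : X 0 0 = Y 0 0 := mul_left_cancel₀ htp (by linear_combination e00 + hd - X 0 0 * ht)
  have k11 : X 1 1 = Y 1 1 := mul_left_cancel₀ htp (by linear_combination e11 + hd - X 1 1 * ht)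
  have k01 : X 0 1 = Y 0 1 := mul_left_cancel₀ htp (by linear_combination e01 - X 0 1 * ht)
  ext i j
  fin_cases i <;> fin_cases j
  · exact k00
  · exact k01
  · simpa [← x0, ← y0] using k01
  · exact k11

/-- Uniqueness of the positive definite solution `X` of `X R X = S`. -/
theorem posDef_mul_mul_injective {X Y R : Mat2 ℝ} (hR : R.PosDef) (hX : X.PosDef) (hY : Y.PosDef)
    (h : X * R * X = Y * R * Y) : X = Y := by
  obtain ⟨B, hB, rfl⟩ := exists_mul_transpose hR
  have hB' : IsUnit Bᵀ.det := by rwa [Matrix.det_transpose]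
  have hX' := posDef_congr hX hB'
  have hY' := posDef_congr hY hB'
  rw [Matrix.transpose_transpose] at hX' hY'
  have key := posDef_sq_injective hX' hY' (by
    calc Bᵀ * X * B * (Bᵀ * X * B) = Bᵀ * (X * (B * Bᵀ) * X) * B := by noncomm_ring
      _ = Bᵀ * (Y * (B * Bᵀ) * Y) * B := by rw [h]
      _ = _ := by noncomm_ring)
  have hu := (Matrix.isUnit_iff_isUnit_det B).2 hB
  have hu' := (Matrix.isUnit_iff_isUnit_det Bᵀ).2 hB'
  exact hu'.mul_left_cancel (hu.mul_right_cancel key)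

/-! ### Linear subspaces spanned by the columns of a matrix -/

/-- The span of the columns of a `4 × 2` matrix. -/
def colSpan {K : Type} [Field K] (M : Matrix (Fin 2 ⊕ Fin 2) (Fin 2) K) :
    Submodule K (Vec4 K) :=
  LinearMap.range M.mulVecLin

section Field

variable {K : Type} [Field K]

theorem graphLag_eq_colSpan (Z : Mat2 K) : graphLag Z = colSpan (Matrix.fromRows Z 1) := rfl

theorem lagInf_eq_colSpan : lagInf = colSpan (Matrix.fromRows (1 : Mat2 ℝ) 0) := rfl

theorem map_colSpan (G : Matrix (Fin 2 ⊕ Fin 2) (Fin 2 ⊕ Fin 2) K)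
    (M : Matrix (Fin 2 ⊕ Fin 2) (Fin 2) K) :
    (colSpan M).map G.mulVecLin = colSpan (G * M) := by
  rw [colSpan, colSpan, Matrix.mulVecLin_mul, LinearMap.range_comp]

theorem colSpan_mul_of_isUnit (M : Matrix (Fin 2 ⊕ Fin 2) (Fin 2) K) {Q : Mat2 K}
    (hQ : IsUnit Q.det) : colSpan (M * Q) = colSpan M := by
  have : LinearMap.range Q.mulVecLin = ⊤ := by
    rw [LinearMap.range_eq_top]
    intro v
    exact ⟨Q⁻¹ *ᵥ v, by
      rw [Matrix.mulVecLin_apply, Matrix.mulVec_mulVec, Matrix.mul_nonsing_inv Q hQ,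
        Matrix.one_mulVec]⟩
  rw [colSpan, Matrix.mulVecLin_mul, LinearMap.range_comp, this, Submodule.map_top, colSpan]

theorem fromBlocks_mul_fromRows (A B C D P Q : Mat2 K) :
    Matrix.fromBlocks A B C D * Matrix.fromRows P Q =
      Matrix.fromRows (A * P + B * Q) (C * P + D * Q) := by
  rw [← Matrix.fromRows_fromCols_eq_fromBlocks, Matrix.fromRows_mul,
    Matrix.fromCols_mul_fromRows, Matrix.fromCols_mul_fromRows]

theorem mem_graphLag {Z : Mat2 K} {v : Vec4 K} :
    v ∈ graphLag Z ↔ v ∘ Sum.inl = Z *ᵥ (v ∘ Sum.inr) := by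
  constructor
  · rintro ⟨u, rfl⟩
    simp [Matrix.fromRows_mulVec]
  · intro h
    refine ⟨v ∘ Sum.inr, ?_⟩
    rw [Matrix.mulVecLin_apply, Matrix.fromRows_mulVec, ← h, Matrix.one_mulVec]
    exact Sum.elim_comp_inl_inr v

theorem mem_lagInf {v : Vec4 ℝ} : v ∈ lagInf ↔ v ∘ Sum.inr = 0 := by
  constructor
  · rintro ⟨u, rfl⟩
    simp [Matrix.fromRows_mulVec]
  · intro h
    refine ⟨v ∘ Sum.inl, ?_⟩
    rw [Matrix.mulVecLin_apply, Matrix.fromRows_mulVec, Matrix.zero_mulVec, ← h,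
      Matrix.one_mulVec]
    exact Sum.elim_comp_inl_inr v

theorem graphLag_injective : Function.Injective (graphLag (K := K)) := by
  intro Z W h
  refine Matrix.mulVec_injective (funext fun u => ?_)
  have : (Sum.elim (Z *ᵥ u) u : Vec4 K) ∈ graphLag W := by
    rw [← h, mem_graphLag]
    simp
  rw [mem_graphLag] at this
  simpa using this

theorem map_graphLag {A B C D Z W : Mat2 K} (hu : IsUnit (C * Z + D).det)
    (h : A * Z + B = W * (C * Z + D)) :
    (graphLag Z).map (Matrix.fromBlocks A B C D).mulVecLin = graphLag W := by
  have : Matrix.fromRows (A * Z + B) (C * Z + D) = Matrix.fromRows W 1 * (C * Z + D) := by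
    rw [Matrix.fromRows_mul, one_mul, h]
  rw [graphLag_eq_colSpan, map_colSpan, fromBlocks_mul_fromRows, mul_one, mul_one, this,
    colSpan_mul_of_isUnit _ hu, ← graphLag_eq_colSpan]

end Field

/-! ### The action of the symplectic group on subspaces -/

theorem actLag_mul (g h : Sp4) (l : Submodule ℝ (Vec4 ℝ)) :
    actLag (g * h) l = actLag g (actLag h l) := by
  rw [actLag, actLag, actLag, ← Submodule.map_comp, ← Matrix.mulVecLin_mul]
  rfl

theorem actLag_one (l : Submodule ℝ (Vec4 ℝ)) : actLag 1 l = l := by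
  rw [actLag]
  simp

theorem actLag_inv_actLag (g : Sp4) (l : Submodule ℝ (Vec4 ℝ)) : actLag g⁻¹ (actLag g l) = l := by
  rw [← actLag_mul, inv_mul_cancel, actLag_one]

theorem actLag_actLag_inv (g : Sp4) (l : Submodule ℝ (Vec4 ℝ)) : actLag g (actLag g⁻¹ l) = l := by
  rw [← actLag_mul, mul_inv_cancel, actLag_one]

/-- The block relations of a symplectic matrix. -/
theorem sp_blocks (g : Sp4) :
    ∃ A B C D : Mat2 ℝ, g.1 = Matrix.fromBlocks A B C D ∧
      Aᵀ * C = Cᵀ * A ∧ Bᵀ * D = Dᵀ * B ∧ Aᵀ * D - Cᵀ * B = 1 := by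
  refine ⟨g.1.toBlocks₁₁, g.1.toBlocks₁₂, g.1.toBlocks₂₁, g.1.toBlocks₂₂,
    (Matrix.fromBlocks_toBlocks g.1).symm, ?_⟩
  apply SymplecticGroup.fromBlocks_mem_iff.1
  rw [Matrix.fromBlocks_toBlocks]
  exact g.2

/-- The translation `Z ↦ Z + X`. -/
def transl (X : Mat2 ℝ) (hX : Xᵀ = X) : Sp4 :=
  ⟨Matrix.fromBlocks 1 X 0 1, SymplecticGroup.fromBlocks_mem_iff.2 (by simp [hX])⟩

/-- The congruence `Z ↦ B Z Bᵀ`. -/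
def levi (B : Mat2 ℝ) (hB : IsUnit B.det) : Sp4 :=
  ⟨Matrix.fromBlocks B 0 0 (B⁻¹)ᵀ, SymplecticGroup.fromBlocks_mem_iff.2 (by
    simp [← Matrix.transpose_mul, Matrix.nonsing_inv_mul _ hB])⟩

/-- The diagonal copy of `SL(2, ℝ)` in `Sp(4, ℝ)`, acting by scalar fractional linear
transformations. -/
def scalarSL (a b c d : ℝ) (h : a * d - b * c = 1) : Sp4 :=
  ⟨Matrix.fromBlocks (a • 1) (b • 1) (c • 1) (d • 1), SymplecticGroup.fromBlocks_mem_iff.2 (by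
    refine ⟨by simp [mul_comm, smul_smul], by simp [mul_comm, smul_smul], ?_⟩
    simp only [Matrix.transpose_smul, Matrix.transpose_one, smul_mul_smul_comm, mul_one]
    rw [← sub_smul, mul_comm c b, h, one_smul])⟩

theorem actLag_graphLag {g : Sp4} {A B C D X Y : Mat2 ℝ} (hg : g.1 = Matrix.fromBlocks A B C D)
    (hu : IsUnit (C * X + D).det) (h : A * X + B = Y * (C * X + D)) :
    actLag g (graphLag X) = graphLag Y := by
  rw [actLag, hg]
  exact map_graphLag hu h

theorem actLag_lagInf {g : Sp4} {A B C D : Mat2 ℝ} (hg : g.1 = Matrix.fromBlocks A B C D) :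
    actLag g lagInf = colSpan (Matrix.fromRows A C) := by
  rw [actLag, hg, lagInf_eq_colSpan, map_colSpan, fromBlocks_mul_fromRows]
  simp

theorem actLag_lagInf_eq_graphLag {g : Sp4} {A B C D Y : Mat2 ℝ}
    (hg : g.1 = Matrix.fromBlocks A B C D) (hu : IsUnit C.det) (h : A = Y * C) :
    actLag g lagInf = graphLag Y := by
  have : Matrix.fromRows A C = Matrix.fromRows Y 1 * C := by
    rw [Matrix.fromRows_mul, one_mul, h]
  rw [actLag_lagInf hg, this, colSpan_mul_of_isUnit _ hu, graphLag_eq_colSpan]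

theorem actLag_lagInf_eq_lagInf {g : Sp4} {A B D : Mat2 ℝ}
    (hg : g.1 = Matrix.fromBlocks A B 0 D) (hu : IsUnit A.det) :
    actLag g lagInf = lagInf := by
  have : Matrix.fromRows A (0 : Mat2 ℝ) = Matrix.fromRows (1 : Mat2 ℝ) (0 : Mat2 ℝ) * A := by
    rw [Matrix.fromRows_mul, one_mul, zero_mul]
  rw [actLag_lagInf hg, this, colSpan_mul_of_isUnit _ hu, lagInf_eq_colSpan]

theorem actLag_graphLag_eq_lagInf {g : Sp4} {A B C D X : Mat2 ℝ}
    (hg : g.1 = Matrix.fromBlocks A B C D) (hu : IsUnit (A * X + B).det) (h : C * X + D = 0) :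
    actLag g (graphLag X) = lagInf := by
  have : Matrix.fromRows (A * X + B) (0 : Mat2 ℝ) = Matrix.fromRows (1 : Mat2 ℝ) (0 : Mat2 ℝ) * (A * X + B) := by
    rw [Matrix.fromRows_mul, one_mul, zero_mul]
  rw [actLag, hg, graphLag_eq_colSpan, map_colSpan, fromBlocks_mul_fromRows, mul_one, mul_one, h,
    this, colSpan_mul_of_isUnit _ hu, lagInf_eq_colSpan]

theorem transl_lagInf (X : Mat2 ℝ) (hX : Xᵀ = X) : actLag (transl X hX) lagInf = lagInf :=
  actLag_lagInf_eq_lagInf rfl (by simp)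

theorem transl_graphLag (X : Mat2 ℝ) (hX : Xᵀ = X) (Y : Mat2 ℝ) :
    actLag (transl X hX) (graphLag Y) = graphLag (Y + X) :=
  actLag_graphLag rfl (by simp) (by simp)

theorem levi_lagInf (B : Mat2 ℝ) (hB : IsUnit B.det) : actLag (levi B hB) lagInf = lagInf :=
  actLag_lagInf_eq_lagInf rfl hB

theorem levi_graphLag (B : Mat2 ℝ) (hB : IsUnit B.det) (Y : Mat2 ℝ) :
    actLag (levi B hB) (graphLag Y) = graphLag (B * Y * Bᵀ) := by
  refine actLag_graphLag rfl ?_ ?_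
  · simpa [Matrix.det_transpose] using Matrix.isUnit_nonsing_inv_det B hB
  · rw [zero_mul, zero_add, add_zero, mul_assoc _ Bᵀ, ← Matrix.transpose_mul,
      Matrix.nonsing_inv_mul _ hB, Matrix.transpose_one, mul_one]

/-- The blocks of an element fixing `l_∞`. -/
theorem blocks_of_fix_lagInf {g : Sp4} (hg : actLag g lagInf = lagInf) :
    ∃ A B D : Mat2 ℝ, g.1 = Matrix.fromBlocks A B 0 D ∧ Bᵀ * D = Dᵀ * B ∧ Aᵀ * D = 1 := by
  obtain ⟨A, B, C, D, h, h1, h2, h3⟩ := sp_blocks g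
  have hC : C = 0 := by
    refine Matrix.mulVec_injective (funext fun u => ?_)
    have : (Matrix.fromRows A C).mulVecLin u ∈ lagInf := by
      rw [← hg, actLag_lagInf h]
      exact ⟨u, rfl⟩
    rw [mem_lagInf] at this
    simpa [Matrix.fromRows_mulVec] using this
  subst hC
  exact ⟨A, B, D, h, h2, by simpa using h3⟩

/-- An element fixing `l_∞` and the zero Lagrangian is a congruence. -/
theorem levi_of_fix {g : Sp4} (hg : actLag g lagInf = lagInf)
    (hg0 : actLag g (graphLag 0) = graphLag 0) : ∃ B hB, g = levi B hB := by
  obtain ⟨A, B, D, h, h2, h3⟩ := blocks_of_fix_lagInf hg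
  have hu : IsUnit A.det := by
    have := congrArg Matrix.det h3
    rw [Matrix.det_mul, Matrix.det_transpose, Matrix.det_one] at this
    exact IsUnit.of_mul_eq_one _ this
  have hB : B = 0 := by
    refine Matrix.mulVec_injective (funext fun u => ?_)
    have : (Matrix.fromRows B D).mulVecLin u ∈ graphLag (0 : Mat2 ℝ) := by
      rw [← hg0, actLag, h, graphLag_eq_colSpan, map_colSpan, fromBlocks_mul_fromRows]
      exact ⟨u, by simp⟩
    rw [mem_graphLag] at this
    simpa [Matrix.fromRows_mulVec] using this
  refine ⟨A, hu, Subtype.ext ?_⟩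
  have hD : D = (A⁻¹)ᵀ := by
    rw [Matrix.transpose_nonsing_inv]
    exact (Matrix.inv_eq_right_inv h3).symm
  rw [h, hB, hD]
  rfl

/-! ### Maximal triples form a partial cyclic order -/

theorem IsMaximalTriple.act {a b c : Submodule ℝ (Vec4 ℝ)} (h : IsMaximalTriple a b c)
    (g : Sp4) : IsMaximalTriple (actLag g a) (actLag g b) (actLag g c) := by
  obtain ⟨k, rfl, rfl, rfl⟩ := h
  exact ⟨g * k, by simp only [actLag_mul], by simp only [actLag_mul], by simp only [actLag_mul]⟩

theorem isMaximalTriple_act_iff (g : Sp4) {a b c : Submodule ℝ (Vec4 ℝ)} :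
    IsMaximalTriple (actLag g a) (actLag g b) (actLag g c) ↔ IsMaximalTriple a b c :=
  ⟨fun h => by simpa only [actLag_inv_actLag] using h.act g⁻¹, fun h => h.act g⟩

theorem IsMaximalTriple.exists_graphs {b c : Submodule ℝ (Vec4 ℝ)}
    (h : IsMaximalTriple lagInf b c) :
    ∃ X Y : Mat2 ℝ, b = graphLag X ∧ c = graphLag Y ∧ Xᵀ = X ∧ Yᵀ = Y ∧ (Y - X).PosDef := by
  obtain ⟨g, hg, rfl, rfl⟩ := h
  obtain ⟨A, B, D, h, h2, h3⟩ := blocks_of_fix_lagInf hg.symm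
  have h4 : D * Aᵀ = 1 := mul_eq_one_comm.1 h3
  have h5 : Dᵀ * A = 1 := by simpa using congrArg Matrix.transpose h3
  have h6 : A * Dᵀ = 1 := mul_eq_one_comm.1 h5
  have hA : IsUnit A.det := by
    have := congrArg Matrix.det h6
    rw [Matrix.det_mul, Matrix.det_one] at this
    exact IsUnit.of_mul_eq_one _ this
  have hD : IsUnit D.det := by
    have := congrArg Matrix.det h4
    rw [Matrix.det_mul, Matrix.det_one] at this
    exact IsUnit.of_mul_eq_one _ this
  have hX : (B * Aᵀ)ᵀ = B * Aᵀ := by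
    calc (B * Aᵀ)ᵀ = A * Bᵀ := by simp
      _ = A * Bᵀ * (D * Aᵀ) := by rw [h4, mul_one]
      _ = A * (Bᵀ * D) * Aᵀ := by noncomm_ring
      _ = A * Dᵀ * B * Aᵀ := by rw [h2]; noncomm_ring
      _ = B * Aᵀ := by rw [h6, one_mul]
  have hP : (A * Aᵀ)ᵀ = A * Aᵀ := by simp
  refine ⟨B * Aᵀ, (A + B) * Aᵀ, ?_, ?_, hX, ?_, ?_⟩
  · refine actLag_graphLag h (by simpa using hD) ?_
    rw [mul_zero, zero_add, mul_zero, zero_add, mul_assoc, h3, mul_one]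
  · refine actLag_graphLag h (by simpa using hD) ?_
    rw [zero_mul, zero_add, mul_one, mul_assoc, h3, mul_one]
  · rw [add_mul, Matrix.transpose_add, hX, hP]
  · have := posDef_congr Matrix.PosDef.one hA
    rw [mul_one] at this
    rwa [add_mul, add_sub_cancel_right]

theorem isMaximalTriple_of_posDef {X Y : Mat2 ℝ} (hX : Xᵀ = X) (h : (Y - X).PosDef) :
    IsMaximalTriple lagInf (graphLag X) (graphLag Y) := by
  obtain ⟨B, hB, hBS⟩ := exists_mul_transpose h
  refine ⟨transl X hX * levi B hB, ?_, ?_, ?_⟩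
  · rw [actLag_mul, levi_lagInf, transl_lagInf]
  · rw [actLag_mul, levi_graphLag, transl_graphLag]
    simp
  · rw [actLag_mul, levi_graphLag, transl_graphLag, mul_one, hBS, sub_add_cancel]

theorem isMaximalTriple_lagInf_iff {X Y : Mat2 ℝ} (hX : Xᵀ = X) :
    IsMaximalTriple lagInf (graphLag X) (graphLag Y) ↔ (Y - X).PosDef := by
  refine ⟨fun h => ?_, isMaximalTriple_of_posDef hX⟩
  obtain ⟨X', Y', h1, h2, -, -, h3⟩ := h.exists_graphs
  rwa [graphLag_injective h1, graphLag_injective h2]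

theorem IsMaximalTriple.rotate {a b c : Submodule ℝ (Vec4 ℝ)} (h : IsMaximalTriple a b c) :
    IsMaximalTriple b c a := by
  obtain ⟨g, rfl, rfl, rfl⟩ := h
  -- The scalar transformation `z ↦ 1 / (1 - z)` permutes `∞ → 0 → 1 → ∞`.
  refine ⟨g * scalarSL 0 1 (-1) 1 (by norm_num), ?_, ?_, ?_⟩ <;> rw [actLag_mul] <;> congr 1 <;>
    symm
  · exact actLag_lagInf_eq_graphLag rfl (by simp [Matrix.det_neg]) (by simp)
  · exact actLag_graphLag rfl (by simp) (by simp)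
  · exact actLag_graphLag_eq_lagInf rfl (by simp) (by simp)

theorem IsMaximalTriple.not_swap {a b c : Submodule ℝ (Vec4 ℝ)} (h : IsMaximalTriple a b c) :
    ¬ IsMaximalTriple a c b := by
  obtain ⟨g, rfl, rfl, rfl⟩ := h
  rw [isMaximalTriple_act_iff, isMaximalTriple_lagInf_iff (by simp)]
  intro h
  have := h.diag_pos (i := 0)
  norm_num at this

theorem IsMaximalTriple.trans {a b c d : Submodule ℝ (Vec4 ℝ)} (h : IsMaximalTriple a b c)
    (h' : IsMaximalTriple a c d) : IsMaximalTriple a b d := by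
  obtain ⟨g, ha, -, -⟩ := id h
  subst ha
  rw [← actLag_actLag_inv g b, ← actLag_actLag_inv g c, isMaximalTriple_act_iff] at h
  rw [← actLag_actLag_inv g d, ← actLag_actLag_inv g c, isMaximalTriple_act_iff] at h'
  rw [← actLag_actLag_inv g b, ← actLag_actLag_inv g d, isMaximalTriple_act_iff]
  obtain ⟨X, Y, hX, hY, sX, sY, hp⟩ := h.exists_graphs
  obtain ⟨Y', W, hY', hW, -, sW, hp'⟩ := h'.exists_graphs
  rw [hY] at hY'
  obtain rfl := graphLag_injective hY'
  rw [hX, hW]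
  refine isMaximalTriple_of_posDef sX ?_
  simpa using hp'.add hp

theorem IsMaximalTriple.trans' {a b c d : Submodule ℝ (Vec4 ℝ)} (h : IsMaximalTriple a b c)
    (h' : IsMaximalTriple a c d) : IsMaximalTriple b c d :=
  (h'.rotate.trans h.rotate.rotate).rotate.rotate

/-- A tuple is maximal as soon as its consecutive members are maximal together with the
first one. -/
theorem isMaximalTuple_of_chain {n : ℕ} {l : Fin (n + 1) → Submodule ℝ (Vec4 ℝ)}
    (h : ∀ i : ℕ, 0 < i → ∀ hi : i + 1 < n + 1,
      IsMaximalTriple (l 0) (l ⟨i, by omega⟩) (l ⟨i + 1, hi⟩)) :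
    IsMaximalTuple l := by
  have key : ∀ k i : ℕ, 0 < i → ∀ hi : i + k + 1 < n + 1,
      IsMaximalTriple (l 0) (l ⟨i, by omega⟩) (l ⟨i + k + 1, hi⟩) := by
    intro k
    induction k with
    | zero => exact fun i h0 hi => h i h0 hi
    | succ k ih => exact fun i h0 hi => (ih i h0 (by omega)).trans (h (i + k + 1) (by omega) hi)
  have key' : ∀ i j : Fin (n + 1), 0 < i → i < j → IsMaximalTriple (l 0) (l i) (l j) := by
    rintro ⟨i, hi⟩ ⟨j, hj⟩ h0 hij
    obtain ⟨k, rfl⟩ := Nat.exists_eq_add_of_lt (Fin.mk_lt_mk.1 hij)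
    exact key k i (Fin.mk_lt_mk.1 h0) hj
  intro i j k hij hjk
  rcases (Fin.zero_le i).eq_or_lt' with rfl | hi
  · exact key' j k hij hjk
  · exact (key' i j hi hij).trans' (key' j k (hi.trans hij) hjk)

theorem IsMaximalTuple.act {m : ℕ} {l : Fin m → Submodule ℝ (Vec4 ℝ)} (h : IsMaximalTuple l)
    (g : Sp4) : IsMaximalTuple fun i => actLag g (l i) :=
  fun i j k hij hjk => (h i j k hij hjk).act g

/-! ### Square roots and commuting products -/

theorem trace_mul_pos {P Q : Mat2 ℝ} (hP : P.PosDef) (hQ : Q.PosDef) : 0 < (P * Q).trace := by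
  obtain ⟨B, hB, rfl⟩ := exists_mul_transpose hP
  have h := (posDef_congr hQ (B := Bᵀ) (by rwa [Matrix.det_transpose])).trace_pos
  rwa [Matrix.transpose_transpose, mul_assoc, Matrix.trace_mul_comm, mul_assoc,
    Matrix.trace_mul_comm] at h

theorem posDef_mul_of_commute {P Q : Mat2 ℝ} (hP : P.PosDef) (hQ : Q.PosDef)
    (h : P * Q = Q * P) : (P * Q).PosDef := by
  have ht := trace_mul_pos hP hQ
  have hd : 0 < (P * Q).det := by
    rw [Matrix.det_mul]
    exact mul_pos hP.det_pos hQ.det_pos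
  have hs : (P * Q)ᵀ = P * Q := by
    rw [Matrix.transpose_mul, posDef_symm hP, posDef_symm hQ, h]
  have h0 : (P * Q) 1 0 = (P * Q) 0 1 := congrFun (congrFun hs 0) 1
  rw [Matrix.trace_fin_two] at ht
  rw [Matrix.det_fin_two, h0] at hd
  refine posDef_two_iff.2 ⟨h0.symm, ?_, hd⟩
  nlinarith [sq_nonneg ((P * Q) 0 1), sq_nonneg ((P * Q) 0 0)]

/-- The square root `(S + √det S) / √(tr S + 2 √det S)` of a positive definite matrix. -/
theorem exists_posDef_sq {S : Mat2 ℝ} (hS : S.PosDef) : ∃ X : Mat2 ℝ, X.PosDef ∧ X * X = S := by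
  obtain ⟨h0, h1, h2⟩ := posDef_two_iff.1 hS
  have h3 : 0 < S 1 1 := hS.diag_pos
  obtain ⟨δ, hδ, hδ2⟩ : ∃ δ : ℝ, 0 < δ ∧ δ * δ = S 0 0 * S 1 1 - S 0 1 * S 0 1 :=
    ⟨_, Real.sqrt_pos.2 h2, Real.mul_self_sqrt h2.le⟩
  have h4 : 0 < S 0 0 + S 1 1 + 2 * δ := by positivity
  obtain ⟨τ, hτ, hτ2⟩ : ∃ τ : ℝ, 0 < τ ∧ τ * τ = S 0 0 + S 1 1 + 2 * δ :=
    ⟨_, Real.sqrt_pos.2 h4, Real.mul_self_sqrt h4.le⟩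
  refine ⟨τ⁻¹ • (S + δ • 1), (hS.add (Matrix.PosDef.one.smul hδ)).smul (inv_pos.2 hτ), ?_⟩
  have key : (S + δ • 1) * (S + δ • 1) = (τ * τ) • S := by
    ext i j
    fin_cases i <;> fin_cases j <;> simp [Matrix.mul_apply, hτ2, ← h0]
    · linear_combination hδ2
    · ring
    · ring
    · linear_combination hδ2
  rw [smul_mul_smul_comm, key, smul_smul]
  have : τ⁻¹ * τ⁻¹ * (τ * τ) = 1 := by field_simp
  rw [this, one_smul]

/-- The square root is monotone at the identity. -/
theorem posDef_sub_one_of_sq {X : Mat2 ℝ} (hX : X.PosDef) (h : (X * X - 1).PosDef) :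
    (X - 1).PosDef := by
  have h1 : (X + 1).PosDef := hX.add Matrix.PosDef.one
  have hu := posDef_isUnit_det h1
  have e1 : (X * X - 1) = (X - 1) * (X + 1) := by noncomm_ring
  have e2 : (X * X - 1) = (X + 1) * (X - 1) := by noncomm_ring
  have e3 : (X * X - 1) * (X + 1)⁻¹ = X - 1 := by
    rw [e1, mul_assoc, Matrix.mul_nonsing_inv _ hu, mul_one]
  have e4 : (X + 1)⁻¹ * (X * X - 1) = X - 1 := by
    rw [e2, ← mul_assoc, Matrix.nonsing_inv_mul _ hu, one_mul]
  rw [← e3]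
  exact posDef_mul_of_commute h h1.inv (e3.trans e4.symm)

/-! ### Harmonic quadruples -/

/-- Harmonic quadruples of Lagrangians: the `Sp(4, ℝ)`-orbit of `(l_∞, -Id, 0, Id)`. They are the
maximal quadruples `(a, x, b, y)` such that the tubes with endpoints `a, b` and `x, y` are
orthogonal. -/
def IsHarmonic (a x b y : Submodule ℝ (Vec4 ℝ)) : Prop :=
  ∃ g : Sp4, a = actLag g lagInf ∧ x = actLag g (graphLag (-1)) ∧ b = actLag g (graphLag 0) ∧
    y = actLag g (graphLag 1)

theorem IsHarmonic.act {a x b y : Submodule ℝ (Vec4 ℝ)} (h : IsHarmonic a x b y) (g : Sp4) :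
    IsHarmonic (actLag g a) (actLag g x) (actLag g b) (actLag g y) := by
  obtain ⟨k, rfl, rfl, rfl, rfl⟩ := h
  exact ⟨g * k, by simp only [actLag_mul], by simp only [actLag_mul], by simp only [actLag_mul],
    by simp only [actLag_mul]⟩

theorem isHarmonic_act_iff (g : Sp4) {a x b y : Submodule ℝ (Vec4 ℝ)} :
    IsHarmonic (actLag g a) (actLag g x) (actLag g b) (actLag g y) ↔ IsHarmonic a x b y :=
  ⟨fun h => by simpa only [actLag_inv_actLag] using h.act g⁻¹, fun h => h.act g⟩

theorem inv_sqrt_two_mul : (√2 : ℝ)⁻¹ * (√2)⁻¹ = 1 / 2 := by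
  rw [← mul_inv, Real.mul_self_sqrt (by norm_num)]
  norm_num

/-- The Cayley transform `Z ↦ (Z - 1) (Z + 1)⁻¹`. -/
def cayley : Sp4 :=
  scalarSL (√2)⁻¹ (-(√2)⁻¹) (√2)⁻¹ (√2)⁻¹ (by linarith [inv_sqrt_two_mul])

theorem isUnit_det_smul_one {c : ℝ} (hc : c ≠ 0) : IsUnit (c • (1 : Mat2 ℝ)).det := by
  rw [Matrix.det_smul, Matrix.det_one, isUnit_iff_ne_zero]
  simpa using hc

theorem cayley_graphLag {X Y : Mat2 ℝ} (hu : IsUnit (X + 1).det) (h : X - 1 = Y * (X + 1)) :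
    actLag cayley (graphLag X) = graphLag Y := by
  have e : (√2 : ℝ)⁻¹ • (1 : Mat2 ℝ) * X + (√2 : ℝ)⁻¹ • 1 = (√2 : ℝ)⁻¹ • 1 * (X + 1) := by
    rw [mul_add, mul_one]
  refine actLag_graphLag rfl ?_ ?_
  · rw [e, Matrix.det_mul]
    exact (isUnit_det_smul_one (by positivity)).mul hu
  · rw [e, smul_mul_assoc, one_mul, smul_mul_assoc, one_mul, mul_smul_comm, ← h, neg_smul,
      smul_sub, sub_eq_add_neg]

theorem cayley_neg_one : actLag cayley (graphLag (-1)) = lagInf := by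
  refine actLag_graphLag_eq_lagInf rfl ?_ (by simp)
  have : (√2 : ℝ)⁻¹ • (1 : Mat2 ℝ) * (-1) + (-(√2)⁻¹ : ℝ) • 1 = (-2 * (√2)⁻¹ : ℝ) • 1 := by
    rw [mul_neg, mul_one, ← neg_smul, ← add_smul]
    congr 1
    ring
  rw [this]
  exact isUnit_det_smul_one (by simp)

theorem cayley_lagInf : actLag cayley lagInf = graphLag 1 :=
  actLag_lagInf_eq_graphLag rfl (isUnit_det_smul_one (by positivity)) (by simp)

theorem cayley_zero : actLag cayley (graphLag 0) = graphLag (-1) :=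
  cayley_graphLag (by simp) (by simp)

theorem cayley_one : actLag cayley (graphLag 1) = graphLag 0 := by
  refine cayley_graphLag ?_ (by simp)
  rw [← two_smul ℝ (1 : Mat2 ℝ)]
  exact isUnit_det_smul_one (by norm_num)

theorem IsHarmonic.rotate {a x b y : Submodule ℝ (Vec4 ℝ)} (h : IsHarmonic a x b y) :
    IsHarmonic x b y a := by
  obtain ⟨g, rfl, rfl, rfl, rfl⟩ := h
  rw [isHarmonic_act_iff, ← isHarmonic_act_iff cayley, cayley_lagInf, cayley_zero, cayley_one,
    cayley_neg_one]
  exact ⟨1, by simp only [actLag_one], by simp only [actLag_one], by simp only [actLag_one],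
    by simp only [actLag_one]⟩

theorem IsHarmonic.maximal {a x b y : Submodule ℝ (Vec4 ℝ)} (h : IsHarmonic a x b y) :
    IsMaximalTriple a x b := by
  obtain ⟨g, rfl, rfl, rfl, -⟩ := h
  rw [isMaximalTriple_act_iff]
  refine isMaximalTriple_of_posDef (by simp) ?_
  simpa using Matrix.PosDef.one

theorem IsHarmonic.of_posDef {X : Mat2 ℝ} (hX : X.PosDef) :
    IsHarmonic lagInf (graphLag (-X)) (graphLag 0) (graphLag X) := by
  obtain ⟨B, hB, rfl⟩ := exists_mul_transpose hX
  refine ⟨levi B hB, ?_, ?_, ?_, ?_⟩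
  · rw [levi_lagInf]
  · rw [levi_graphLag]
    simp
  · rw [levi_graphLag]
    simp
  · rw [levi_graphLag]
    simp

theorem IsHarmonic.exists_posDef {x y : Submodule ℝ (Vec4 ℝ)}
    (h : IsHarmonic lagInf x (graphLag 0) y) :
    ∃ X : Mat2 ℝ, X.PosDef ∧ x = graphLag (-X) ∧ y = graphLag X := by
  obtain ⟨g, h1, rfl, h2, rfl⟩ := h
  obtain ⟨B, hB, rfl⟩ := levi_of_fix h1.symm h2.symm
  refine ⟨B * Bᵀ, ?_, ?_, ?_⟩
  · simpa using posDef_congr Matrix.PosDef.one hB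
  · rw [levi_graphLag]
    simp
  · rw [levi_graphLag]
    simp

/-- The fourth member of a harmonic quadruple is determined by the other three. -/
theorem IsHarmonic.unique {a x b y y' : Submodule ℝ (Vec4 ℝ)} (h : IsHarmonic a x b y)
    (h' : IsHarmonic a x b y') : y = y' := by
  obtain ⟨g, rfl, rfl, rfl, rfl⟩ := h
  rw [← actLag_actLag_inv g y', isHarmonic_act_iff] at h'
  obtain ⟨X, hX, h1, h2⟩ := h'.exists_posDef
  have := graphLag_injective h1
  rw [← neg_inj.1 this] at h2
  rw [← h2, actLag_actLag_inv]

/-- If `0 < R < X`, then `X R⁻¹ X` is the image of `R` under the reflection in the tube with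
endpoints `-X` and `X`. -/
theorem IsHarmonic.of_lt {R X : Mat2 ℝ} (hR : R.PosDef) (h : (X - R).PosDef) :
    IsHarmonic (graphLag R) (graphLag X) (graphLag (X * R⁻¹ * X)) (graphLag (-X)) := by
  have main : ∀ r : Mat2 ℝ, r.PosDef → (1 - r).PosDef →
      IsHarmonic (graphLag r) (graphLag 1) (graphLag r⁻¹) (graphLag (-1)) := by
    intro r hr h1
    have hmax : IsMaximalTriple (graphLag (-1)) (graphLag r) (graphLag 1) := by
      refine (isMaximalTriple_of_posDef (by simp) ?_).trans'
        (isMaximalTriple_of_posDef (posDef_symm hr) h1)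
      rw [sub_neg_eq_add]
      exact hr.add Matrix.PosDef.one
    have hr1 : (r + 1).PosDef := hr.add Matrix.PosDef.one
    have hu := posDef_isUnit_det hr1
    have hur := posDef_isUnit_det hr
    have hcr : actLag cayley (graphLag r) = graphLag ((r - 1) * (r + 1)⁻¹) :=
      cayley_graphLag hu (by rw [mul_assoc, Matrix.nonsing_inv_mul _ hu, mul_one])
    rw [← isMaximalTriple_act_iff cayley, cayley_neg_one, cayley_one, hcr] at hmax
    obtain ⟨K', Z, hK, hZ, -, -, hp⟩ := hmax.exists_graphs
    obtain rfl := graphLag_injective hZ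
    obtain rfl := graphLag_injective hK
    rw [zero_sub] at hp
    have hcr' : actLag cayley (graphLag r⁻¹) = graphLag (-((r - 1) * (r + 1)⁻¹)) := by
      have e : r⁻¹ + 1 = (r + 1) * r⁻¹ := by
        rw [add_mul, Matrix.mul_nonsing_inv _ hur, one_mul, add_comm]
      refine cayley_graphLag ?_ ?_
      · rw [e, Matrix.det_mul]
        exact hu.mul (Matrix.isUnit_nonsing_inv_det r hur)
      · rw [e, neg_mul, ← mul_assoc, mul_assoc (r - 1), Matrix.nonsing_inv_mul _ hu, mul_one,
          sub_mul, Matrix.mul_nonsing_inv _ hur, one_mul, neg_sub]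
    rw [← isHarmonic_act_iff cayley, hcr, cayley_one, cayley_neg_one, hcr']
    have := IsHarmonic.of_posDef hp
    rw [neg_neg] at this
    exact this.rotate
  have hX : X.PosDef := by simpa using h.add hR
  obtain ⟨B, hB, rfl⟩ := exists_mul_transpose hX
  have hBi : B * B⁻¹ = 1 := Matrix.mul_nonsing_inv _ hB
  have hBi' : B⁻¹ * B = 1 := Matrix.nonsing_inv_mul _ hB
  have hBt : (B⁻¹)ᵀ * Bᵀ = 1 := by rw [← Matrix.transpose_mul, hBi, Matrix.transpose_one]
  have hBt' : Bᵀ * (B⁻¹)ᵀ = 1 := by rw [← Matrix.transpose_mul, hBi', Matrix.transpose_one]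
  have hBu : IsUnit B⁻¹.det := Matrix.isUnit_nonsing_inv_det B hB
  have hr := posDef_congr hR hBu
  have hRu := posDef_isUnit_det hR
  have e1 : B * (B⁻¹ * R * (B⁻¹)ᵀ) * Bᵀ = R := by
    calc _ = (B * B⁻¹) * R * ((B⁻¹)ᵀ * Bᵀ) := by noncomm_ring
      _ = R := by rw [hBi, hBt, one_mul, mul_one]
  have e2 : (B⁻¹ * R * (B⁻¹)ᵀ)⁻¹ = Bᵀ * R⁻¹ * B := by
    refine Matrix.inv_eq_right_inv ?_
    calc _ = B⁻¹ * R * ((B⁻¹)ᵀ * Bᵀ) * R⁻¹ * B := by noncomm_ring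
      _ = B⁻¹ * (R * R⁻¹) * B := by rw [hBt]; noncomm_ring
      _ = 1 := by rw [Matrix.mul_nonsing_inv _ hRu, mul_one, hBi']
  have h1 : (1 - B⁻¹ * R * (B⁻¹)ᵀ).PosDef := by
    have := posDef_congr h hBu
    have e : B⁻¹ * (B * Bᵀ - R) * (B⁻¹)ᵀ = 1 - B⁻¹ * R * (B⁻¹)ᵀ := by
      calc _ = (B⁻¹ * B) * (Bᵀ * (B⁻¹)ᵀ) - B⁻¹ * R * (B⁻¹)ᵀ := by noncomm_ring
        _ = _ := by rw [hBi', hBt', one_mul]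
    rwa [e] at this
  have := (main _ hr h1).act (levi B hB)
  simp only [levi_graphLag, e1, e2, mul_one, mul_neg, neg_mul] at this
  convert this using 2
  noncomm_ring

/-- The reflection in the tube with endpoints `p, q` reverses the cyclic order. -/
theorem IsHarmonic.maximal_iff {p q a a' x y : Submodule ℝ (Vec4 ℝ)} (h : IsHarmonic p a q a')
    (h' : IsHarmonic p x q y) : IsMaximalTriple p a x ↔ IsMaximalTriple p y a' := by
  obtain ⟨g, rfl, rfl, rfl, rfl⟩ := h
  rw [← actLag_actLag_inv g x, ← actLag_actLag_inv g y, isHarmonic_act_iff] at h'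
  rw [← actLag_actLag_inv g x, ← actLag_actLag_inv g y, isMaximalTriple_act_iff,
    isMaximalTriple_act_iff]
  obtain ⟨X, hX, h1, h2⟩ := h'.exists_posDef
  rw [h1, h2, isMaximalTriple_lagInf_iff (by simp), isMaximalTriple_lagInf_iff (posDef_symm hX),
    neg_sub_neg]

/-! ### Common perpendiculars -/

theorem exists_normal_form {p q r s : Submodule ℝ (Vec4 ℝ)} (h : IsMaximalTriple p q r)
    (h' : IsMaximalTriple p r s) : ∃ (g : Sp4) (S : Mat2 ℝ), (S - 1).PosDef ∧
      p = actLag g lagInf ∧ q = actLag g (graphLag 0) ∧ r = actLag g (graphLag 1) ∧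
      s = actLag g (graphLag S) := by
  obtain ⟨g, rfl, rfl, rfl⟩ := h
  rw [← actLag_actLag_inv g s, isMaximalTriple_act_iff] at h'
  obtain ⟨X, S, h1, h2, -, -, h3⟩ := h'.exists_graphs
  obtain rfl := graphLag_injective h1
  exact ⟨g, S, h3, rfl, rfl, rfl, by rw [← h2, actLag_actLag_inv]⟩

/-- Two tubes with endpoints `p, q` and `r, s` in maximal position have a common perpendicular.
In the normal form `(∞, 0, Id, S)` its endpoints are `±√S`. -/
theorem exists_common_perpendicular {p q r s : Submodule ℝ (Vec4 ℝ)}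
    (h : IsMaximalTriple p q r) (h' : IsMaximalTriple p r s) :
    ∃ x y, IsHarmonic p x q y ∧ IsHarmonic r y s x := by
  obtain ⟨g, S, hS, rfl, rfl, rfl, rfl⟩ := exists_normal_form h h'
  obtain ⟨X, hX, rfl⟩ := exists_posDef_sq (S := S) (by simpa using hS.add Matrix.PosDef.one)
  refine ⟨actLag g (graphLag (-X)), actLag g (graphLag X), (IsHarmonic.of_posDef hX).act g, ?_⟩
  have := (IsHarmonic.of_lt Matrix.PosDef.one (posDef_sub_one_of_sq hX hS)).act g
  simpa using this

theorem common_perpendicular_unique {p q r s x y x' y' : Submodule ℝ (Vec4 ℝ)}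
    (h : IsMaximalTriple p q r) (h' : IsMaximalTriple p r s)
    (h1 : IsHarmonic p x q y) (h2 : IsHarmonic r y s x)
    (h1' : IsHarmonic p x' q y') (h2' : IsHarmonic r y' s x') : x = x' ∧ y = y' := by
  obtain ⟨g, S, hS, rfl, rfl, rfl, rfl⟩ := exists_normal_form h h'
  have key : ∀ x y, IsHarmonic (actLag g lagInf) x (actLag g (graphLag 0)) y →
      IsHarmonic (actLag g (graphLag 1)) y (actLag g (graphLag S)) x →
      ∃ X : Mat2 ℝ, X.PosDef ∧ X * X = S ∧ x = actLag g (graphLag (-X)) ∧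
        y = actLag g (graphLag X) := by
    intro x y k1 k2
    have hm' : IsMaximalTriple (actLag g lagInf) (actLag g (graphLag 1)) y :=
      (k2.maximal.trans h'.rotate).rotate.rotate
    rw [← actLag_actLag_inv g x, ← actLag_actLag_inv g y, isHarmonic_act_iff] at k1 k2
    rw [← actLag_actLag_inv g y, isMaximalTriple_act_iff] at hm'
    obtain ⟨X, hX, e1, e2⟩ := k1.exists_posDef
    rw [e2, isMaximalTriple_lagInf_iff (by simp)] at hm'
    have k3 := IsHarmonic.of_lt Matrix.PosDef.one hm'
    rw [e1, e2] at k2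
    have k4 := k3.rotate.rotate.rotate.unique k2.rotate.rotate.rotate
    refine ⟨X, hX, by simpa using graphLag_injective k4, ?_, ?_⟩
    · rw [← e1, actLag_actLag_inv]
    · rw [← e2, actLag_actLag_inv]
  obtain ⟨X, hX, e, rfl, rfl⟩ := key x y h1 h2
  obtain ⟨X', hX', e', rfl, rfl⟩ := key x' y' h1' h2'
  obtain rfl := posDef_sq_injective hX hX' (e.trans e'.symm)
  exact ⟨rfl, rfl⟩

/-! ### Complexification of real matrices -/

theorem toComplex_mul {l m n : Type} [Fintype m] (M : Matrix l m ℝ) (N : Matrix m n ℝ) :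
    toComplex (M * N) = toComplex M * toComplex N :=
  Matrix.map_mul (f := Complex.ofRealHom)

theorem toComplex_add {m n : Type} (M N : Matrix m n ℝ) :
    toComplex (M + N) = toComplex M + toComplex N := by
  ext; simp [toComplex]

theorem toComplex_sub {m n : Type} (M N : Matrix m n ℝ) :
    toComplex (M - N) = toComplex M - toComplex N := by
  ext; simp [toComplex]

theorem toComplex_neg {m n : Type} (M : Matrix m n ℝ) : toComplex (-M) = -toComplex M := by
  ext; simp [toComplex]

theorem toComplex_transpose {m n : Type} (M : Matrix m n ℝ) :
    toComplex Mᵀ = (toComplex M)ᵀ := rfl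

theorem toComplex_one {n : Type} [DecidableEq n] : toComplex (1 : Matrix n n ℝ) = 1 := by
  simp [toComplex]

theorem toComplex_zero {m n : Type} : toComplex (0 : Matrix m n ℝ) = 0 := by
  ext; simp [toComplex]

theorem toComplex_injective {m n : Type} :
    Function.Injective (toComplex : Matrix m n ℝ → Matrix m n ℂ) :=
  Matrix.map_injective Complex.ofReal_injective

theorem toComplex_det (M : Mat2 ℝ) : (toComplex M).det = (M.det : ℂ) :=
  (RingHom.map_det Complex.ofRealHom M).symm

theorem toComplex_isUnit_det {M : Mat2 ℝ} (h : IsUnit M.det) : IsUnit (toComplex M).det := by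
  rw [toComplex_det, isUnit_iff_ne_zero]
  exact_mod_cast h.ne_zero

theorem toComplex_inv {M : Mat2 ℝ} (h : IsUnit M.det) : toComplex M⁻¹ = (toComplex M)⁻¹ := by
  refine (Matrix.inv_eq_right_inv ?_).symm
  rw [← toComplex_mul, Matrix.mul_nonsing_inv _ h, toComplex_one]

theorem conjMat_mul (M N : Mat2 ℂ) : conjMat (M * N) = conjMat M * conjMat N :=
  Matrix.map_mul

theorem conjMat_add (M N : Mat2 ℂ) : conjMat (M + N) = conjMat M + conjMat N := by
  ext; simp [conjMat]

theorem conjMat_one : conjMat 1 = 1 := by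
  simp [conjMat]

theorem conjMat_det (M : Mat2 ℂ) : (conjMat M).det = (starRingEnd ℂ) M.det :=
  (RingHom.map_det (starRingEnd ℂ) M).symm

theorem conjMat_isUnit_det {M : Mat2 ℂ} (h : IsUnit M.det) : IsUnit (conjMat M).det := by
  rw [conjMat_det]
  exact h.map _

theorem conjMat_inv {M : Mat2 ℂ} (h : IsUnit M.det) : conjMat M⁻¹ = (conjMat M)⁻¹ := by
  refine (Matrix.inv_eq_right_inv ?_).symm
  rw [← conjMat_mul, Matrix.mul_nonsing_inv _ h, conjMat_one]

theorem conjMat_toComplex (M : Mat2 ℝ) : conjMat (toComplex M) = toComplex M := by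
  ext; simp [conjMat, toComplex]

theorem conjMat_transpose (M : Mat2 ℂ) : conjMat Mᵀ = (conjMat M)ᵀ := rfl

theorem conjMat_conjMat (M : Mat2 ℂ) : conjMat (conjMat M) = M := by
  ext; simp [conjMat]

theorem conjTranspose_eq (M : Mat2 ℂ) : Mᴴ = (conjMat M)ᵀ := rfl

theorem sub_conjMat (Z : Mat2 ℂ) : Z - conjMat Z = (2 * Complex.I) • toComplex (imMat Z) := by
  ext i j
  simp only [conjMat, imMat, toComplex, Matrix.sub_apply, Matrix.map_apply, Matrix.smul_apply,
    smul_eq_mul]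
  apply Complex.ext <;> simp
  ring

theorem posDef_toComplex {M : Mat2 ℝ} (h : M.PosDef) : (toComplex M).PosDef := by
  obtain ⟨B, hB, rfl⟩ := exists_mul_transpose h
  have e : toComplex (B * Bᵀ) = toComplex B * (toComplex B)ᴴ := by
    rw [toComplex_mul, conjTranspose_eq, conjMat_toComplex, toComplex_transpose]
  rw [e]
  refine Matrix.PosDef.mul_conjTranspose_self _ ?_
  exact Matrix.vecMul_injective_of_isUnit
    ((Matrix.isUnit_iff_isUnit_det _).2 (toComplex_isUnit_det hB))

theorem posDef_of_toComplex {M : Mat2 ℝ} (h : (toComplex M).PosDef) : M.PosDef := by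
  have h0 := h.isHermitian.eq
  have h1 := h.diag_pos (i := 0)
  have h2 := h.det_pos
  have hs : M 0 1 = M 1 0 := by
    have := congrFun (congrFun h0 1) 0
    simpa [toComplex, Matrix.conjTranspose_apply] using this
  rw [toComplex_det, Matrix.det_fin_two, ← hs] at h2
  refine posDef_two_iff.2 ⟨hs, ?_, ?_⟩
  · simpa [toComplex] using h1
  · exact_mod_cast h2

/-! ### The Siegel space and fractional linear transformations -/

theorem siegel_transpose {Z : Mat2 ℂ} (hZ : Z ∈ siegelSpace) : Zᵀ = Z := by
  have h1 : (reMat Z)ᵀ = reMat Z := hZ.1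
  have h2 := posDef_symm hZ.2
  ext i j
  apply Complex.ext
  · exact congrFun (congrFun h1 i) j
  · exact congrFun (congrFun h2 i) j

theorem mem_siegelSpace {Z : Mat2 ℂ} (h : Zᵀ = Z) (hp : (toComplex (imMat Z)).PosDef) :
    Z ∈ siegelSpace := by
  refine ⟨?_, posDef_of_toComplex hp⟩
  ext i j
  exact congrArg Complex.re (congrFun (congrFun h i) j)

theorem siegel_quadratic_ne_zero {Z : Mat2 ℂ} (hZ : Z ∈ siegelSpace) {v : Fin 2 → ℂ}
    (hv : v ≠ 0) : star v ⬝ᵥ ((Z - conjMat Z) *ᵥ v) ≠ 0 := by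
  rw [sub_conjMat, Matrix.smul_mulVec, dotProduct_smul]
  have := (posDef_toComplex hZ.2).dotProduct_mulVec_pos hv
  exact smul_ne_zero (by simp) this.ne'

theorem siegel_isUnit_det {Z : Mat2 ℂ} (hZ : Z ∈ siegelSpace) : IsUnit Z.det := by
  rw [isUnit_iff_ne_zero]
  intro h
  obtain ⟨v, hv, hv0⟩ := Matrix.exists_mulVec_eq_zero_iff.2 h
  refine siegel_quadratic_ne_zero hZ hv ?_
  have e : conjMat Z = Zᴴ := by
    rw [conjTranspose_eq, ← conjMat_transpose, siegel_transpose hZ]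
  rw [Matrix.sub_mulVec, hv0, zero_sub, dotProduct_neg, e, Matrix.dotProduct_mulVec,
    ← Matrix.star_mulVec, hv0]
  simp

/-- The numerator `AZ + B` of the action of a symplectic matrix. -/
def num (g : Sp4) (Z : Mat2 ℂ) : Mat2 ℂ :=
  toComplex g.1.toBlocks₁₁ * Z + toComplex g.1.toBlocks₁₂

/-- The automorphy factor `CZ + D` of the action of a symplectic matrix. -/
def den (g : Sp4) (Z : Mat2 ℂ) : Mat2 ℂ :=
  toComplex g.1.toBlocks₂₁ * Z + toComplex g.1.toBlocks₂₂

theorem moebius_eq (g : Sp4) (Z : Mat2 ℂ) : moebius g Z = num g Z * (den g Z)⁻¹ := rfl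

theorem conjMat_num (g : Sp4) (Z : Mat2 ℂ) : conjMat (num g Z) = num g (conjMat Z) := by
  rw [num, num, conjMat_add, conjMat_mul, conjMat_toComplex, conjMat_toComplex]

theorem conjMat_den (g : Sp4) (Z : Mat2 ℂ) : conjMat (den g Z) = den g (conjMat Z) := by
  rw [den, den, conjMat_add, conjMat_mul, conjMat_toComplex, conjMat_toComplex]

/-- The symplectic relation in terms of numerators and denominators. -/
theorem den_transpose_mul_num (g : Sp4) (W Z : Mat2 ℂ) :
    (den g W)ᵀ * num g Z - (num g W)ᵀ * den g Z = Z - Wᵀ := by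
  obtain ⟨A, B, C, D, h, h1, h2, h3⟩ := sp_blocks g
  have k1 := congrArg toComplex h1
  have k2 := congrArg toComplex h2
  have k3 := congrArg toComplex h3
  have k4 : (toComplex D)ᵀ * toComplex A - (toComplex B)ᵀ * toComplex C = 1 := by
    have := congrArg toComplex (congrArg Matrix.transpose h3)
    simpa [toComplex_mul, toComplex_sub, toComplex_one, toComplex_transpose] using this
  simp only [toComplex_mul, toComplex_sub, toComplex_one, toComplex_transpose] at k1 k2 k3
  rw [num, num, den, den, h, Matrix.toBlocks_fromBlocks₁₁, Matrix.toBlocks_fromBlocks₁₂,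
    Matrix.toBlocks_fromBlocks₂₁, Matrix.toBlocks_fromBlocks₂₂]
  simp only [Matrix.transpose_add, Matrix.transpose_mul]
  set A' := toComplex A
  set B' := toComplex B
  set C' := toComplex C
  set D' := toComplex D
  calc (Wᵀ * C'ᵀ + D'ᵀ) * (A' * Z + B') - (Wᵀ * A'ᵀ + B'ᵀ) * (C' * Z + D')
      = -(Wᵀ * (A'ᵀ * C' - C'ᵀ * A') * Z) - Wᵀ * (A'ᵀ * D' - C'ᵀ * B')
        + (D'ᵀ * A' - B'ᵀ * C') * Z - (B'ᵀ * D' - D'ᵀ * B') := by noncomm_ring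
    _ = Z - Wᵀ := by
      rw [k1, k2, k3, k4]
      simp
      abel

theorem den_isUnit {Z : Mat2 ℂ} (hZ : Z ∈ siegelSpace) (g : Sp4) : IsUnit (den g Z).det := by
  rw [isUnit_iff_ne_zero]
  intro h
  obtain ⟨v, hv, hv0⟩ := Matrix.exists_mulVec_eq_zero_iff.2 h
  refine siegel_quadratic_ne_zero hZ hv ?_
  have key := den_transpose_mul_num g (conjMat Z) Z
  rw [← conjMat_den, ← conjMat_num, ← conjTranspose_eq, ← conjTranspose_eq, ← conjMat_transpose,
    siegel_transpose hZ] at key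
  rw [← key, Matrix.sub_mulVec, ← Matrix.mulVec_mulVec, ← Matrix.mulVec_mulVec, hv0,
    Matrix.mulVec_zero, sub_zero, Matrix.dotProduct_mulVec, ← Matrix.star_mulVec, hv0]
  simp

theorem moebius_mul_den {g : Sp4} {Z : Mat2 ℂ} (hu : IsUnit (den g Z).det) :
    moebius g Z * den g Z = num g Z := by
  rw [moebius_eq, mul_assoc, Matrix.nonsing_inv_mul _ hu, mul_one]

theorem den_mul_moebius_sub (g : Sp4) {W Z : Mat2 ℂ} (hW : IsUnit (den g W).det)
    (hZ : IsUnit (den g Z).det) :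
    (den g W)ᵀ * (moebius g Z - (moebius g W)ᵀ) * den g Z = Z - Wᵀ := by
  rw [← den_transpose_mul_num g W Z, ← moebius_mul_den hW, ← moebius_mul_den hZ,
    Matrix.transpose_mul]
  noncomm_ring

theorem moebius_transpose {g : Sp4} {Z : Mat2 ℂ} (hs : Zᵀ = Z) (hZ : IsUnit (den g Z).det) :
    (moebius g Z)ᵀ = moebius g Z := by
  have h := den_mul_moebius_sub g hZ hZ
  rw [hs, sub_self] at h
  have hu := (Matrix.isUnit_iff_isUnit_det _).2 hZ
  have hu' : IsUnit (den g Z)ᵀ := (Matrix.isUnit_iff_isUnit_det _).2 (by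
    rwa [Matrix.det_transpose])
  rw [hu.mul_left_eq_zero, hu'.mul_right_eq_zero, sub_eq_zero] at h
  exact h.symm

/-- The difference formula `gZ - gW = (CW + D)⁻ᵀ (Z - W) (CZ + D)⁻¹`, from which the derivative
of `g` and the imaginary part of `gZ` are read off. -/
theorem moebius_sub_moebius (g : Sp4) {W Z : Mat2 ℂ} (hWs : Wᵀ = W)
    (hW : IsUnit (den g W).det) (hZ : IsUnit (den g Z).det) :
    moebius g Z - moebius g W = ((den g W)⁻¹)ᵀ * (Z - W) * (den g Z)⁻¹ := by
  have h := den_mul_moebius_sub g hW hZ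
  rw [moebius_transpose hWs hW, hWs] at h
  have e : ((den g W)⁻¹)ᵀ * (den g W)ᵀ = 1 := by
    rw [← Matrix.transpose_mul, Matrix.mul_nonsing_inv _ hW, Matrix.transpose_one]
  rw [← h]
  calc moebius g Z - moebius g W
      = (((den g W)⁻¹)ᵀ * (den g W)ᵀ) * (moebius g Z - moebius g W)
        * (den g Z * (den g Z)⁻¹) := by
        rw [e, Matrix.mul_nonsing_inv _ hZ, one_mul, mul_one]
    _ = _ := by noncomm_ring

theorem conjMat_moebius {g : Sp4} {Z : Mat2 ℂ} (hZ : IsUnit (den g Z).det) :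
    conjMat (moebius g Z) = moebius g (conjMat Z) := by
  rw [moebius_eq, moebius_eq, conjMat_mul, conjMat_inv hZ, conjMat_num, conjMat_den]

theorem den_conj_isUnit {Z : Mat2 ℂ} (hZ : Z ∈ siegelSpace) (g : Sp4) :
    IsUnit (den g (conjMat Z)).det := by
  rw [← conjMat_den]
  exact conjMat_isUnit_det (den_isUnit hZ g)

theorem imMat_moebius (g : Sp4) {Z : Mat2 ℂ} (hZ : Z ∈ siegelSpace) :
    toComplex (imMat (moebius g Z)) =
      ((den g Z)⁻¹)ᴴ * toComplex (imMat Z) * (den g Z)⁻¹ := by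
  have hu := den_isUnit hZ g
  have hu' := den_conj_isUnit hZ g
  have h := moebius_sub_moebius g (W := conjMat Z) (Z := Z)
    (by rw [← conjMat_transpose, siegel_transpose hZ]) hu' hu
  rw [← conjMat_moebius hu, sub_conjMat, sub_conjMat, ← conjMat_den, ← conjMat_inv hu,
    ← conjTranspose_eq, mul_smul_comm, smul_mul_assoc] at h
  exact smul_right_injective _ (by simp : (2 * Complex.I) ≠ 0) h

theorem moebius_mem_siegelSpace (g : Sp4) {Z : Mat2 ℂ} (hZ : Z ∈ siegelSpace) :
    moebius g Z ∈ siegelSpace := by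
  have hu := den_isUnit hZ g
  refine mem_siegelSpace (moebius_transpose (siegel_transpose hZ) hu) ?_
  rw [imMat_moebius g hZ]
  have hu' := (Matrix.isUnit_iff_isUnit_det _).2 (Matrix.isUnit_nonsing_inv_det _ hu)
  exact (Matrix.IsUnit.posDef_star_left_conjugate_iff hu').2 (posDef_toComplex hZ.2)

/-! ### The action on complex subspaces -/

/-- The action of `Sp(4, ℝ)` on linear subspaces of `ℂ⁴`. -/
def actC (g : Sp4) (l : Submodule ℂ (Vec4 ℂ)) : Submodule ℂ (Vec4 ℂ) :=
  l.map (toComplex g.1).mulVecLin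

theorem actC_mul (g h : Sp4) (l : Submodule ℂ (Vec4 ℂ)) :
    actC (g * h) l = actC g (actC h l) := by
  rw [actC, actC, actC, ← Submodule.map_comp, ← Matrix.mulVecLin_mul, ← toComplex_mul]
  rfl

theorem actC_one (l : Submodule ℂ (Vec4 ℂ)) : actC 1 l = l := by
  rw [actC]
  simp [toComplex_one]

theorem actC_graphLag {g : Sp4} {Z : Mat2 ℂ} (hZ : IsUnit (den g Z).det) :
    actC g (graphLag Z) = graphLag (moebius g Z) := by
  have e : toComplex g.1 = Matrix.fromBlocks (toComplex g.1.toBlocks₁₁)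
      (toComplex g.1.toBlocks₁₂) (toComplex g.1.toBlocks₂₁) (toComplex g.1.toBlocks₂₂) := by
    conv_lhs => rw [← Matrix.fromBlocks_toBlocks g.1]
    exact Matrix.fromBlocks_map _ _ _ _ _
  rw [actC, e]
  exact map_graphLag hZ (moebius_mul_den hZ).symm

theorem moebius_mul (g h : Sp4) {Z : Mat2 ℂ} (hZ : Z ∈ siegelSpace) :
    moebius (g * h) Z = moebius g (moebius h Z) := by
  apply graphLag_injective
  rw [← actC_graphLag (den_isUnit hZ _), actC_mul, actC_graphLag (den_isUnit hZ _),
    actC_graphLag (den_isUnit (moebius_mem_siegelSpace h hZ) _)]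

theorem moebius_one (Z : Mat2 ℂ) (hZ : Z ∈ siegelSpace) : moebius 1 Z = Z := by
  apply graphLag_injective
  rw [← actC_graphLag (den_isUnit hZ _), actC_one]

theorem moebius_inv_moebius (g : Sp4) {Z : Mat2 ℂ} (hZ : Z ∈ siegelSpace) :
    moebius g⁻¹ (moebius g Z) = Z := by
  rw [← moebius_mul _ _ hZ, inv_mul_cancel, moebius_one Z hZ]

theorem moebius_moebius_inv (g : Sp4) {Z : Mat2 ℂ} (hZ : Z ∈ siegelSpace) :
    moebius g (moebius g⁻¹ Z) = Z := by
  rw [← moebius_mul _ _ hZ, mul_inv_cancel, moebius_one Z hZ]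

theorem complexify_actLag (g : Sp4) (l : Submodule ℝ (Vec4 ℝ)) :
    complexify (actLag g l) = actC g (complexify l) := by
  rw [complexify, complexify, actC, Submodule.map_span, actLag, Submodule.map_coe,
    Set.image_image, Set.image_image]
  congr 1
  refine Set.image_congr fun v _ => ?_
  ext i
  simp [Matrix.mulVec, dotProduct, toComplex, -Fintype.sum_sum_type]

theorem actC_isCompl (g : Sp4) {l l' : Submodule ℂ (Vec4 ℂ)} (h : IsCompl l l') :
    IsCompl (actC g l) (actC g l') := by
  have hb : Function.Bijective (toComplex g.1).mulVecLin := by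
    have h1 : toComplex (g⁻¹).1 * toComplex g.1 = 1 := by
      rw [← toComplex_mul, ← toComplex_one]
      exact congrArg toComplex (congrArg Subtype.val (inv_mul_cancel g))
    have h2 := mul_eq_one_comm.1 h1
    refine Function.bijective_iff_has_inverse.2 ⟨(toComplex (g⁻¹).1).mulVecLin, ?_, ?_⟩
    · intro v
      rw [Matrix.mulVecLin_apply, Matrix.mulVecLin_apply, Matrix.mulVec_mulVec, h1,
        Matrix.one_mulVec]
    · intro v
      rw [Matrix.mulVecLin_apply, Matrix.mulVecLin_apply, Matrix.mulVec_mulVec, h2,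
        Matrix.one_mulVec]
  exact (Submodule.orderIsoMapComapOfBijective _ hb).isCompl h

/-! ### Tubes -/

theorem crossRatio_eq_neg_id_iff {l₁ l₂ l₃ l₄ : Submodule ℂ (Vec4 ℂ)} (h₁₂ : IsCompl l₁ l₂)
    (h₄₃ : IsCompl l₄ l₃) :
    crossRatio l₁ l₂ l₃ l₄ h₁₂ h₄₃ = -LinearMap.id ↔
      ∀ v ∈ l₁, ∃ w ∈ l₄, v - w ∈ l₃ ∧ w + v ∈ l₂ := by
  constructor
  · intro h v hv
    refine ⟨l₄.projection l₃ h₄₃ v, Submodule.projection_apply_mem _ _, ?_, ?_⟩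
    · rw [← Submodule.projection_apply_eq_zero_iff h₄₃, map_sub, sub_eq_zero]
      exact (Submodule.projection_apply_left h₄₃
        ⟨_, Submodule.projection_apply_mem h₄₃ v⟩).symm
    · have h1 := LinearMap.congr_fun h ⟨v, hv⟩
      simp only [crossRatio, LinearMap.comp_apply, Submodule.subtype_apply, LinearMap.neg_apply,
        LinearMap.id_apply] at h1
      rw [← Submodule.projectionOnto_apply_eq_zero_iff h₁₂, map_add, h1,
        Submodule.projectionOnto_apply_of_mem_left h₁₂ hv, neg_add_cancel]
  · intro h
    ext1 ⟨v, hv⟩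
    obtain ⟨w, hw, h1, h2⟩ := h v hv
    simp only [crossRatio, LinearMap.comp_apply, Submodule.subtype_apply, LinearMap.neg_apply,
      LinearMap.id_apply]
    have e1 : l₄.projection l₃ h₄₃ v = w := by
      rw [← Submodule.projection_apply_eq_zero_iff h₄₃, map_sub, sub_eq_zero] at h1
      rw [h1, Submodule.projection_apply_of_mem_left h₄₃ hw]
    rw [e1, ← Submodule.projectionOnto_apply_of_mem_left h₁₂ hv, eq_neg_iff_add_eq_zero, ← map_add,
      Submodule.projectionOnto_apply_eq_zero_iff]
    exact h2

theorem mem_tube_iff {a b : Submodule ℝ (Vec4 ℝ)} {Z : Mat2 ℂ} :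
    Z ∈ tube a b ↔ Z ∈ siegelSpace ∧ IsCompl (complexify a) (graphLag Z) ∧
      IsCompl (complexify b) (graphLag (conjMat Z)) ∧
      ∀ v ∈ complexify a, ∃ w ∈ complexify b, v - w ∈ graphLag (conjMat Z) ∧
        w + v ∈ graphLag Z := by
  refine and_congr_right fun _ => ⟨?_, ?_⟩
  · rintro ⟨h1, h2, h⟩
    exact ⟨h1, h2, (crossRatio_eq_neg_id_iff h1 h2).1 h⟩
  · rintro ⟨h1, h2, h⟩
    exact ⟨h1, h2, (crossRatio_eq_neg_id_iff h1 h2).2 h⟩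

theorem moebius_mem_tube (g : Sp4) {a b : Submodule ℝ (Vec4 ℝ)} {Z : Mat2 ℂ}
    (h : Z ∈ tube a b) : moebius g Z ∈ tube (actLag g a) (actLag g b) := by
  obtain ⟨hZ, h1, h2, h3⟩ := mem_tube_iff.1 h
  rw [mem_tube_iff, conjMat_moebius (den_isUnit hZ g), ← actC_graphLag (den_isUnit hZ g),
    ← actC_graphLag (den_conj_isUnit hZ g), complexify_actLag, complexify_actLag]
  refine ⟨moebius_mem_siegelSpace g hZ, actC_isCompl g h1, actC_isCompl g h2, ?_⟩
  rintro _ ⟨v, hv, rfl⟩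
  obtain ⟨w, hw, h4, h5⟩ := h3 v hv
  refine ⟨_, ⟨w, hw, rfl⟩, ⟨_, h4, ?_⟩, ⟨_, h5, ?_⟩⟩
  · rw [map_sub]
  · rw [map_add]

theorem moebius_image_tube (g : Sp4) (a b : Submodule ℝ (Vec4 ℝ)) :
    moebius g '' tube a b = tube (actLag g a) (actLag g b) := by
  ext Z
  constructor
  · rintro ⟨W, hW, rfl⟩
    exact moebius_mem_tube g hW
  · intro h
    have := moebius_mem_tube g⁻¹ h
    rw [actLag_inv_actLag, actLag_inv_actLag] at this
    exact ⟨_, this, moebius_moebius_inv g h.1⟩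

theorem complexify_colSpan (M : Matrix (Fin 2 ⊕ Fin 2) (Fin 2) ℝ) :
    complexify (colSpan M) = colSpan (toComplex M) := by
  have hcast : ∀ u : Fin 2 → ℝ,
      (fun i => ((M *ᵥ u) i : ℂ)) = toComplex M *ᵥ (fun j => (u j : ℂ)) := by
    intro u
    ext i
    simp [Matrix.mulVec, dotProduct, toComplex]
  apply le_antisymm
  · rw [complexify, Submodule.span_le]
    rintro _ ⟨_, ⟨u, rfl⟩, rfl⟩
    exact ⟨fun j => (u j : ℂ), (hcast u).symm⟩
  · rintro _ ⟨u, rfl⟩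
    have e : u = (fun j => ((Complex.re (u j) : ℝ) : ℂ)) +
        Complex.I • (fun j => ((Complex.im (u j) : ℝ) : ℂ)) := by
      ext j
      simp [mul_comm Complex.I, Complex.re_add_im]
    rw [e, map_add, map_smul, Matrix.mulVecLin_apply, Matrix.mulVecLin_apply,
      ← hcast (fun j => (u j).re), ← hcast (fun j => (u j).im)]
    exact Submodule.add_mem _ (Submodule.subset_span ⟨_, ⟨fun j => (u j).re, rfl⟩, rfl⟩)
      (Submodule.smul_mem _ _ (Submodule.subset_span ⟨_, ⟨fun j => (u j).im, rfl⟩, rfl⟩))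

theorem mem_complexify_lagInf {v : Vec4 ℂ} : v ∈ complexify lagInf ↔ v ∘ Sum.inr = 0 := by
  have e : toComplex (Matrix.fromRows (1 : Mat2 ℝ) (0 : Mat2 ℝ)) =
      Matrix.fromRows (1 : Mat2 ℂ) (0 : Mat2 ℂ) := by
    ext (i | i) j
    · exact congrFun (congrFun toComplex_one i) j
    · simp [toComplex]
  rw [lagInf_eq_colSpan, complexify_colSpan, e]
  constructor
  · rintro ⟨u, rfl⟩
    simp [Matrix.fromRows_mulVec]
  · intro h
    refine ⟨v ∘ Sum.inl, ?_⟩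
    rw [Matrix.mulVecLin_apply, Matrix.fromRows_mulVec, Matrix.zero_mulVec, ← h,
      Matrix.one_mulVec]
    exact Sum.elim_comp_inl_inr v

theorem mem_complexify_zero {v : Vec4 ℂ} :
    v ∈ complexify (graphLag 0) ↔ v ∘ Sum.inl = 0 := by
  have e : toComplex (Matrix.fromRows (0 : Mat2 ℝ) (1 : Mat2 ℝ)) =
      Matrix.fromRows (0 : Mat2 ℂ) (1 : Mat2 ℂ) := by
    ext (i | i) j
    · simp [toComplex]
    · exact congrFun (congrFun toComplex_one i) j
  rw [graphLag_eq_colSpan, complexify_colSpan, e, ← graphLag_eq_colSpan, mem_graphLag,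
    Matrix.zero_mulVec]

theorem reMat_eq_zero_iff {Z : Mat2 ℂ} : reMat Z = 0 ↔ conjMat Z = -Z := by
  constructor
  · intro h
    ext i j
    have h1 : (Z i j).re = 0 := congrFun (congrFun h i) j
    apply Complex.ext <;> simp [conjMat, h1]
  · intro h
    ext i j
    have h1 := congrArg Complex.re (congrFun (congrFun h i) j)
    simp [conjMat] at h1
    simp only [reMat, Matrix.map_apply, Matrix.zero_apply]
    linarith

/-- The tube with endpoints `l_∞` and `0` consists of the purely imaginary points. -/
theorem mem_tube_lagInf_zero {Z : Mat2 ℂ} :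
    Z ∈ tube lagInf (graphLag 0) ↔ Z ∈ siegelSpace ∧ conjMat Z = -Z := by
  rw [mem_tube_iff]
  refine and_congr_right fun hZ => ?_
  have hu := siegel_isUnit_det hZ
  have hu' := conjMat_isUnit_det hu
  have hinj := Matrix.mulVec_injective_of_isUnit ((Matrix.isUnit_iff_isUnit_det _).2 hu)
  have hinj' := Matrix.mulVec_injective_of_isUnit ((Matrix.isUnit_iff_isUnit_det _).2 hu')
  constructor
  · rintro ⟨-, -, h⟩
    refine Matrix.mulVec_injective (funext fun y => ?_)
    obtain ⟨w, hw, h1, h2⟩ := h (Sum.elim (Z *ᵥ y) 0)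
      (by rw [mem_complexify_lagInf, Sum.elim_comp_inr])
    rw [mem_complexify_zero] at hw
    rw [mem_graphLag] at h1 h2
    have e1 : (Sum.elim (Z *ᵥ y) 0 - w) ∘ Sum.inl = Z *ᵥ y - w ∘ Sum.inl := by
      ext i; simp
    have e2 : (Sum.elim (Z *ᵥ y) 0 - w) ∘ Sum.inr = -(w ∘ Sum.inr) := by
      ext i; simp
    have e3 : (w + Sum.elim (Z *ᵥ y) 0) ∘ Sum.inl = w ∘ Sum.inl + Z *ᵥ y := by
      ext i; simp
    have e4 : (w + Sum.elim (Z *ᵥ y) 0) ∘ Sum.inr = w ∘ Sum.inr := by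
      ext i; simp
    rw [e1, e2, hw, sub_zero] at h1
    rw [e3, e4, hw, zero_add] at h2
    rw [← hinj h2, Matrix.mulVec_neg] at h1
    rw [Matrix.neg_mulVec, h1, neg_neg]
  · intro h
    refine ⟨?_, ?_, ?_⟩
    · constructor
      · rw [Submodule.disjoint_def]
        intro v h1 h2
        rw [mem_complexify_lagInf] at h1
        rw [mem_graphLag, h1, Matrix.mulVec_zero] at h2
        rw [← Sum.elim_comp_inl_inr v, h1, h2]
        ext (i | i) <;> rfl
      · rw [Submodule.codisjoint_iff_exists_add_eq]
        intro v
        refine ⟨Sum.elim (v ∘ Sum.inl - Z *ᵥ (v ∘ Sum.inr)) 0,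
          Sum.elim (Z *ᵥ (v ∘ Sum.inr)) (v ∘ Sum.inr), ?_, ?_, ?_⟩
        · rw [mem_complexify_lagInf, Sum.elim_comp_inr]
        · rw [mem_graphLag, Sum.elim_comp_inr, Sum.elim_comp_inl]
        · rw [← Sum.elim_add_add, sub_add_cancel, zero_add, Sum.elim_comp_inl_inr]
    · constructor
      · rw [Submodule.disjoint_def]
        intro v h1 h2
        rw [mem_complexify_zero] at h1
        rw [mem_graphLag, h1, eq_comm, ← Matrix.mulVec_zero (conjMat Z)] at h2
        rw [← Sum.elim_comp_inl_inr v, h1, hinj' h2]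
        ext (i | i) <;> rfl
      · rw [Submodule.codisjoint_iff_exists_add_eq]
        intro v
        have e : conjMat Z *ᵥ ((conjMat Z)⁻¹ *ᵥ (v ∘ Sum.inl)) = v ∘ Sum.inl := by
          rw [Matrix.mulVec_mulVec, Matrix.mul_nonsing_inv _ hu', Matrix.one_mulVec]
        refine ⟨Sum.elim (0 : Fin 2 → ℂ) (v ∘ Sum.inr - (conjMat Z)⁻¹ *ᵥ (v ∘ Sum.inl)),
          Sum.elim (v ∘ Sum.inl) ((conjMat Z)⁻¹ *ᵥ (v ∘ Sum.inl)), ?_, ?_, ?_⟩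
        · rw [mem_complexify_zero, Sum.elim_comp_inl]
        · rw [mem_graphLag, Sum.elim_comp_inr, Sum.elim_comp_inl, e]
        · rw [← Sum.elim_add_add, sub_add_cancel, zero_add, Sum.elim_comp_inl_inr]
    · intro v hv
      rw [mem_complexify_lagInf] at hv
      have e : Z *ᵥ (Z⁻¹ *ᵥ (v ∘ Sum.inl)) = v ∘ Sum.inl := by
        rw [Matrix.mulVec_mulVec, Matrix.mul_nonsing_inv _ hu, Matrix.one_mulVec]
      refine ⟨Sum.elim (0 : Fin 2 → ℂ) (Z⁻¹ *ᵥ (v ∘ Sum.inl)), ?_, ?_, ?_⟩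
      · rw [mem_complexify_zero, Sum.elim_comp_inl]
      · have e1 : (v - Sum.elim (0 : Fin 2 → ℂ) (Z⁻¹ *ᵥ (v ∘ Sum.inl))) ∘ Sum.inl = v ∘ Sum.inl := by
          ext i; simp
        have e2 : (v - Sum.elim (0 : Fin 2 → ℂ) (Z⁻¹ *ᵥ (v ∘ Sum.inl))) ∘ Sum.inr =
            -(Z⁻¹ *ᵥ (v ∘ Sum.inl)) := by
          ext i
          have : v (Sum.inr i) = 0 := congrFun hv i
          simp [this]
        rw [mem_graphLag, e1, e2, h, Matrix.neg_mulVec, Matrix.mulVec_neg, neg_neg, e]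
      · have e1 : (Sum.elim (0 : Fin 2 → ℂ) (Z⁻¹ *ᵥ (v ∘ Sum.inl)) + v) ∘ Sum.inl = v ∘ Sum.inl := by
          ext i; simp
        have e2 : (Sum.elim (0 : Fin 2 → ℂ) (Z⁻¹ *ᵥ (v ∘ Sum.inl)) + v) ∘ Sum.inr =
            Z⁻¹ *ᵥ (v ∘ Sum.inl) := by
          ext i
          have : v (Sum.inr i) = 0 := congrFun hv i
          simp [this]
        rw [mem_graphLag, e1, e2, e]

/-! ### A tube determines its endpoints -/

/-- The purely imaginary matrix `iT`. -/
def imagMat (T : Mat2 ℝ) : Mat2 ℂ := Complex.I • toComplex T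

theorem conjMat_imagMat (T : Mat2 ℝ) : conjMat (imagMat T) = -imagMat T := by
  ext; simp [imagMat, conjMat, toComplex]

theorem imMat_imagMat (T : Mat2 ℝ) : imMat (imagMat T) = T := by
  ext; simp [imagMat, imMat, toComplex]

theorem eq_imagMat_of_conjMat {Z : Mat2 ℂ} (h : conjMat Z = -Z) : Z = imagMat (imMat Z) := by
  have h0 := reMat_eq_zero_iff.2 h
  ext i j
  have h1 : (Z i j).re = 0 := congrFun (congrFun h0 i) j
  apply Complex.ext <;> simp [imagMat, imMat, toComplex, h1]

theorem imagMat_mem_tube {T : Mat2 ℝ} (hT : T.PosDef) :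
    imagMat T ∈ tube lagInf (graphLag 0) := by
  refine mem_tube_lagInf_zero.2 ⟨mem_siegelSpace ?_ ?_, conjMat_imagMat T⟩
  · rw [imagMat, Matrix.transpose_smul, ← toComplex_transpose, posDef_symm hT]
  · rw [imMat_imagMat]
    exact posDef_toComplex hT

theorem exists_posDef_of_mem_tube {Z : Mat2 ℂ} (h : Z ∈ tube lagInf (graphLag 0)) :
    ∃ T : Mat2 ℝ, T.PosDef ∧ Z = imagMat T :=
  ⟨imMat Z, h.1.2, eq_imagMat_of_conjMat (mem_tube_lagInf_zero.1 h).2⟩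

theorem add_imagMat_inj {P Q P' Q' : Mat2 ℝ}
    (h : toComplex P + imagMat Q = toComplex P' + imagMat Q') : P = P' ∧ Q = Q' := by
  constructor <;> ext i j
  · simpa [toComplex, imagMat] using congrArg Complex.re (congrFun (congrFun h i) j)
  · simpa [toComplex, imagMat] using congrArg Complex.im (congrFun (congrFun h i) j)

theorem toComplex_mul_imagMat (P Q : Mat2 ℝ) : toComplex P * imagMat Q = imagMat (P * Q) := by
  rw [imagMat, mul_smul_comm, ← toComplex_mul, imagMat]

theorem imagMat_mul_toComplex (P Q : Mat2 ℝ) : imagMat P * toComplex Q = imagMat (P * Q) := by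
  rw [imagMat, smul_mul_assoc, ← toComplex_mul, imagMat]

theorem imagMat_mul_imagMat (P Q : Mat2 ℝ) : imagMat P * imagMat Q = toComplex (-(P * Q)) := by
  rw [imagMat, imagMat, smul_mul_smul_comm, Complex.I_mul_I, ← toComplex_mul, toComplex_neg,
    neg_one_smul]

theorem num_eq {g : Sp4} {A B C D : Mat2 ℝ} (hg : g.1 = Matrix.fromBlocks A B C D)
    (Z : Mat2 ℂ) : num g Z = toComplex A * Z + toComplex B := by
  rw [num, hg, Matrix.toBlocks_fromBlocks₁₁, Matrix.toBlocks_fromBlocks₁₂]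

theorem den_eq {g : Sp4} {A B C D : Mat2 ℝ} (hg : g.1 = Matrix.fromBlocks A B C D)
    (Z : Mat2 ℂ) : den g Z = toComplex C * Z + toComplex D := by
  rw [den, hg, Matrix.toBlocks_fromBlocks₂₁, Matrix.toBlocks_fromBlocks₂₂]

/-- Real and imaginary part of the equation `g(iT) = iS`. -/
theorem moebius_imagMat_eq {g : Sp4} {A B C D T S : Mat2 ℝ}
    (hg : g.1 = Matrix.fromBlocks A B C D) (hT : imagMat T ∈ siegelSpace)
    (h : moebius g (imagMat T) = imagMat S) : A * T = S * D ∧ B = -(S * C * T) := by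
  have h1 := moebius_mul_den (den_isUnit hT g)
  rw [h, num_eq hg, den_eq hg, mul_add, toComplex_mul_imagMat, toComplex_mul_imagMat,
    imagMat_mul_imagMat, imagMat_mul_toComplex, add_comm (imagMat (A * T))] at h1
  obtain ⟨h2, h3⟩ := add_imagMat_inj h1
  exact ⟨h3.symm, by rw [← h2, mul_assoc]⟩

theorem eq_zero_of_transpose_mul_mul {S D : Mat2 ℝ} (hS : S.PosDef) (h : Dᵀ * S * D = 0) :
    D = 0 := by
  obtain ⟨E, hE, rfl⟩ := exists_mul_transpose hS
  have h1 : (Eᵀ * D)ᴴ * (Eᵀ * D) = 0 := by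
    rw [conjTranspose_eq_transpose_real, Matrix.transpose_mul, Matrix.transpose_transpose, ← h]
    noncomm_ring
  rw [Matrix.conjTranspose_mul_self_eq_zero] at h1
  have hu : IsUnit Eᵀ := (Matrix.isUnit_iff_isUnit_det _).2 (by rwa [Matrix.det_transpose])
  exact hu.mul_right_eq_zero.1 h1

/-- A symplectic matrix preserving the tube `{iT}` is block diagonal or block antidiagonal.
The matrix `DᵀA` commutes with every `T`, so it is a scalar `k ∈ [0, 1]`; if `0 < k < 1`, then
`g(iT) = iS` would make `S` both linear in `T` and linear in `T⁻¹`. -/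
theorem endpoints_of_preserves_tube {g : Sp4}
    (hg : ∀ Z ∈ tube lagInf (graphLag 0), moebius g Z ∈ tube lagInf (graphLag 0)) :
    (actLag g lagInf = lagInf ∧ actLag g (graphLag 0) = graphLag 0) ∨
      (actLag g lagInf = graphLag 0 ∧ actLag g (graphLag 0) = lagInf) := by
  obtain ⟨A, B, C, D, h, -, -, h3⟩ := sp_blocks g
  have key : ∀ T : Mat2 ℝ, T.PosDef → ∃ S : Mat2 ℝ, S.PosDef ∧ A * T = S * D ∧
      B = -(S * C * T) := by
    intro T hT
    obtain ⟨S, hS, hST⟩ := exists_posDef_of_mem_tube (hg _ (imagMat_mem_tube hT))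
    exact ⟨S, hS, moebius_imagMat_eq h (imagMat_mem_tube hT).1 hST⟩
  have h3' : Dᵀ * A - Bᵀ * C = 1 := by simpa using congrArg Matrix.transpose h3
  set K := Dᵀ * A with hK
  have hKT : ∀ T : Mat2 ℝ, T.PosDef → K * T = T * Kᵀ := by
    intro T hT
    obtain ⟨S, hS, h4, -⟩ := key T hT
    have e : K * T = Dᵀ * S * D := by rw [hK, mul_assoc, h4, mul_assoc]
    have e' : (K * T)ᵀ = K * T := by
      rw [e, Matrix.transpose_mul, Matrix.transpose_mul, posDef_symm hS,
        Matrix.transpose_transpose, mul_assoc]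
    rw [← e', Matrix.transpose_mul, posDef_symm hT]
  have hKs : Kᵀ = K := by
    have := hKT 1 Matrix.PosDef.one
    rwa [mul_one, one_mul, eq_comm] at this
  obtain ⟨k, hk⟩ : ∃ k : ℝ, K = k • 1 := by
    have t1 := hKT !![2, 0; 0, 1] (posDef_two_iff.2 (by norm_num))
    have t2 := hKT !![2, 1; 1, 2] (posDef_two_iff.2 (by norm_num))
    rw [hKs] at t1 t2
    have a1 := congrFun (congrFun t1 0) 1
    have a2 := congrFun (congrFun t1 1) 0
    have a3 := congrFun (congrFun t2 0) 1
    simp [Matrix.mul_apply, Fin.sum_univ_two] at a1 a2 a3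
    refine ⟨K 0 0, ?_⟩
    ext i j
    fin_cases i <;> fin_cases j <;> simp <;> linarith
  have hD : ∀ {T S : Mat2 ℝ}, A * T = S * D → Dᵀ * S * D = k • T := by
    intro T S h4
    rw [mul_assoc, ← h4, ← mul_assoc, ← hK, hk, smul_mul_assoc, one_mul]
  have hC : ∀ {T S : Mat2 ℝ}, B = -(S * C * T) → Cᵀ * S * C * T = (1 - k) • 1 := by
    intro T S h5
    have e : Cᵀ * B = (k - 1) • 1 := by
      have : Aᵀ * D = K := by rw [← hKs, hK, Matrix.transpose_mul, Matrix.transpose_transpose]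
      rw [← sub_eq_iff_eq_add'.2 (sub_eq_iff_eq_add.1 h3), this, hk, sub_smul, one_smul]
    rw [h5, mul_neg] at e
    rw [← neg_inj, ← neg_smul, neg_sub, ← e]
    noncomm_ring
  obtain ⟨S, hS, h4, h5⟩ := key 1 Matrix.PosDef.one
  have d1 := hD h4
  have c1 := hC h5
  rw [mul_one] at c1 h4 h5
  have hAu : D = 0 → A = 0 := fun hD0 => by rw [h4, hD0, mul_zero]
  have hBu : C = 0 → B = 0 := fun hC0 => by rw [h5, hC0, mul_zero, neg_zero]
  by_cases hk0 : k = 0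
  · right
    have hD0 : D = 0 := eq_zero_of_transpose_mul_mul hS (by rw [d1, hk0, zero_smul])
    have hA0 := hAu hD0
    subst hD0 hA0
    rw [mul_zero, zero_sub] at h3
    have hu := congrArg Matrix.det h3
    rw [← neg_mul, Matrix.det_mul, Matrix.det_one] at hu
    have hB : IsUnit B.det := IsUnit.of_mul_eq_one_right _ hu
    have hCu : IsUnit C.det := by
      have := IsUnit.of_mul_eq_one _ hu
      simpa [Matrix.det_neg, Matrix.det_transpose] using this
    exact ⟨actLag_lagInf_eq_graphLag h hCu (by rw [zero_mul]),
      actLag_graphLag_eq_lagInf h (by simpa using hB) (by simp)⟩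
  by_cases hk1 : k = 1
  · left
    have hC0 : C = 0 := eq_zero_of_transpose_mul_mul hS (by rw [c1, hk1, sub_self, zero_smul])
    have hB0 := hBu hC0
    subst hC0 hB0
    rw [mul_zero, sub_zero] at h3
    have hu := congrArg Matrix.det h3
    rw [Matrix.det_mul, Matrix.det_one, Matrix.det_transpose] at hu
    exact ⟨actLag_lagInf_eq_lagInf h (IsUnit.of_mul_eq_one _ hu),
      actLag_graphLag h (by simpa using IsUnit.of_mul_eq_one_right _ hu) (by simp)⟩
  exfalso
  have h2p : ((2 : ℝ) • (1 : Mat2 ℝ)).PosDef := Matrix.PosDef.one.smul (by norm_num)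
  obtain ⟨S', hS', h4', h5'⟩ := key _ h2p
  have d2 := hD h4'
  have c2 := hC h5'
  have hDu : IsUnit D := by
    rw [Matrix.isUnit_iff_isUnit_det]
    have := congrArg Matrix.det d1
    rw [Matrix.det_mul, Matrix.det_smul, Matrix.det_one, mul_one] at this
    refine isUnit_of_mul_isUnit_right (x := (Dᵀ * S).det) ?_
    rw [this]
    simpa using hk0
  have hCu : IsUnit C := by
    rw [Matrix.isUnit_iff_isUnit_det]
    have := congrArg Matrix.det c1
    rw [Matrix.det_mul, Matrix.det_smul, Matrix.det_one, mul_one] at this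
    refine isUnit_of_mul_isUnit_right (x := (Cᵀ * S).det) ?_
    rw [this]
    simpa [sub_eq_zero] using Ne.symm hk1
  have e1 : S' = (2 : ℝ) • S := by
    have hDt : IsUnit Dᵀ := (Matrix.isUnit_transpose _).2 hDu
    refine hDt.mul_left_cancel (hDu.mul_right_cancel ?_)
    rw [d2, mul_smul_comm, smul_mul_assoc, d1, smul_comm]
  have e2 : S = (2 : ℝ) • S' := by
    have hCt : IsUnit Cᵀ := (Matrix.isUnit_transpose _).2 hCu
    refine hCt.mul_left_cancel (hCu.mul_right_cancel ?_)
    rw [c1, ← c2, mul_smul_comm, mul_one, mul_smul_comm, smul_mul_assoc]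
  rw [e1, smul_smul] at e2
  have e3 := congrFun (congrFun e2 0) 0
  rw [Matrix.smul_apply, smul_eq_mul] at e3
  have := hS.diag_pos (i := 0)
  linarith

/-- Two equal tubes have the same endpoints, up to order. -/
theorem endpoints_of_tube_eq {a b c a' b' c' : Submodule ℝ (Vec4 ℝ)} (h : IsMaximalTriple a b c)
    (h' : IsMaximalTriple a' b' c') (ht : tube a b = tube a' b') :
    (a' = a ∧ b' = b) ∨ (a' = b ∧ b' = a) := by
  obtain ⟨g, rfl, rfl, -⟩ := h
  obtain ⟨k, rfl, rfl, -⟩ := h'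
  have := endpoints_of_preserves_tube (g := g⁻¹ * k) (by
    intro Z hZ
    have h1 := moebius_mem_tube k hZ
    rw [← ht] at h1
    have h2 := moebius_mem_tube g⁻¹ h1
    rwa [actLag_inv_actLag, actLag_inv_actLag, ← moebius_mul _ _ hZ.1] at h2)
  simp only [actLag_mul] at this
  refine this.imp ?_ ?_ <;> rintro ⟨h1, h2⟩ <;> constructor
  · rw [← actLag_actLag_inv g (actLag k lagInf), h1]
  · rw [← actLag_actLag_inv g (actLag k (graphLag 0)), h2]
  · rw [← actLag_actLag_inv g (actLag k lagInf), h1]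
  · rw [← actLag_actLag_inv g (actLag k (graphLag 0)), h2]

/-! ### Tangent vectors and the invariant metric -/

theorem hasDerivAt_entries_iff {γ : ℝ → Mat2 ℂ} {V : Mat2 ℂ} :
    (∀ i j, HasDerivAt (fun t => γ t i j) (V i j) 0) ↔
      Tendsto (fun t : ℝ => t⁻¹ • (γ t - γ 0)) (𝓝[≠] 0) (𝓝 V) := by
  refine Iff.trans ?_ (tendsto_pi_nhds.trans (forall_congr' fun i => tendsto_pi_nhds)).symm
  refine forall_congr' fun i => forall_congr' fun j => ?_
  rw [hasDerivAt_iff_tendsto_slope_zero]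
  simp

theorem continuousAt_of_hasDerivAt_entries {γ : ℝ → Mat2 ℂ} {V : Mat2 ℂ}
    (h : ∀ i j, HasDerivAt (fun t => γ t i j) (V i j) 0) : ContinuousAt γ 0 :=
  tendsto_pi_nhds.2 fun i => tendsto_pi_nhds.2 fun j => (h i j).continuousAt

/-- The derivative of the action of `g` at `Z`, applied to `V`. -/
def moebiusDeriv (g : Sp4) (Z V : Mat2 ℂ) : Mat2 ℂ := ((den g Z)⁻¹)ᵀ * V * (den g Z)⁻¹

theorem IsTangentTo.moebius {S : Set (Mat2 ℂ)} (hS : S ⊆ siegelSpace) {Z V : Mat2 ℂ}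
    (h : IsTangentTo S Z V) (g : Sp4) :
    IsTangentTo (moebius g '' S) (SiegelHexagon.moebius g Z) (moebiusDeriv g Z V) := by
  obtain ⟨γ, rfl, hγ, hV⟩ := h
  refine ⟨fun t => SiegelHexagon.moebius g (γ t), rfl, fun t => ⟨_, hγ t, rfl⟩, ?_⟩
  have hZ := hS (hγ 0)
  have hu := den_isUnit hZ g
  have hcont := continuousAt_of_hasDerivAt_entries hV
  have hden : Tendsto (fun t => (den g (γ t))⁻¹) (𝓝[≠] 0) (𝓝 (den g (γ 0))⁻¹) := by
    have h1 : ContinuousAt (fun t => den g (γ t)) 0 :=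
      (continuousAt_const.mul hcont).add continuousAt_const
    have h2 : ContinuousAt (fun M : Mat2 ℂ => M⁻¹) (den g (γ 0)) := by
      refine continuousAt_matrix_inv _ ?_
      have : (Ring.inverse : ℂ → ℂ) = fun z => z⁻¹ := by
        ext z
        exact Ring.inverse_eq_inv z
      rw [this]
      exact continuousAt_inv₀ hu.ne_zero
    exact (ContinuousAt.comp (f := fun t => den g (γ t)) h2 h1).tendsto.mono_left
      nhdsWithin_le_nhds
  rw [hasDerivAt_entries_iff] at hV ⊢
  have key := (tendsto_const_nhds (x := ((den g (γ 0))⁻¹)ᵀ)).mul hV |>.mul hden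
  refine key.congr fun t => ?_
  rw [moebius_sub_moebius g (siegel_transpose hZ) hu (den_isUnit (hS (hγ t)) g),
    mul_smul_comm, smul_mul_assoc]

theorem trace_mul_cancel {R S q qi qt qti qh qhi qc qci U V : Mat2 ℂ} (h₁ : S = qc * R * qt)
    (h₂ : S = q * R * qh) (k₁ : qt * qti = 1) (k₂ : qi * q = 1) (k₃ : qh * qhi = 1)
    (k₄ : qci * qc = 1) :
    (S * (qti * U * qi) * S * (qhi * V * qci)).trace = (R * U * R * V).trace := by
  calc (S * (qti * U * qi) * S * (qhi * V * qci)).trace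
      = ((qc * R * qt) * (qti * U * qi) * (q * R * qh) * (qhi * V * qci)).trace := by
        rw [← h₁, ← h₂]
    _ = (qc * (R * (qt * qti) * U * (qi * q) * R * (qh * qhi) * V * qci)).trace := by
        simp only [mul_assoc]
    _ = (R * U * R * V).trace := by
        rw [Matrix.trace_mul_comm, k₁, k₂, k₃, mul_one, mul_one, mul_one, mul_assoc _ qci, k₄,
          mul_one]

theorem siegelMetric_moebius (g : Sp4) {Z : Mat2 ℂ} (hZ : Z ∈ siegelSpace) (U V : Mat2 ℂ) :
    siegelMetric (moebius g Z) (moebiusDeriv g Z U) (moebiusDeriv g Z V) =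
      siegelMetric Z U V := by
  have hu := den_isUnit hZ g
  have hY := posDef_isUnit_det hZ.2
  have hY' := posDef_isUnit_det (moebius_mem_siegelSpace g hZ).2
  have e := imMat_moebius g hZ
  rw [siegelMetric, siegelMetric, toComplex_inv hY, toComplex_inv hY', moebiusDeriv, moebiusDeriv]
  set q := den g Z with hq
  set Y := toComplex (imMat Z)
  have e2 : (toComplex (imMat (moebius g Z)))⁻¹ = q * Y⁻¹ * qᴴ := by
    rw [e, Matrix.mul_inv_rev, Matrix.mul_inv_rev, ← Matrix.conjTranspose_nonsing_inv,
      Matrix.nonsing_inv_nonsing_inv _ hu, mul_assoc]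
  have e1 : (toComplex (imMat (moebius g Z)))⁻¹ = conjMat q * Y⁻¹ * qᵀ := by
    have := congrArg conjMat e2
    rw [← toComplex_inv hY', ← toComplex_inv hY, conjMat_toComplex, conjMat_mul, conjMat_mul,
      conjMat_toComplex, conjTranspose_eq, conjMat_transpose, conjMat_conjMat] at this
    rw [← toComplex_inv hY', this, toComplex_inv hY]
  have k1 : qᵀ * (q⁻¹)ᵀ = 1 := by
    rw [← Matrix.transpose_mul, Matrix.nonsing_inv_mul _ hu, Matrix.transpose_one]
  have k2 : q⁻¹ * q = 1 := Matrix.nonsing_inv_mul _ hu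
  have k3 : qᴴ * conjMat (q⁻¹)ᵀ = 1 := by
    rw [conjTranspose_eq, conjMat_transpose, ← Matrix.transpose_mul, ← conjMat_mul, k2,
      conjMat_one, Matrix.transpose_one]
  have k4 : conjMat q⁻¹ * conjMat q = 1 := by
    rw [← conjMat_mul, k2, conjMat_one]
  have k5 : conjMat ((q⁻¹)ᵀ * V * q⁻¹) = conjMat (q⁻¹)ᵀ * conjMat V * conjMat q⁻¹ := by
    rw [conjMat_mul, conjMat_mul]
  rw [k5]
  exact congrArg Complex.re (trace_mul_cancel e1 e2 k1 k2 k3 k4)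

theorem AreOrthogonal.moebius {S T : Set (Mat2 ℂ)} (hS : S ⊆ siegelSpace) (hT : T ⊆ siegelSpace)
    (h : AreOrthogonal S T) (g : Sp4) : AreOrthogonal (moebius g '' S) (moebius g '' T) := by
  have cancel : ∀ R : Set (Mat2 ℂ), R ⊆ siegelSpace →
      SiegelHexagon.moebius g⁻¹ '' (SiegelHexagon.moebius g '' R) = R := by
    intro R hR
    rw [Set.image_image]
    exact (Set.image_congr fun Z hZ => moebius_inv_moebius g (hR hZ)).trans (Set.image_id' R)
  have maps : ∀ R : Set (Mat2 ℂ), R ⊆ siegelSpace →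
      SiegelHexagon.moebius g '' R ⊆ siegelSpace := by
    rintro R hR _ ⟨Z, hZ, rfl⟩
    exact moebius_mem_siegelSpace g (hR hZ)
  obtain ⟨⟨Z, hZS, hZT⟩, h⟩ := h
  refine ⟨⟨_, ⟨Z, hZS, rfl⟩, ⟨Z, hZT, rfl⟩⟩, ?_⟩
  rintro W ⟨hWS, hWT⟩ U V hU hV
  have hU' := hU.moebius (maps S hS) g⁻¹
  have hV' := hV.moebius (maps T hT) g⁻¹
  rw [cancel S hS] at hU'
  rw [cancel T hT] at hV'
  have hWS' : SiegelHexagon.moebius g⁻¹ W ∈ S := by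
    rw [← cancel S hS]
    exact ⟨W, hWS, rfl⟩
  have hWT' : SiegelHexagon.moebius g⁻¹ W ∈ T := by
    rw [← cancel T hT]
    exact ⟨W, hWT, rfl⟩
  rw [← siegelMetric_moebius g⁻¹ (maps S hS hWS)]
  exact h _ ⟨hWS', hWT'⟩ _ _ hU' hV'

theorem tube_subset_siegelSpace (a b : Submodule ℝ (Vec4 ℝ)) : tube a b ⊆ siegelSpace :=
  fun _ h => h.1

theorem AreOrthogonal.act {a b x y : Submodule ℝ (Vec4 ℝ)}
    (h : AreOrthogonal (tube a b) (tube x y)) (g : Sp4) :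
    AreOrthogonal (tube (actLag g a) (actLag g b)) (tube (actLag g x) (actLag g y)) := by
  rw [← moebius_image_tube, ← moebius_image_tube]
  exact h.moebius (tube_subset_siegelSpace a b) (tube_subset_siegelSpace x y) g

theorem areOrthogonal_act_iff (g : Sp4) {a b x y : Submodule ℝ (Vec4 ℝ)} :
    AreOrthogonal (tube (actLag g a) (actLag g b)) (tube (actLag g x) (actLag g y)) ↔
      AreOrthogonal (tube a b) (tube x y) :=
  ⟨fun h => by simpa only [actLag_inv_actLag] using h.act g⁻¹, fun h => h.act g⟩

/-! ### Orthogonal tubes are harmonic -/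

theorem den_cayley (Z : Mat2 ℂ) : den cayley Z = ((√2 : ℝ) : ℂ)⁻¹ • (Z + 1) := by
  have e : toComplex ((√2 : ℝ)⁻¹ • (1 : Mat2 ℝ)) = ((√2 : ℝ) : ℂ)⁻¹ • 1 := by
    ext i j
    fin_cases i <;> fin_cases j <;> simp [toComplex]
  rw [den_eq (g := cayley) rfl, e, smul_mul_assoc, one_mul, smul_add]

theorem num_cayley (Z : Mat2 ℂ) : num cayley Z = ((√2 : ℝ) : ℂ)⁻¹ • (Z - 1) := by
  have e : toComplex ((√2 : ℝ)⁻¹ • (1 : Mat2 ℝ)) = ((√2 : ℝ) : ℂ)⁻¹ • 1 := by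
    ext i j
    fin_cases i <;> fin_cases j <;> simp [toComplex]
  have e' : toComplex ((-(√2)⁻¹ : ℝ) • (1 : Mat2 ℝ)) = -(((√2 : ℝ) : ℂ)⁻¹ • 1) := by
    ext i j
    fin_cases i <;> fin_cases j <;> simp [toComplex]
  rw [num_eq (g := cayley) rfl, e, e', smul_mul_assoc, one_mul, smul_sub, sub_eq_add_neg]

/-- The tube with endpoints `-Id` and `Id` lies in the locus `conj Z * Z = 1`. -/
theorem conjMat_mul_self_of_mem_tube {Z : Mat2 ℂ} (h : Z ∈ tube (graphLag (-1)) (graphLag 1)) :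
    conjMat Z * Z = 1 := by
  have hZ := h.1
  have h1 := moebius_mem_tube cayley h
  rw [cayley_neg_one, cayley_one, mem_tube_lagInf_zero] at h1
  have hu := den_isUnit hZ cayley
  have e1 := moebius_mul_den hu
  have e2 := congrArg conjMat e1
  rw [conjMat_mul, h1.2] at e2
  have e3 := congrArg Matrix.transpose e2
  rw [Matrix.transpose_mul, Matrix.transpose_neg, siegel_transpose h1.1] at e3
  have e4 : (conjMat (num cayley Z))ᵀ * den cayley Z =
      -((conjMat (den cayley Z))ᵀ * num cayley Z) := by
    rw [← e3, ← e1, mul_neg, neg_mul, mul_assoc]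
  rw [conjMat_num, conjMat_den, num_cayley, den_cayley, num_cayley, den_cayley,
    Matrix.transpose_smul, Matrix.transpose_smul, smul_mul_smul_comm, smul_mul_smul_comm,
    ← smul_neg] at e4
  have h2 : ((√2 : ℝ) : ℂ)⁻¹ * ((√2 : ℝ) : ℂ)⁻¹ ≠ 0 := by simp
  have e5 := smul_right_injective _ h2 e4
  rw [Matrix.transpose_sub, Matrix.transpose_add, Matrix.transpose_one, ← conjMat_transpose,
    siegel_transpose hZ] at e5
  have e6 : (2 : ℂ) • (conjMat Z * Z) = (2 : ℂ) • 1 := by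
    rw [two_smul, two_smul, ← sub_eq_zero]
    rw [← sub_eq_zero] at e5
    rw [← e5]
    noncomm_ring
  exact smul_right_injective _ two_ne_zero e6

theorem imagMat_one : imagMat 1 = Complex.I • 1 := by
  rw [imagMat, toComplex_one]

theorem moebius_cayley_imagMat_one : moebius cayley (imagMat 1) = imagMat 1 := by
  have hu := den_isUnit (imagMat_mem_tube Matrix.PosDef.one).1 cayley
  have e : imagMat 1 * den cayley (imagMat 1) = num cayley (imagMat 1) := by
    rw [den_cayley, num_cayley, mul_smul_comm, mul_add, mul_one, imagMat_mul_imagMat,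
      mul_one, toComplex_neg, toComplex_one]
    congr 1
    abel
  rw [moebius_eq, ← e, mul_assoc, Matrix.mul_nonsing_inv _ hu, mul_one]

theorem imagMat_one_mem_tube : imagMat 1 ∈ tube (graphLag (-1)) (graphLag 1) := by
  have h := imagMat_mem_tube Matrix.PosDef.one
  have h1 := moebius_mem_tube cayley⁻¹ h
  rwa [← cayley_neg_one, ← cayley_one, actLag_inv_actLag, actLag_inv_actLag,
    ← moebius_cayley_imagMat_one, moebius_inv_moebius cayley h.1] at h1

theorem continuous_conjMat : Continuous conjMat :=
  Continuous.matrix_map continuous_id Complex.continuous_conj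

theorem conjMat_smul_real (t : ℝ) (M : Mat2 ℂ) : conjMat (t • M) = t • conjMat M := by
  ext; simp [conjMat]

theorem conjMat_sub (M N : Mat2 ℂ) : conjMat (M - N) = conjMat M - conjMat N := by
  ext; simp [conjMat]

theorem tangent_tube_lagInf_zero {Z U : Mat2 ℂ}
    (h : IsTangentTo (tube lagInf (graphLag 0)) Z U) : conjMat U = -U := by
  obtain ⟨γ, rfl, hγ, hU⟩ := h
  rw [hasDerivAt_entries_iff] at hU
  have h1 := (continuous_conjMat.tendsto U).comp hU
  refine tendsto_nhds_unique h1 (hU.neg.congr fun t => ?_)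
  rw [Function.comp_apply, conjMat_smul_real, conjMat_sub, (mem_tube_lagInf_zero.1 (hγ t)).2,
    (mem_tube_lagInf_zero.1 (hγ 0)).2, ← smul_neg]
  congr 1
  abel

theorem tangent_tube_neg_one_one {V : Mat2 ℂ}
    (h : IsTangentTo (tube (graphLag (-1)) (graphLag 1)) (imagMat 1) V) : conjMat V = V := by
  obtain ⟨γ, h0, hγ, hV⟩ := h
  have hc := (continuousAt_of_hasDerivAt_entries hV).tendsto.mono_left
    (nhdsWithin_le_nhds (s := {0}ᶜ))
  rw [hasDerivAt_entries_iff] at hV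
  rw [h0] at hc hV
  have h1 := (continuous_conjMat.tendsto V).comp hV
  have h2 := (h1.mul hc).add ((tendsto_const_nhds (x := conjMat (imagMat 1))).mul hV)
  have h3 : conjMat V * imagMat 1 + conjMat (imagMat 1) * V = 0 := by
    refine tendsto_nhds_unique h2 ((tendsto_const_nhds (x := 0)).congr fun t => ?_)
    have e1 := conjMat_mul_self_of_mem_tube (hγ t)
    have e2 := conjMat_mul_self_of_mem_tube (hγ 0)
    rw [h0] at e2
    rw [Function.comp_apply, conjMat_smul_real, conjMat_sub, smul_mul_assoc, mul_smul_comm,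
      ← smul_add, sub_mul, mul_sub, e1, e2]
    simp
  rw [conjMat_imagMat, imagMat_one, mul_smul_comm, mul_one, neg_mul, smul_mul_assoc, one_mul,
    ← sub_eq_add_neg, ← smul_sub, smul_eq_zero, sub_eq_zero] at h3
  exact h3.resolve_left Complex.I_ne_zero

/-- The tubes of a harmonic quadruple are orthogonal: in normal form they only meet at `i`, where
the tangent vectors of the first are purely imaginary and those of the second are real. -/
theorem IsHarmonic.areOrthogonal {a x b y : Submodule ℝ (Vec4 ℝ)} (h : IsHarmonic a x b y) :
    AreOrthogonal (tube a b) (tube x y) := by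
  obtain ⟨g, rfl, rfl, rfl, rfl⟩ := h
  rw [areOrthogonal_act_iff]
  refine ⟨⟨_, imagMat_mem_tube Matrix.PosDef.one, imagMat_one_mem_tube⟩, ?_⟩
  rintro Z ⟨hZ, hZ'⟩ U V hU hV
  obtain ⟨Y, hY, rfl⟩ := exists_posDef_of_mem_tube hZ
  have h1 := conjMat_mul_self_of_mem_tube hZ'
  rw [conjMat_imagMat, neg_mul, imagMat_mul_imagMat, ← toComplex_neg, neg_neg,
    ← toComplex_one] at h1
  obtain rfl : Y = 1 :=
    posDef_sq_injective hY Matrix.PosDef.one ((toComplex_injective h1).trans (one_mul 1).symm)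
  have hU' := tangent_tube_lagInf_zero hU
  have hV' := tangent_tube_neg_one_one hV
  rw [siegelMetric, imMat_imagMat, inv_one, toComplex_one, one_mul, mul_one, hV']
  have e : (starRingEnd ℂ) (U * V).trace = -(U * V).trace := by
    calc (starRingEnd ℂ) (U * V).trace = (conjMat (U * V)).trace :=
          AddMonoidHom.map_trace (starRingEnd ℂ) (U * V)
      _ = _ := by rw [conjMat_mul, hU', hV', neg_mul, Matrix.trace_neg]
  have := congrArg Complex.re e
  rw [Complex.conj_re, Complex.neg_re] at this
  linarith

theorem isTangentTo_imagMat {T U P : Mat2 ℝ} (h : ∀ t : ℝ, (T + t • U + t ^ 2 • P).PosDef) :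
    IsTangentTo (tube lagInf (graphLag 0)) (imagMat T) (imagMat U) := by
  refine ⟨fun t => imagMat (T + t • U + t ^ 2 • P), by simp, fun t => imagMat_mem_tube (h t), ?_⟩
  intro i j
  have h1 : HasDerivAt (fun t : ℝ => T i j + t * U i j + t ^ 2 * P i j) (U i j) 0 := by
    have := (((hasDerivAt_id (0 : ℝ)).mul_const (U i j)).const_add (T i j)).add
      (((hasDerivAt_id (0 : ℝ)).pow 2).mul_const (P i j))
    simpa [Pi.add_def] using this
  have h2 := (h1.ofReal_comp).const_mul Complex.I
  simpa [imagMat, toComplex] using h2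

theorem moebius_levi_imagMat_one (B : Mat2 ℝ) (hB : IsUnit B.det) :
    moebius (levi B hB) (imagMat 1) = imagMat (B * Bᵀ) := by
  have hu := den_isUnit (imagMat_mem_tube Matrix.PosDef.one).1 (levi B hB)
  have e : imagMat (B * Bᵀ) * den (levi B hB) (imagMat 1) = num (levi B hB) (imagMat 1) := by
    rw [den_eq (g := levi B hB) rfl, num_eq (g := levi B hB) rfl, toComplex_zero, zero_mul,
      zero_add, add_zero, imagMat_mul_toComplex, toComplex_mul_imagMat, mul_one, mul_assoc,
      ← Matrix.transpose_mul, Matrix.nonsing_inv_mul _ hB, Matrix.transpose_one, mul_one]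
  rw [moebius_eq, ← e, mul_assoc, Matrix.mul_nonsing_inv _ hu, mul_one]

/-- A symplectic matrix carrying `l_∞` to `c` and `0` to `d`, where `E` is the inverse of
`d - c`. -/
def toEndpoints (c E : Mat2 ℝ) (hc : cᵀ = c) (hE : Eᵀ = E) : Sp4 :=
  ⟨Matrix.fromBlocks c (-(c * E) - 1) 1 (-E), SymplecticGroup.fromBlocks_mem_iff.2 (by
    refine ⟨by simp [hc], ?_, ?_⟩
    · simp only [Matrix.transpose_sub, Matrix.transpose_neg, Matrix.transpose_mul, hc, hE,
        Matrix.transpose_one]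
      noncomm_ring
    · rw [Matrix.transpose_one, hc]
      noncomm_ring)⟩

theorem siegelMetric_imagMat_one (N R : Mat2 ℝ) :
    siegelMetric (imagMat 1) (imagMat N) (imagMat N + toComplex R) = (N * N).trace := by
  rw [siegelMetric, imMat_imagMat, inv_one, toComplex_one, one_mul, mul_one, conjMat_add,
    conjMat_imagMat, conjMat_toComplex, mul_add, mul_neg, imagMat_mul_imagMat,
    imagMat_mul_toComplex, ← toComplex_neg, neg_neg]
  simp [Matrix.trace_fin_two, toComplex, imagMat]

theorem IsHarmonic.of_areOrthogonal_of_mem {x y : Submodule ℝ (Vec4 ℝ)}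
    (hx : IsMaximalTriple lagInf x (graphLag 0)) (hy : IsMaximalTriple lagInf (graphLag 0) y)
    (hi : imagMat 1 ∈ tube x y)
    (h : AreOrthogonal (tube lagInf (graphLag 0)) (tube x y)) :
    IsHarmonic lagInf x (graphLag 0) y := by
  obtain ⟨c, Z, rfl, hZ, hcs, -, hc⟩ := hx.exists_graphs
  obtain rfl := graphLag_injective hZ
  obtain ⟨Z, d, hZ, rfl, -, hds, hd⟩ := hy.exists_graphs
  obtain rfl := graphLag_injective hZ
  rw [zero_sub] at hc
  rw [sub_zero] at hd
  have hdc : (d - c).PosDef := by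
    rw [sub_eq_add_neg]
    exact hd.add hc
  have hu := posDef_isUnit_det hdc
  have hE := hdc.inv
  have hE1 : (d - c) * (d - c)⁻¹ = 1 := Matrix.mul_nonsing_inv _ hu
  set E := (d - c)⁻¹ with hEdef
  have hEs := posDef_symm hE
  obtain ⟨k, hk⟩ : ∃ k : Sp4, k.1 = Matrix.fromBlocks c (-(c * E) - 1) 1 (-E) :=
    ⟨toEndpoints c E hcs hEs, rfl⟩
  have k0 : actLag k lagInf = graphLag c :=
    actLag_lagInf_eq_graphLag hk (by simp) (by rw [mul_one])
  have k1 : actLag k (graphLag 0) = graphLag d := by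
    refine actLag_graphLag hk ?_ ?_
    · simpa [Matrix.det_neg] using posDef_isUnit_det hE
    · rw [mul_zero, zero_add, mul_zero, zero_add, ← hE1]
      noncomm_ring
  have ht : moebius k '' tube lagInf (graphLag 0) = tube (graphLag c) (graphLag d) := by
    rw [moebius_image_tube, k0, k1]
  obtain ⟨_, hT, hTi⟩ : imagMat 1 ∈ moebius k '' tube lagInf (graphLag 0) := by rwa [ht]
  obtain ⟨T, hTp, rfl⟩ := exists_posDef_of_mem_tube hT
  obtain ⟨e1, e2⟩ := moebius_imagMat_eq hk hT.1 hTi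
  rw [one_mul] at e1
  rw [mul_one, one_mul] at e2
  have hTs := posDef_symm hTp
  have e3 : T * c = -E := by
    have := congrArg Matrix.transpose e1
    rwa [Matrix.transpose_mul, hcs, hTs, Matrix.transpose_neg, hEs] at this
  have e4 : T = c * E + 1 := by
    rw [← neg_inj, ← e2]
    abel
  -- The radial direction of the tube at `iT`, transported to the common point `i`.
  have hV : IsTangentTo (tube (graphLag c) (graphLag d)) (imagMat 1)
      (moebiusDeriv k (imagMat T) (imagMat T)) := by
    rw [← ht, ← hTi]
    refine (isTangentTo_imagMat (P := (1 / 2 : ℝ) • T) fun t => ?_).moebius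
      (tube_subset_siegelSpace _ _) k
    have : T + t • T + t ^ 2 • (1 / 2 : ℝ) • T = (1 + t + t ^ 2 * (1 / 2)) • T := by
      rw [add_smul, add_smul, one_smul, smul_smul]
    rw [this]
    exact hTp.smul (by nlinarith [sq_nonneg (t + 1)])
  have hden : (den k (imagMat T))⁻¹ = toComplex c - imagMat 1 := by
    refine Matrix.inv_eq_left_inv ?_
    rw [den_eq hk, toComplex_one, one_mul, mul_add, sub_mul, sub_mul, toComplex_mul_imagMat,
      imagMat_mul_imagMat, imagMat_mul_toComplex, ← toComplex_mul, one_mul, one_mul, e1,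
      toComplex_neg, mul_neg, toComplex_neg]
    have : toComplex T = toComplex (c * E) + 1 := by
      rw [← toComplex_one, ← toComplex_add, ← e4]
    rw [this]
    abel
  have hQs : (toComplex c - imagMat 1)ᵀ = toComplex c - imagMat 1 := by
    rw [Matrix.transpose_sub, ← toComplex_transpose, hcs, imagMat_one, Matrix.transpose_smul,
      Matrix.transpose_one]
  have hV' : moebiusDeriv k (imagMat T) (imagMat T) =
      imagMat (c * T * c - T) + toComplex (c * T + T * c) := by
    have sub : imagMat (c * T * c - T) = imagMat (c * T * c) - imagMat T := by
      rw [imagMat, toComplex_sub, smul_sub, imagMat, imagMat]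
    rw [moebiusDeriv, hden, hQs, sub_mul, toComplex_mul_imagMat, imagMat_mul_imagMat, mul_sub,
      sub_mul, sub_mul, imagMat_mul_toComplex, imagMat_mul_imagMat, toComplex_neg, neg_mul,
      neg_mul, ← toComplex_mul, toComplex_mul_imagMat, one_mul, mul_one, mul_one, sub,
      toComplex_add, toComplex_neg]
    abel
  set N := c * T * c - T with hN
  have hNs : Nᵀ = N := by
    rw [hN, Matrix.transpose_sub, Matrix.transpose_mul, Matrix.transpose_mul, hcs, hTs, mul_assoc]
  have hU : IsTangentTo (tube lagInf (graphLag 0)) (imagMat 1) (imagMat N) := by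
    refine isTangentTo_imagMat (P := (1 / 2 : ℝ) • (N * N)) fun t => ?_
    have e : (1 : Mat2 ℝ) + t • N + t ^ 2 • (1 / 2 : ℝ) • (N * N) =
        (1 / 2 : ℝ) • 1 + (1 / 2 : ℝ) • ((1 + t • N) * (1 + t • N)ᴴ) := by
      rw [conjTranspose_eq_transpose_real, Matrix.transpose_add, Matrix.transpose_one,
        Matrix.transpose_smul, hNs, mul_add, mul_one, add_mul, one_mul, smul_mul_smul_comm]
      module
    rw [e]
    exact (Matrix.PosDef.one.smul (by norm_num)).add_posSemidef
      ((Matrix.posSemidef_self_mul_conjTranspose _).smul (by norm_num))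
  have horth := h.2 _ ⟨imagMat_mem_tube Matrix.PosDef.one, hi⟩ _ _ hU hV
  rw [hV', siegelMetric_imagMat_one] at horth
  have hN0 : N = 0 := by
    have h1 : (N * Nᴴ).trace = 0 := by rw [conjTranspose_eq_transpose_real, hNs, horth]
    exact Matrix.trace_mul_conjTranspose_self_eq_zero_iff.1 h1
  obtain rfl : c = -1 := by
    rw [← neg_eq_iff_eq_neg]
    refine posDef_mul_mul_injective hTp hc Matrix.PosDef.one ?_
    rw [hN, sub_eq_zero] at hN0
    simpa using hN0
  have e5 : E = T := by simpa using e1.symm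
  have e6 : E + E = 1 := by
    rw [← e5] at e4
    nth_rewrite 1 [e4]
    noncomm_ring
  have hd1 : d = 1 := by
    have h1 : (d - -1) * E + (d - -1) * E = 1 + 1 := by rw [hE1]
    rw [← mul_add, e6, mul_one, sub_neg_eq_add] at h1
    exact add_right_cancel h1
  rw [hd1]
  exact IsHarmonic.of_posDef Matrix.PosDef.one

/-- Orthogonal tubes in maximal position form a harmonic quadruple. -/
theorem IsHarmonic.of_areOrthogonal {a x b y : Submodule ℝ (Vec4 ℝ)}
    (hx : IsMaximalTriple a x b) (hy : IsMaximalTriple a b y)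
    (h : AreOrthogonal (tube a b) (tube x y)) : IsHarmonic a x b y := by
  obtain ⟨W, hW, hW'⟩ := h.1
  obtain ⟨k, ha, hb, hk⟩ : ∃ k : Sp4, a = actLag k lagInf ∧ b = actLag k (graphLag 0) ∧
      W = moebius k (imagMat 1) := by
    obtain ⟨g, rfl, rfl, -⟩ := id hy
    rw [← moebius_image_tube] at hW
    obtain ⟨Z, hZ, rfl⟩ := hW
    obtain ⟨Y, hY, rfl⟩ := exists_posDef_of_mem_tube hZ
    obtain ⟨B, hB, rfl⟩ := exists_mul_transpose hY
    refine ⟨g * levi B hB, ?_, ?_, ?_⟩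
    · rw [actLag_mul, levi_lagInf]
    · rw [actLag_mul, levi_graphLag]
      simp
    · rw [moebius_mul _ _ (imagMat_mem_tube Matrix.PosDef.one).1, moebius_levi_imagMat_one]
  subst ha hb hk
  have hi : imagMat 1 ∈ tube (actLag k⁻¹ x) (actLag k⁻¹ y) := by
    have := moebius_mem_tube k⁻¹ hW'
    rwa [moebius_inv_moebius k (imagMat_mem_tube Matrix.PosDef.one).1] at this
  rw [← actLag_actLag_inv k x] at hx h ⊢
  rw [← actLag_actLag_inv k y] at hy h ⊢
  rw [isMaximalTriple_act_iff] at hx hy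
  rw [areOrthogonal_act_iff] at h
  rw [isHarmonic_act_iff]
  exact IsHarmonic.of_areOrthogonal_of_mem hx hy hi h

/-! ### Right-angled hexagons and their boundary tuples -/

theorem boundaryTuple_act (g : Sp4) (P Q : Fin 6 → Submodule ℝ (Vec4 ℝ)) :
    boundaryTuple (fun i => actLag g (P i)) (fun i => actLag g (Q i)) =
      fun i => actLag g (boundaryTuple P Q i) := by
  funext i
  fin_cases i <;> rfl

theorem hexagonTubes_act (g : Sp4) (P Q : Fin 6 → Submodule ℝ (Vec4 ℝ)) (i : Fin 6) :
    hexagonTubes (fun i => actLag g (P i)) (fun i => actLag g (Q i)) i =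
      moebius g '' hexagonTubes P Q i := by
  fin_cases i <;> exact (moebius_image_tube g _ _).symm

/-- The harmonic relations expressing that consecutive sides of a hexagon are orthogonal. -/
structure IsHarmonicHexagon (P Q : Fin 6 → Submodule ℝ (Vec4 ℝ)) : Prop where
  side₁ : IsHarmonic (P 0) (Q 0) (P 1) (Q 1)
  side₂ : IsHarmonic (Q 0) (P 2) (Q 1) (P 3)
  side₃ : IsHarmonic (P 2) (Q 2) (P 3) (Q 3)
  side₄ : IsHarmonic (Q 2) (P 4) (Q 3) (P 5)
  side₅ : IsHarmonic (P 4) (Q 4) (P 5) (Q 5)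
  side₆ : IsHarmonic (Q 4) (P 0) (Q 5) (P 1)

theorem IsHarmonicHexagon.act {P Q : Fin 6 → Submodule ℝ (Vec4 ℝ)} (h : IsHarmonicHexagon P Q)
    (g : Sp4) : IsHarmonicHexagon (fun i => actLag g (P i)) fun i => actLag g (Q i) :=
  ⟨h.side₁.act g, h.side₂.act g, h.side₃.act g, h.side₄.act g, h.side₅.act g, h.side₆.act g⟩

theorem isHarmonicHexagon_of_orthogonal {P Q : Fin 6 → Submodule ℝ (Vec4 ℝ)}
    (hm : IsMaximalTuple (boundaryTuple P Q))
    (h : ∀ i, AreOrthogonal (hexagonTubes P Q i) (hexagonTubes P Q (i + 1))) :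
    IsHarmonicHexagon P Q where
  side₁ := .of_areOrthogonal (hm 0 2 3 (by decide) (by decide)) (hm 0 3 5 (by decide) (by decide))
    (h 0)
  side₂ := .of_areOrthogonal (hm 2 4 5 (by decide) (by decide)) (hm 2 5 7 (by decide) (by decide))
    (h 1)
  side₃ := .of_areOrthogonal (hm 4 6 7 (by decide) (by decide)) (hm 4 7 9 (by decide) (by decide))
    (h 2)
  side₄ := .of_areOrthogonal (hm 6 8 9 (by decide) (by decide))
    (hm 6 9 11 (by decide) (by decide)) (h 3)
  side₅ := .of_areOrthogonal (hm 8 10 11 (by decide) (by decide))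
    (hm 1 8 11 (by decide) (by decide)).rotate (h 4)
  side₆ := .of_areOrthogonal (hm 0 1 10 (by decide) (by decide)).rotate.rotate
    (hm 1 3 10 (by decide) (by decide)).rotate.rotate (h 5)

theorem IsHarmonicHexagon.orthogonal {P Q : Fin 6 → Submodule ℝ (Vec4 ℝ)}
    (h : IsHarmonicHexagon P Q) (i : Fin 6) :
    AreOrthogonal (hexagonTubes P Q i) (hexagonTubes P Q (i + 1)) := by
  fin_cases i
  · exact h.side₁.areOrthogonal
  · exact h.side₂.areOrthogonal
  · exact h.side₃.areOrthogonal
  · exact h.side₄.areOrthogonal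
  · exact h.side₅.areOrthogonal
  · exact h.side₆.areOrthogonal

theorem OrderedHexagon.isHarmonicHexagon {H : OrderedHexagon}
    {P Q : Fin 6 → Submodule ℝ (Vec4 ℝ)} (hm : IsMaximalTuple (boundaryTuple P Q))
    (h : H.tubes = hexagonTubes P Q) : IsHarmonicHexagon P Q :=
  isHarmonicHexagon_of_orthogonal hm (h ▸ H.orthogonal)

/-- The members `P₂, Q₂, P₄, P₅, Q₅, P₁` of the boundary tuple determine the others: four of them
are reflections of known points, and `Q₃, Q₄` are the endpoints of a common perpendicular. -/
theorem IsHarmonicHexagon.unique {P Q P' Q' : Fin 6 → Submodule ℝ (Vec4 ℝ)}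
    (hm : IsMaximalTuple (boundaryTuple P Q)) (h : IsHarmonicHexagon P Q)
    (h' : IsHarmonicHexagon P' Q')
    (e : ![P' 1, Q' 1, P' 3, P' 4, Q' 4, P' 0] = ![P 1, Q 1, P 3, P 4, Q 4, P 0]) :
    P' = P ∧ Q' = Q := by
  have p1 : P' 1 = P 1 := congrFun e 0
  have q1 : Q' 1 = Q 1 := congrFun e 1
  have p3 : P' 3 = P 3 := congrFun e 2
  have p4 : P' 4 = P 4 := congrFun e 3
  have q4 : Q' 4 = Q 4 := congrFun e 4
  have p0 : P' 0 = P 0 := congrFun e 5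
  obtain ⟨a1, a2, a3, a4, a5, a6⟩ := h'
  rw [p0, p1, q1] at a1
  have q0 : Q' 0 = Q 0 := a1.rotate.rotate.unique h.side₁.rotate.rotate
  rw [q4, p0, p1] at a6
  have q5 : Q' 5 = Q 5 := a6.rotate.rotate.rotate.unique h.side₆.rotate.rotate.rotate
  rw [q0, q1, p3] at a2
  have p2 : P' 2 = P 2 := a2.rotate.rotate.unique h.side₂.rotate.rotate
  rw [p4, q4, q5] at a5
  have p5 : P' 5 = P 5 := a5.rotate.rotate.rotate.unique h.side₅.rotate.rotate.rotate
  rw [p2, p3] at a3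
  rw [p4, p5] at a4
  obtain ⟨q2, q3⟩ := common_perpendicular_unique (hm 4 7 8 (by decide) (by decide))
    (hm 4 8 11 (by decide) (by decide)) a3 a4.rotate h.side₃ h.side₄.rotate
  constructor <;> funext i <;> fin_cases i <;> assumption

theorem IsMaximalTriple.not_reverse {a b c : Submodule ℝ (Vec4 ℝ)} (h : IsMaximalTriple a b c) :
    ¬ IsMaximalTriple c b a :=
  fun h' => h.not_swap h'.rotate.rotate

theorem IsMaximalTriple.not_swap_left {a b c : Submodule ℝ (Vec4 ℝ)}
    (h : IsMaximalTriple a b c) : ¬ IsMaximalTriple b a c :=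
  fun h' => h.not_swap h'.rotate

/-- The sides of a hexagon determine its boundary tuple. -/
theorem boundary_unique {P Q P' Q' : Fin 6 → Submodule ℝ (Vec4 ℝ)}
    (hm : IsMaximalTuple (boundaryTuple P Q)) (hm' : IsMaximalTuple (boundaryTuple P' Q'))
    (h : hexagonTubes P Q = hexagonTubes P' Q') : P' = P ∧ Q' = Q := by
  have t (i j k : Fin 12) (hij : i < j := by decide) (hjk : j < k := by decide) :=
    hm i j k hij hjk
  have t' (i j k : Fin 12) (hij : i < j := by decide) (hjk : j < k := by decide) :=
    hm' i j k hij hjk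
  obtain ⟨p0, p1⟩ : P' 0 = P 0 ∧ P' 1 = P 1 := by
    refine (endpoints_of_tube_eq (t 0 3 4) (t' 0 3 4) (congrFun h 0)).resolve_right ?_
    rintro ⟨e0, e1⟩
    change P' 0 = P 1 at e0
    change P' 1 = P 0 at e1
    have h2 : IsMaximalTriple (P' 0) (P' 1) (P' 2) := t' 0 3 4
    have h3 : IsMaximalTriple (P' 0) (P' 1) (P' 3) := t' 0 3 7
    rw [e0, e1] at h2 h3
    rcases endpoints_of_tube_eq (t 4 7 8) (t' 4 7 8) (congrFun h 2) with ⟨e, -⟩ | ⟨-, e⟩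
    · change P' 2 = P 2 at e
      rw [e] at h2
      exact (t 0 3 4).not_swap_left h2
    · change P' 3 = P 2 at e
      rw [e] at h3
      exact (t 0 3 4).not_swap_left h3
  obtain ⟨q0, q1⟩ : Q' 0 = Q 0 ∧ Q' 1 = Q 1 := by
    refine (endpoints_of_tube_eq (t 2 5 6) (t' 2 5 6) (congrFun h 1)).resolve_right ?_
    rintro ⟨e0, -⟩
    change Q' 0 = Q 1 at e0
    have h2 : IsMaximalTriple (P' 0) (Q' 0) (P' 1) := t' 0 2 3
    rw [p0, p1, e0] at h2
    exact (t 0 3 5).not_swap h2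
  obtain ⟨p2, p3⟩ : P' 2 = P 2 ∧ P' 3 = P 3 := by
    refine (endpoints_of_tube_eq (t 4 7 8) (t' 4 7 8) (congrFun h 2)).resolve_right ?_
    rintro ⟨e0, e1⟩
    change P' 2 = P 3 at e0
    change P' 3 = P 2 at e1
    have h2 : IsMaximalTriple (P' 2) (Q' 1) (P' 3) := t' 4 5 7
    rw [e0, e1, q1] at h2
    exact (t 4 5 7).not_reverse h2
  obtain ⟨q2, q3⟩ : Q' 2 = Q 2 ∧ Q' 3 = Q 3 := by
    refine (endpoints_of_tube_eq (t 6 9 10) (t' 6 9 10) (congrFun h 3)).resolve_right ?_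
    rintro ⟨e0, e1⟩
    change Q' 2 = Q 3 at e0
    change Q' 3 = Q 2 at e1
    have h2 : IsMaximalTriple (Q' 2) (P' 3) (Q' 3) := t' 6 7 9
    rw [e0, e1, p3] at h2
    exact (t 6 7 9).not_reverse h2
  obtain ⟨p4, p5⟩ : P' 4 = P 4 ∧ P' 5 = P 5 := by
    refine (endpoints_of_tube_eq (t 0 8 11).rotate (t' 0 8 11).rotate
      (congrFun h 4)).resolve_right ?_
    rintro ⟨e0, e1⟩
    change P' 4 = P 5 at e0
    change P' 5 = P 4 at e1
    have h2 : IsMaximalTriple (P' 4) (Q' 3) (P' 5) := t' 8 9 11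
    rw [e0, e1, q3] at h2
    exact (t 8 9 11).not_reverse h2
  obtain ⟨q4, q5⟩ : Q' 4 = Q 4 ∧ Q' 5 = Q 5 := by
    refine (endpoints_of_tube_eq (t 1 3 10).rotate.rotate (t' 1 3 10).rotate.rotate
      (congrFun h 5)).resolve_right ?_
    rintro ⟨e0, -⟩
    change Q' 4 = Q 5 at e0
    have h2 : IsMaximalTriple (P' 0) (P' 1) (Q' 4) := t' 0 3 10
    rw [e0, p0, p1] at h2
    exact (t 0 1 3).not_swap h2
  constructor <;> funext i <;> fin_cases i <;> assumption

/-! ### Existence of hexagons with given boundary members -/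

/-- The 6-tuple `(0, A, Id, C, D, ∞)`. -/
def normalTuple (A C D : Mat2 ℝ) : Fin 6 → Submodule ℝ (Vec4 ℝ) :=
  ![graphLag 0, graphLag A, graphLag 1, graphLag C, graphLag D, lagInf]

/-- The cyclic position `(0, A, Id, C, D, ∞)`, that is `0 < A < Id < C < D`. -/
structure IsOrdered (A C D : Mat2 ℝ) : Prop where
  pos : A.PosDef
  lt_one : (1 - A).PosDef
  one_lt : (C - 1).PosDef
  lt : (D - C).PosDef

/-- In the cyclic order of the boundary of a hexagon, the endpoints `x, y` of the common
perpendicular of two sides with endpoints `p, q` and `r, s` are separated from the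
perpendiculars `a, a'` and `d, d'`: this follows by reflecting in the two sides. -/
theorem common_perpendicular_position {o p q r s a a' d d' x y : Submodule ℝ (Vec4 ℝ)}
    (h1 : IsMaximalTriple o p q) (h2 : IsMaximalTriple o q r) (h3 : IsMaximalTriple o r s)
    (ha' : IsMaximalTriple o a' p) (hd' : IsMaximalTriple o d' p) (hrd : IsMaximalTriple o r d)
    (ha : IsHarmonic p a q a') (hd : IsHarmonic r d s d')
    (hx : IsHarmonic p x q y) (hy : IsHarmonic r y s x) :
    IsMaximalTriple o a x ∧ IsMaximalTriple o x q ∧ IsMaximalTriple o r y ∧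
      IsMaximalTriple o y d := by
  have pxo : IsMaximalTriple p x o := hx.maximal.trans h1.rotate
  have opx := pxo.rotate.rotate
  have oxq := (hx.maximal.trans' h1.rotate).rotate.rotate
  have ory := (hy.maximal.trans h3.rotate).rotate.rotate
  have opy := ((h1.trans h2).trans ory)
  have pax := (ha.maximal_iff hx).2 (ha'.trans' opy).rotate
  have ryd := (hy.maximal_iff hd).2 ((hd'.trans opx).trans' (oxq.trans h2)).rotate.rotate
  exact ⟨(pax.trans' pxo).rotate.rotate, oxq, ory, (ryd.trans' hrd.rotate).rotate.rotate⟩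

theorem exists_hexagon {A C D : Mat2 ℝ} (h : IsOrdered A C D) :
    ∃ H : OrderedHexagon, H.HasSixTuple (normalTuple A C D) := by
  obtain ⟨hA, hA1, hC1, hDC⟩ := h
  have hC : C.PosDef := by simpa using hC1.add Matrix.PosDef.one
  have hD : D.PosDef := by simpa using hDC.add hC
  have sA := posDef_symm hA
  have sC := posDef_symm hC
  have sD := posDef_symm hD
  have hAA : (A * A).PosDef := posDef_mul_of_commute hA hA rfl
  have hAA' : (A - A * A).PosDef := by
    have := posDef_mul_of_commute hA hA1 (by noncomm_ring)
    rwa [mul_sub, mul_one] at this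
  have hAA1 : (1 - A * A).PosDef := by simpa using hA1.add hAA'
  have hS : (D * C⁻¹ * D - D).PosDef := by
    have h1 := hDC.add (posDef_congr hC.inv (posDef_isUnit_det hDC))
    have hu := posDef_isUnit_det hC
    have e : D - C + (D - C) * C⁻¹ * (D - C)ᵀ = D * C⁻¹ * D - D := by
      rw [posDef_symm hDC, sub_mul, Matrix.mul_nonsing_inv _ hu, mul_sub, sub_mul, sub_mul,
        one_mul, one_mul, mul_assoc D C⁻¹ C, Matrix.nonsing_inv_mul _ hu, mul_one]
      abel
    rwa [e] at h1
  have n (X : Mat2 ℝ) (hX : Xᵀ = X) : (-X)ᵀ = -X := by rw [Matrix.transpose_neg, hX]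
  -- The reflections of `Id` in the tube `(-A, A)` and of `C` in the tube `(-D, D)`.
  have ha := IsHarmonic.of_lt hAA hAA'
  have eA : A * (A * A)⁻¹ * A = 1 := by
    have hu := posDef_isUnit_det hA
    rw [Matrix.mul_inv_rev, ← mul_assoc, Matrix.mul_nonsing_inv _ hu, one_mul,
      Matrix.nonsing_inv_mul _ hu]
  rw [eA] at ha
  have hd := IsHarmonic.of_lt hC hDC
  have mA : IsMaximalTriple lagInf (graphLag (-A)) (graphLag 0) :=
    isMaximalTriple_of_posDef (n A sA) (by simpa using hA)
  have mD : IsMaximalTriple lagInf (graphLag (-D)) (graphLag 0) :=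
    isMaximalTriple_of_posDef (n D sD) (by simpa using hD)
  have m0 : IsMaximalTriple lagInf (graphLag 0) (graphLag (A * A)) :=
    isMaximalTriple_of_posDef (by simp) (by simpa using hAA)
  have m1 : IsMaximalTriple lagInf (graphLag (A * A)) (graphLag 1) :=
    isMaximalTriple_of_posDef (posDef_symm hAA) hAA1
  have m2 : IsMaximalTriple lagInf (graphLag 1) (graphLag C) :=
    isMaximalTriple_of_posDef (by simp) hC1
  have m3 : IsMaximalTriple lagInf (graphLag C) (graphLag D) :=
    isMaximalTriple_of_posDef sC hDC
  have m4 : IsMaximalTriple lagInf (graphLag D) (graphLag (D * C⁻¹ * D)) :=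
    isMaximalTriple_of_posDef sD hS
  have mDA : IsMaximalTriple lagInf (graphLag (-D)) (graphLag (-A)) := by
    refine isMaximalTriple_of_posDef (n D sD) ?_
    have : -A - -D = (1 - A) + (C - 1) + (D - C) := by abel
    rw [this]
    exact (hA1.add hC1).add hDC
  have mAA : IsMaximalTriple lagInf (graphLag (A * A)) (graphLag A) :=
    isMaximalTriple_of_posDef (posDef_symm hAA) hAA'
  have k1 := m1.trans' m2
  have k2 := (m1.trans m2).trans' (m3.trans m4)
  obtain ⟨x, y, hx, hy⟩ := exists_common_perpendicular k1 k2
  obtain ⟨l1, l2, l3, l4⟩ := common_perpendicular_position m1 m2 (m3.trans m4) (mA.trans m0)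
    (mD.trans m0) m3 ha hd hx hy
  let P : Fin 6 → Submodule ℝ (Vec4 ℝ) :=
    ![lagInf, graphLag 0, graphLag (A * A), graphLag 1, graphLag C, graphLag (D * C⁻¹ * D)]
  let Q : Fin 6 → Submodule ℝ (Vec4 ℝ) :=
    ![graphLag (-A), graphLag A, x, y, graphLag D, graphLag (-D)]
  have hmax : IsMaximalTuple (boundaryTuple P Q) := by
    refine isMaximalTuple_of_chain fun i h0 hi => ?_
    have hi' : i < 11 := by omega
    interval_cases i
    exacts [mDA, mA, m0, mAA, l1, l2, m2, l3, l4, m4]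
  have hharm : IsHarmonicHexagon P Q :=
    { side₁ := IsHarmonic.of_posDef hA
      side₂ := ha.rotate.rotate.rotate
      side₃ := hx
      side₄ := hy.rotate.rotate.rotate
      side₅ := hd
      side₆ := (IsHarmonic.of_posDef hD).rotate.rotate.rotate }
  exact ⟨⟨hexagonTubes P Q, hharm.orthogonal, P, Q, hmax, rfl⟩, P, Q, hmax, rfl, rfl⟩

/-! ### Isometry classes of hexagons -/

theorem sixTuple_isometry {H H' : OrderedHexagon} {l l' : Fin 6 → Submodule ℝ (Vec4 ℝ)}
    (hl : H.HasSixTuple l) (hl' : H'.HasSixTuple l') {g : Sp4}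
    (hg : ∀ i, H'.tubes i = moebius g '' H.tubes i) (i : Fin 6) : l' i = actLag g (l i) := by
  obtain ⟨P, Q, hm, hH, rfl⟩ := hl
  obtain ⟨P', Q', hm', hH', rfl⟩ := hl'
  have hm1 := hm.act g
  rw [← boundaryTuple_act] at hm1
  obtain ⟨e1, e2⟩ := boundary_unique hm1 hm' (by
    funext i
    rw [hexagonTubes_act, ← hH, ← hg, hH'])
  rw [e1, e2]
  fin_cases i <;> rfl

theorem isometry_of_sixTuple {H H' : OrderedHexagon} {l l' : Fin 6 → Submodule ℝ (Vec4 ℝ)}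
    (hl : H.HasSixTuple l) (hl' : H'.HasSixTuple l') {g : Sp4}
    (hg : ∀ i, l' i = actLag g (l i)) (i : Fin 6) : H'.tubes i = moebius g '' H.tubes i := by
  obtain ⟨P, Q, hm, hH, rfl⟩ := hl
  obtain ⟨P', Q', hm', hH', rfl⟩ := hl'
  have hm1 := hm.act g
  rw [← boundaryTuple_act] at hm1
  obtain ⟨rfl, rfl⟩ := ((OrderedHexagon.isHarmonicHexagon hm hH).act g).unique hm1
    (OrderedHexagon.isHarmonicHexagon hm' hH') (by
      funext i
      rw [hg i]
      fin_cases i <;> rfl)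
  rw [hH', hexagonTubes_act, hH]

theorem isometric_iff {H H' : OrderedHexagon} {l l' : Fin 6 → Submodule ℝ (Vec4 ℝ)}
    (hl : H.HasSixTuple l) (hl' : H'.HasSixTuple l') :
    H.Isometric H' ↔ ∃ g : Sp4, ∀ i, l' i = actLag g (l i) :=
  ⟨fun ⟨g, hg⟩ => ⟨g, sixTuple_isometry hl hl' hg⟩,
    fun ⟨g, hg⟩ => ⟨g, isometry_of_sixTuple hl hl' hg⟩⟩

theorem OrderedHexagon.exists_sixTuple (H : OrderedHexagon) : ∃ l, H.HasSixTuple l := by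
  obtain ⟨P, Q, hm, hH⟩ := H.maximal
  exact ⟨_, P, Q, hm, hH, rfl⟩

theorem hexagon_unique {H H' : OrderedHexagon} {l : Fin 6 → Submodule ℝ (Vec4 ℝ)}
    (hl : H.HasSixTuple l) (hl' : H'.HasSixTuple l) : H' = H := by
  have h := isometry_of_sixTuple hl hl' (g := 1) fun i => (actLag_one _).symm
  obtain ⟨t, h1, h2⟩ := H
  obtain ⟨t', h1', h2'⟩ := H'
  obtain rfl : t' = t := by
    funext i
    refine (h i).trans ?_
    have ht : t i ⊆ siegelSpace := by
      obtain ⟨P, Q, -, rfl⟩ := h2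
      fin_cases i <;> exact tube_subset_siegelSpace _ _
    exact (Set.image_congr fun Z hZ => moebius_one Z (ht hZ)).trans (Set.image_id' _)
  rfl

theorem isometric_equivalence : Equivalence OrderedHexagon.Isometric where
  refl H := by
    obtain ⟨l, hl⟩ := H.exists_sixTuple
    exact (isometric_iff hl hl).2 ⟨1, fun i => (actLag_one _).symm⟩
  symm {H H'} h := by
    obtain ⟨l, hl⟩ := H.exists_sixTuple
    obtain ⟨l', hl'⟩ := H'.exists_sixTuple
    obtain ⟨g, hg⟩ := (isometric_iff hl hl').1 h
    exact (isometric_iff hl' hl).2 ⟨g⁻¹, fun i => by rw [hg, actLag_inv_actLag]⟩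
  trans {H H' H''} h h' := by
    obtain ⟨l, hl⟩ := H.exists_sixTuple
    obtain ⟨l', hl'⟩ := H'.exists_sixTuple
    obtain ⟨l'', hl''⟩ := H''.exists_sixTuple
    obtain ⟨g, hg⟩ := (isometric_iff hl hl').1 h
    obtain ⟨g', hg'⟩ := (isometric_iff hl' hl'').1 h'
    exact (isometric_iff hl hl'').2 ⟨g' * g, fun i => by rw [hg', hg, actLag_mul]⟩

theorem mk_isometric_eq_iff {H H' : OrderedHexagon} :
    Quot.mk OrderedHexagon.Isometric H = Quot.mk OrderedHexagon.Isometric H' ↔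
      H.Isometric H' :=
  ⟨fun h => (isometric_equivalence.eqvGen_iff).1 (Quot.eqvGen_exact h), fun h => Quot.sound h⟩

/-- Every 6-tuple of a hexagon is in the symplectic orbit of one of the form
`(0, A, Id, C, D, ∞)`. -/
theorem OrderedHexagon.exists_normalTuple {H : OrderedHexagon}
    {l : Fin 6 → Submodule ℝ (Vec4 ℝ)} (hl : H.HasSixTuple l) :
    ∃ (g : Sp4) (A C D : Mat2 ℝ), IsOrdered A C D ∧ ∀ i, l i = actLag g (normalTuple A C D i) := by
  obtain ⟨P, Q, hm, -, rfl⟩ := hl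
  have t (i j k : Fin 12) (hij : i < j := by decide) (hjk : j < k := by decide) :=
    hm i j k hij hjk
  obtain ⟨g, h0, h1, h3⟩ : IsMaximalTriple (P 0) (P 1) (P 3) := t 0 3 7
  have a1 : IsMaximalTriple (P 0) (P 1) (Q 1) := t 0 3 5
  have a2 : IsMaximalTriple (P 0) (Q 1) (P 3) := t 0 5 7
  have a3 : IsMaximalTriple (P 0) (P 3) (P 4) := t 0 7 8
  have a4 : IsMaximalTriple (P 0) (P 4) (Q 4) := t 0 8 10
  rw [← actLag_actLag_inv g (Q 1), h0, h1, isMaximalTriple_act_iff] at a1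
  rw [← actLag_actLag_inv g (Q 1), h0, h3, isMaximalTriple_act_iff] at a2
  rw [← actLag_actLag_inv g (P 4), h0, h3, isMaximalTriple_act_iff] at a3
  rw [← actLag_actLag_inv g (P 4), ← actLag_actLag_inv g (Q 4), h0, isMaximalTriple_act_iff] at a4
  obtain ⟨X, A, hX, hA, -, sA, -⟩ := a1.exists_graphs
  obtain ⟨C, D, hC, hD, sC, -, -⟩ := a4.exists_graphs
  rw [hA, isMaximalTriple_lagInf_iff (by simp), sub_zero] at a1
  rw [hA, isMaximalTriple_lagInf_iff sA] at a2
  rw [hC, isMaximalTriple_lagInf_iff (by simp)] at a3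
  rw [hC, hD, isMaximalTriple_lagInf_iff sC] at a4
  refine ⟨g, A, C, D, ⟨a1, a2, a3, a4⟩, fun i => ?_⟩
  fin_cases i
  · exact h1
  · exact ((congrArg (actLag g) hA).symm.trans (actLag_actLag_inv g (Q 1))).symm
  · exact h3
  · exact ((congrArg (actLag g) hC).symm.trans (actLag_actLag_inv g (P 4))).symm
  · exact ((congrArg (actLag g) hD).symm.trans (actLag_actLag_inv g (Q 4))).symm
  · exact h0

theorem isUnit_det_of_mul_transpose {O : Mat2 ℝ} (hO : O * Oᵀ = 1) : IsUnit O.det := by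
  have := congrArg Matrix.det hO
  rw [Matrix.det_mul, Matrix.det_one] at this
  exact IsUnit.of_mul_eq_one _ this

/-- Normalised 6-tuples are equivalent under the symplectic group exactly when they are
conjugate under `O(2)`, the stabiliser of `(∞, 0, Id)`. -/
theorem normalTuple_equiv_iff {A C D A' C' D' : Mat2 ℝ} :
    (∃ g : Sp4, ∀ i, normalTuple A' C' D' i = actLag g (normalTuple A C D i)) ↔
      ∃ O : Mat2 ℝ, O * Oᵀ = 1 ∧ O * A * Oᵀ = A' ∧ O * C * Oᵀ = C' ∧ O * D * Oᵀ = D' := by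
  constructor
  · rintro ⟨g, hg⟩
    obtain ⟨B, hB, rfl⟩ := levi_of_fix (hg 5).symm (hg 0).symm
    have h1 : graphLag A' = actLag (levi B hB) (graphLag A) := hg 1
    have h2 : graphLag 1 = actLag (levi B hB) (graphLag 1) := hg 2
    have h3 : graphLag C' = actLag (levi B hB) (graphLag C) := hg 3
    have h4 : graphLag D' = actLag (levi B hB) (graphLag D) := hg 4
    rw [levi_graphLag] at h1 h2 h3 h4
    refine ⟨B, ?_, (graphLag_injective h1).symm, (graphLag_injective h3).symm,
      (graphLag_injective h4).symm⟩
    simpa using (graphLag_injective h2).symm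
  · rintro ⟨O, hO, rfl, rfl, rfl⟩
    have hu := isUnit_det_of_mul_transpose hO
    refine ⟨levi O hu, fun i => ?_⟩
    fin_cases i
    · exact ((levi_graphLag O hu 0).trans (congrArg graphLag (by simp))).symm
    · exact (levi_graphLag O hu A).symm
    · exact ((levi_graphLag O hu 1).trans (congrArg graphLag (by rw [mul_one, hO]))).symm
    · exact (levi_graphLag O hu C).symm
    · exact (levi_graphLag O hu D).symm
    · exact (levi_lagInf O hu).symm

/-! ### Polar coordinates on symmetric matrices -/

/-- The symmetric matrix with eigenvalues `m + ρ`, `m - ρ` whose first eigenline has angle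
`φ / 2`. -/
def polarMat (m ρ : ℝ) (φ : Real.Angle) : Mat2 ℝ :=
  !![m + ρ * φ.cos, ρ * φ.sin; ρ * φ.sin, m - ρ * φ.cos]

/-- The reflection in the first coordinate axis. -/
def axisReflection : Mat2 ℝ := !![1, 0; 0, -1]

theorem exists_polarMat {S : Mat2 ℝ} (hS : Sᵀ = S) : ∃ m ρ φ, 0 ≤ ρ ∧ S = polarMat m ρ φ := by
  have h01 : S 1 0 = S 0 1 := congrFun (congrFun hS 0) 1
  set z : ℂ := ⟨(S 0 0 - S 1 1) / 2, S 0 1⟩ with hz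
  have h1 : ‖z‖ * Real.cos z.arg = (S 0 0 - S 1 1) / 2 := Complex.norm_mul_cos_arg z
  have h2 : ‖z‖ * Real.sin z.arg = S 0 1 := Complex.norm_mul_sin_arg z
  refine ⟨(S 0 0 + S 1 1) / 2, ‖z‖, (z.arg : Real.Angle), norm_nonneg z, ?_⟩
  rw [polarMat, Real.Angle.cos_coe, Real.Angle.sin_coe, h1, h2]
  ext i j
  fin_cases i <;> fin_cases j <;> simp [h01] <;> ring

theorem polarMat_posDef_iff {m ρ : ℝ} {φ : Real.Angle} : (polarMat m ρ φ).PosDef ↔ |ρ| < m := by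
  have e : (m + ρ * φ.cos) * (m - ρ * φ.cos) - ρ * φ.sin * (ρ * φ.sin) = m ^ 2 - ρ ^ 2 := by
    linear_combination (-ρ ^ 2) * Real.Angle.cos_sq_add_sin_sq φ
  rw [posDef_two_iff]
  simp only [polarMat, Matrix.of_apply, Matrix.cons_val', Matrix.cons_val_zero,
    Matrix.cons_val_one, Matrix.cons_val_fin_one, true_and, e]
  constructor
  · rintro ⟨h1, h2⟩
    have h3 : 0 < m - ρ * φ.cos := by
      refine pos_of_mul_pos_right (a := m + ρ * φ.cos) ?_ h1.le
      nlinarith [mul_self_nonneg (ρ * φ.sin)]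
    exact abs_lt_of_sq_lt_sq (by linarith) (by linarith)
  · intro h
    have h1 : ρ ^ 2 < m ^ 2 := sq_lt_sq.2 (h.trans_le (le_abs_self m))
    refine ⟨?_, by linarith⟩
    have h2 : |ρ * φ.cos| ≤ |ρ| := by
      rw [abs_mul]
      refine mul_le_of_le_one_right (abs_nonneg ρ) (abs_le_one_iff_mul_self_le_one.2 ?_)
      nlinarith [Real.Angle.cos_sq_add_sin_sq φ, sq_nonneg φ.sin]
    linarith [neg_abs_le (ρ * φ.cos)]

theorem polarMat_sub_one (m ρ : ℝ) (φ : Real.Angle) :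
    polarMat m ρ φ - 1 = polarMat (m - 1) ρ φ := by
  ext i j
  fin_cases i <;> fin_cases j <;> simp [polarMat] <;> ring

theorem one_sub_polarMat (m ρ : ℝ) (φ : Real.Angle) :
    1 - polarMat m ρ φ = polarMat (1 - m) (-ρ) φ := by
  ext i j
  fin_cases i <;> fin_cases j <;> simp [polarMat] <;> ring

theorem polarMat_inj {m ρ m' ρ' : ℝ} {φ φ' : Real.Angle} (hρ : 0 ≤ ρ) (hρ' : 0 ≤ ρ')
    (h : polarMat m ρ φ = polarMat m' ρ' φ') : m = m' ∧ ρ = ρ' ∧ (ρ = 0 ∨ φ = φ') := by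
  have h00 : m + ρ * φ.cos = m' + ρ' * φ'.cos := congrFun (congrFun h 0) 0
  have h01 : ρ * φ.sin = ρ' * φ'.sin := congrFun (congrFun h 0) 1
  have h11 : m - ρ * φ.cos = m' - ρ' * φ'.cos := congrFun (congrFun h 1) 1
  have hc : ρ * φ.cos = ρ' * φ'.cos := by linarith
  have hsq : ρ ^ 2 = ρ' ^ 2 := by
    linear_combination (ρ * φ.cos + ρ' * φ'.cos) * hc + (ρ * φ.sin + ρ' * φ'.sin) * h01 -
      ρ ^ 2 * Real.Angle.cos_sq_add_sin_sq φ + ρ' ^ 2 * Real.Angle.cos_sq_add_sin_sq φ'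
  have hr : ρ = ρ' := (pow_left_inj₀ hρ hρ' two_ne_zero).1 hsq
  refine ⟨by linarith, hr, ?_⟩
  subst hr
  refine or_iff_not_imp_left.2 fun h0 => ?_
  have k1 := mul_left_cancel₀ h0 hc
  have k2 := mul_left_cancel₀ h0 h01
  induction φ using Real.Angle.induction_on
  induction φ' using Real.Angle.induction_on
  exact Real.Angle.cos_sin_inj k1 k2

theorem polarMat_zero_radius (m : ℝ) (φ φ' : Real.Angle) : polarMat m 0 φ = polarMat m 0 φ' := by
  simp [polarMat]

theorem polarMat_zero_angle (m ρ : ℝ) : polarMat m ρ 0 = !![m + ρ, 0; 0, m - ρ] := by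
  simp [polarMat]

theorem rot_polarMat (α m ρ : ℝ) (φ : Real.Angle) :
    rot α * polarMat m ρ φ * (rot α)ᵀ = polarMat m ρ (φ + α) := by
  have hc : Real.cos α = Real.cos (α / 2) ^ 2 - Real.sin (α / 2) ^ 2 := by
    rw [← Real.cos_two_mul', mul_div_cancel₀ _ two_ne_zero]
  have hs : Real.sin α = 2 * Real.sin (α / 2) * Real.cos (α / 2) := by
    rw [← Real.sin_two_mul, mul_div_cancel₀ _ two_ne_zero]
  have h1 := Real.sin_sq_add_cos_sq (α / 2)
  set s := Real.sin (α / 2)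
  set c := Real.cos (α / 2)
  ext i j
  fin_cases i <;> fin_cases j <;>
    simp [polarMat, rot, Matrix.mul_apply, Fin.sum_univ_two, Real.Angle.cos_add,
      Real.Angle.sin_add, hc, hs]
  · linear_combination m * h1
  · ring
  · ring
  · linear_combination m * h1

theorem axisReflection_polarMat (m ρ : ℝ) (φ : Real.Angle) :
    axisReflection * polarMat m ρ φ * axisReflectionᵀ = polarMat m ρ (-φ) := by
  ext i j
  fin_cases i <;> fin_cases j <;>
    simp [polarMat, axisReflection, Matrix.mul_apply, Fin.sum_univ_two]

theorem axisReflection_mul_transpose : axisReflection * axisReflectionᵀ = 1 := by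
  ext i j
  fin_cases i <;> fin_cases j <;>
    simp [axisReflection, Matrix.mul_apply, Fin.sum_univ_two]

theorem rot_mul_transpose (α : ℝ) : rot α * (rot α)ᵀ = 1 := by
  have h1 := Real.sin_sq_add_cos_sq (α / 2)
  ext i j
  fin_cases i <;> fin_cases j <;> simp [rot, Matrix.mul_apply, Fin.sum_univ_two]
  · linear_combination h1
  · ring
  · ring
  · linear_combination h1

theorem rot_transpose (α : ℝ) : (rot α)ᵀ = rot (-α) := by
  ext i j
  fin_cases i <;> fin_cases j <;> simp [rot, neg_div]

/-- The elements of `O(2)` are rotations and products of a rotation and a reflection. -/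
theorem orthogonal_cases {O : Mat2 ℝ} (hO : O * Oᵀ = 1) :
    ∃ θ : ℝ, O = rot θ ∨ O = rot θ * axisReflection := by
  have hO' : Oᵀ * O = 1 := mul_eq_one_comm.1 hO
  have h00 := congrFun (congrFun hO' 0) 0
  have h01 := congrFun (congrFun hO' 0) 1
  have h11 := congrFun (congrFun hO' 1) 1
  simp [Matrix.mul_apply, Fin.sum_univ_two] at h00 h01 h11
  set z : ℂ := ⟨O 0 0, O 1 0⟩ with hz
  have hn : ‖z‖ = 1 := by
    rw [Complex.norm_def, Complex.normSq_mk, h00, Real.sqrt_one]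
  have h1 : Real.cos z.arg = O 0 0 := by
    have := Complex.norm_mul_cos_arg z
    rwa [hn, one_mul] at this
  have h2 : Real.sin z.arg = O 1 0 := by
    have := Complex.norm_mul_sin_arg z
    rwa [hn, one_mul] at this
  refine ⟨2 * z.arg, ?_⟩
  have e : 2 * z.arg / 2 = z.arg := by ring
  have hdet : (O 0 0 * O 1 1 - O 0 1 * O 1 0) ^ 2 = 1 := by
    linear_combination h11 * O 0 0 * O 0 0 + h11 * O 1 0 * O 1 0 + h00 -
      h01 * (O 0 0 * O 0 1 + O 1 0 * O 1 1)
  rcases sq_eq_one_iff.1 hdet with hd | hd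
  · left
    have k1 : O 1 1 = O 0 0 := by
      linear_combination O 0 0 * hd + O 1 0 * h01 - O 1 1 * h00
    have k2 : O 0 1 = -O 1 0 := by
      linear_combination (-O 1 0) * hd + O 0 0 * h01 - O 0 1 * h00
    ext i j
    fin_cases i <;> fin_cases j <;> simp [rot, e, h1, h2, k1, k2]
  · right
    have k1 : O 1 1 = -O 0 0 := by
      linear_combination O 0 0 * hd + O 1 0 * h01 - O 1 1 * h00
    have k2 : O 0 1 = O 1 0 := by
      linear_combination (-O 1 0) * hd + O 0 0 * h01 - O 0 1 * h00
    ext i j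
    fin_cases i <;> fin_cases j <;>
      simp [rot, axisReflection, Matrix.mul_apply, Fin.sum_univ_two, e, h1, h2, k1, k2]

/-! ### Arc coordinates in polar form -/

theorem exists_angleMod (φ : Real.Angle) : ∃ α : AngleParam, angleMod α = φ := by
  induction φ using Real.Angle.induction_on with
  | _ x =>
    refine ⟨⟨toIcoMod Real.two_pi_pos 0 x, ?_⟩, Real.Angle.coe_toIcoMod x 0⟩
    simpa using toIcoMod_mem_Ico Real.two_pi_pos 0 x

theorem angleMod_injective : Function.Injective angleMod := by
  intro α β h
  obtain ⟨k, hk⟩ := Real.Angle.angle_eq_iff_two_pi_dvd_sub.1 h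
  have hp := Real.two_pi_pos
  have h1 : (k : ℝ) < 1 := by nlinarith [α.2.2, β.2.1]
  have h2 : (-1 : ℝ) < k := by nlinarith [α.2.1, β.2.2]
  have h3 : k < 1 := by exact_mod_cast h1
  have h4 : -1 < k := by exact_mod_cast h2
  obtain rfl : k = 0 := by omega
  exact Subtype.ext (by simpa [sub_eq_zero] using hk)

/-- The square root of `matC`. -/
def sqrtC (c : Chamber) : Mat2 ℝ := !![√(Real.exp c.1.1), 0; 0, √(Real.exp c.1.2)]

/-- Half the sum of the exponentials of two lengths. -/
def expMean (x y : ℝ) : ℝ := (Real.exp x + Real.exp y) / 2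

/-- Half the difference of the exponentials of two lengths. -/
def expRadius (x y : ℝ) : ℝ := (Real.exp x - Real.exp y) / 2

theorem expMean_add_expRadius (x y : ℝ) : expMean x y + expRadius x y = Real.exp x := by
  rw [expMean, expRadius]
  ring

theorem expMean_sub_expRadius (x y : ℝ) : expMean x y - expRadius x y = Real.exp y := by
  rw [expMean, expRadius]
  ring

theorem expRadius_nonneg {x y : ℝ} (h : y ≤ x) : 0 ≤ expRadius x y := by
  rw [expRadius]
  linarith [Real.exp_le_exp.2 h]

theorem expRadius_eq_zero_iff {x y : ℝ} : expRadius x y = 0 ↔ x = y := by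
  rw [expRadius]
  constructor
  · intro h
    exact Real.exp_injective (by linarith)
  · rintro rfl
    simp

theorem exp_pair_inj {x y x' y' : ℝ} (h : expMean x y = expMean x' y')
    (h' : expRadius x y = expRadius x' y') : x = x' ∧ y = y' := by
  have h1 := expMean_add_expRadius x y
  have h2 := expMean_sub_expRadius x y
  rw [h, h'] at h1 h2
  rw [expMean_add_expRadius] at h1
  rw [expMean_sub_expRadius] at h2
  exact ⟨(Real.exp_injective h1).symm, (Real.exp_injective h2).symm⟩

theorem exists_exp_pair {m ρ : ℝ} (hρ : 0 ≤ ρ) (h : ρ < m) :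
    ∃ x y, y ≤ x ∧ m = expMean x y ∧ ρ = expRadius x y := by
  have h1 : 0 < m - ρ := by linarith
  have h2 : 0 < m + ρ := by linarith
  refine ⟨Real.log (m + ρ), Real.log (m - ρ), Real.log_le_log h1 (by linarith), ?_, ?_⟩
  · rw [expMean, Real.exp_log h1, Real.exp_log h2]
    ring
  · rw [expRadius, Real.exp_log h1, Real.exp_log h2]
    ring

theorem diagonal_eq_polarMat (x y : ℝ) :
    !![Real.exp x, 0; 0, Real.exp y] = polarMat (expMean x y) (expRadius x y) 0 := by
  rw [polarMat_zero_angle, expMean_add_expRadius, expMean_sub_expRadius]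

theorem matA_eq (p : DecoratedArcCoordinates) :
    matA p = polarMat (expMean (-p.b.1.2) (-p.b.1.1)) (expRadius (-p.b.1.2) (-p.b.1.1))
      (-angleMod p.α₁) := by
  have e : rot p.α₁ = (rot (-p.α₁))ᵀ := by rw [rot_transpose, neg_neg]
  rw [matA, rot_transpose, e, diagonal_eq_polarMat, rot_polarMat, zero_add, angleMod,
    Real.Angle.coe_neg]

theorem matC_eq (p : DecoratedArcCoordinates) :
    matC p = polarMat (expMean p.c.1.1 p.c.1.2) (expRadius p.c.1.1 p.c.1.2) 0 :=
  diagonal_eq_polarMat _ _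

theorem matD_eq (p : DecoratedArcCoordinates) :
    matD p = sqrtC p.c * polarMat (expMean p.d.1.1 p.d.1.2) (expRadius p.d.1.1 p.d.1.2)
      (angleMod p.α₂ + Real.pi) * (sqrtC p.c)ᵀ := by
  have h := rot_polarMat p.α₂ (expMean p.d.1.1 p.d.1.2) (expRadius p.d.1.1 p.d.1.2) 0
  rw [← diagonal_eq_polarMat, zero_add] at h
  rw [matD, mul_assoc _ (rot _) _, mul_assoc _ _ (rot _)ᵀ, h]
  ext i j
  fin_cases i <;> fin_cases j <;>
    simp [polarMat, sqrtC, Matrix.mul_apply, Fin.sum_univ_two, angleMod,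
      -Real.Angle.cos_coe, -Real.Angle.sin_coe, sub_eq_add_neg]

theorem sqrtC_isUnit (c : Chamber) : IsUnit (sqrtC c).det := by
  rw [sqrtC, Matrix.det_fin_two_of, isUnit_iff_ne_zero]
  have h1 := Real.sqrt_pos.2 (Real.exp_pos c.1.1)
  have h2 := Real.sqrt_pos.2 (Real.exp_pos c.1.2)
  simp [h1.ne', h2.ne']

theorem sqrtC_mul_transpose (c : Chamber) :
    sqrtC c * (sqrtC c)ᵀ = !![Real.exp c.1.1, 0; 0, Real.exp c.1.2] := by
  ext i j
  fin_cases i <;> fin_cases j <;>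
    simp [sqrtC, Matrix.mul_apply, Fin.sum_univ_two, Real.mul_self_sqrt (Real.exp_pos _).le]

theorem sqrtC_of_onDiagonal {c : Chamber} (hc : c.OnDiagonal) :
    sqrtC c = √(Real.exp c.1.1) • 1 := by
  have h : c.1.1 = c.1.2 := hc
  ext i j
  fin_cases i <;> fin_cases j <;> simp [sqrtC, h]

theorem isOrdered_mat (p : DecoratedArcCoordinates) :
    IsOrdered (matA p) (matC p) (matD p) := by
  obtain ⟨b, c, d, α₁, α₂⟩ := p
  have b1 := Real.exp_le_exp.2 (neg_le_neg b.2.1)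
  have b2 : Real.exp (-b.1.2) < 1 := Real.exp_lt_one_iff.2 (by linarith [b.2.2])
  have b3 := Real.exp_pos (-b.1.1)
  have c1 := Real.exp_le_exp.2 c.2.1
  have c2 : 1 < Real.exp c.1.2 := Real.one_lt_exp_iff.2 c.2.2
  have d1 := Real.exp_le_exp.2 d.2.1
  have d2 : 1 < Real.exp d.1.2 := Real.one_lt_exp_iff.2 d.2.2
  refine ⟨?_, ?_, ?_, ?_⟩
  · rw [matA_eq, polarMat_posDef_iff, expMean, expRadius, abs_lt]
    constructor <;> linarith
  · rw [matA_eq, one_sub_polarMat, polarMat_posDef_iff, expMean, expRadius, abs_lt]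
    constructor <;> linarith
  · rw [matC_eq, polarMat_sub_one, polarMat_posDef_iff, expMean, expRadius, abs_lt]
    constructor <;> linarith
  · have hC : matC ⟨b, c, d, α₁, α₂⟩ = sqrtC c * (sqrtC c)ᵀ := (sqrtC_mul_transpose c).symm
    have e : ∀ S : Mat2 ℝ, sqrtC c * S * (sqrtC c)ᵀ - sqrtC c * (sqrtC c)ᵀ =
        sqrtC c * (S - 1) * (sqrtC c)ᵀ := fun S => by noncomm_ring
    rw [hC, matD_eq, e]
    refine posDef_congr ?_ (sqrtC_isUnit c)
    rw [polarMat_sub_one, polarMat_posDef_iff, expMean, expRadius, abs_lt]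
    constructor <;> linarith

/-! ### Identifications of arc coordinates -/

/-- The matrices of two arc coordinates are conjugate under the orthogonal matrix `O`. -/
def IsConjBy (O : Mat2 ℝ) (p p' : DecoratedArcCoordinates) : Prop :=
  O * matA p * Oᵀ = matA p' ∧ O * matC p * Oᵀ = matC p' ∧ O * matD p * Oᵀ = matD p'

theorem axisReflection_sqrtC (c : Chamber) :
    axisReflection * sqrtC c = sqrtC c * axisReflection := by
  ext i j
  fin_cases i <;> fin_cases j <;>
    simp [axisReflection, sqrtC, Matrix.mul_apply, Fin.sum_univ_two]

theorem conj_mul_mul_of_commute {O L S : Mat2 ℝ} (h : O * L = L * O) :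
    O * (L * S * Lᵀ) * Oᵀ = L * (O * S * Oᵀ) * Lᵀ := by
  have h' : Lᵀ * Oᵀ = Oᵀ * Lᵀ := by rw [← Matrix.transpose_mul, h, Matrix.transpose_mul]
  calc O * (L * S * Lᵀ) * Oᵀ = (O * L) * S * (Lᵀ * Oᵀ) := by noncomm_ring
    _ = _ := by rw [h, h']; noncomm_ring

theorem isConjBy_reflect (b c d : Chamber) {α₁ α₂ β₁ β₂ : AngleParam}
    (h₁ : angleMod β₁ = -angleMod α₁) (h₂ : angleMod β₂ = -angleMod α₂) :
    IsConjBy axisReflection ⟨b, c, d, α₁, α₂⟩ ⟨b, c, d, β₁, β₂⟩ := by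
  refine ⟨?_, ?_, ?_⟩
  · rw [matA_eq, matA_eq, axisReflection_polarMat, h₁]
  · rw [matC_eq, matC_eq, axisReflection_polarMat, neg_zero]
  · rw [matD_eq, matD_eq, conj_mul_mul_of_commute (axisReflection_sqrtC c),
      axisReflection_polarMat, h₂, neg_add, ← Real.Angle.coe_neg, Real.Angle.coe_neg,
      Real.Angle.neg_coe_pi]

theorem rot_sqrtC {c : Chamber} (hc : c.OnDiagonal) (θ : ℝ) :
    rot θ * sqrtC c = sqrtC c * rot θ := by
  rw [sqrtC_of_onDiagonal hc, mul_smul_comm, smul_mul_assoc, mul_one, one_mul]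

theorem exists_isConjBy_of_arcRel {p p' : DecoratedArcCoordinates} (h : ArcRel p p') :
    ∃ O : Mat2 ℝ, O * Oᵀ = 1 ∧ IsConjBy O p p' := by
  induction h with
  | reflect b c d α₁ α₂ β₁ β₂ h₁ h₂ =>
    exact ⟨_, axisReflection_mul_transpose, isConjBy_reflect b c d h₁ h₂⟩
  | diag_b b c d α₁ α₂ β₁ hb =>
    refine ⟨1, by simp, ?_, by simp [matC], by simp [matD]⟩
    have h0 : expRadius (-b.1.2) (-b.1.1) = 0 := expRadius_eq_zero_iff.2 (congrArg Neg.neg hb.symm)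
    rw [matA_eq, matA_eq, h0, one_mul, Matrix.transpose_one, mul_one]
    exact polarMat_zero_radius _ _ _
  | diag_c b c d α₁ α₂ β₁ β₂ hc h =>
    have h1 : -angleMod α₁ + ((α₁ - β₁ : ℝ) : Real.Angle) = -angleMod β₁ := by
      rw [Real.Angle.coe_sub, angleMod, angleMod]
      abel
    have h2 : angleMod α₂ + ((α₁ - β₁ : ℝ) : Real.Angle) = angleMod β₂ := by
      rw [Real.Angle.coe_sub]
      change angleMod α₂ + (angleMod α₁ - angleMod β₁) = angleMod β₂
      rw [add_sub, add_comm (angleMod α₂), ← h]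
      abel
    refine ⟨rot (α₁ - β₁), rot_mul_transpose _, ?_, ?_, ?_⟩
    · rw [matA_eq, matA_eq, rot_polarMat, h1]
    · have h0 : expRadius c.1.1 c.1.2 = 0 := expRadius_eq_zero_iff.2 hc
      rw [matC_eq, matC_eq, rot_polarMat, h0]
      exact polarMat_zero_radius _ _ _
    · rw [matD_eq, matD_eq, conj_mul_mul_of_commute (rot_sqrtC hc _), rot_polarMat,
        add_right_comm, h2]
  | diag_d b c d α₁ α₂ β₂ hd =>
    refine ⟨1, by simp, by simp [matA], by simp [matC], ?_⟩
    have h0 : expRadius d.1.1 d.1.2 = 0 := expRadius_eq_zero_iff.2 hd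
    rw [matD_eq, matD_eq, h0, one_mul, Matrix.transpose_one, mul_one,
      polarMat_zero_radius _ (angleMod α₂ + Real.pi) (angleMod β₂ + Real.pi)]

theorem mk_eq_of_collapsed {b c d : Chamber} {α₁ α₂ β₁ β₂ : AngleParam}
    (h₁ : b.OnDiagonal ∨ α₁ = β₁) (h₂ : d.OnDiagonal ∨ α₂ = β₂) :
    Quot.mk ArcRel ⟨b, c, d, α₁, α₂⟩ = Quot.mk ArcRel ⟨b, c, d, β₁, β₂⟩ := by
  have e1 : Quot.mk ArcRel ⟨b, c, d, α₁, α₂⟩ = Quot.mk ArcRel ⟨b, c, d, β₁, α₂⟩ := by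
    rcases h₁ with hb | rfl
    · exact Quot.sound (.diag_b b c d α₁ α₂ β₁ hb)
    · rfl
  rw [e1]
  rcases h₂ with hd | rfl
  · exact Quot.sound (.diag_d b c d β₁ α₂ β₂ hd)
  · rfl

/-- Conjugation by a rotation is generated by the identifications along the diagonals: either
`c` is on the diagonal and the angles change by opposite amounts, or the rotation is trivial. -/
theorem mk_eq_of_rot {p p' : DecoratedArcCoordinates} {θ : ℝ} (h : IsConjBy (rot θ) p p') :
    Quot.mk ArcRel p = Quot.mk ArcRel p' := by
  obtain ⟨b, c, d, α₁, α₂⟩ := p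
  obtain ⟨b', c', d', β₁, β₂⟩ := p'
  obtain ⟨hA, hC, hD⟩ := h
  rw [matA_eq, matA_eq, rot_polarMat] at hA
  rw [matC_eq, matC_eq, rot_polarMat, zero_add] at hC
  rw [matD_eq, matD_eq] at hD
  dsimp only at hA hC hD
  obtain ⟨a1, a2, a3⟩ := polarMat_inj (expRadius_nonneg (neg_le_neg b.2.1))
    (expRadius_nonneg (neg_le_neg b'.2.1)) hA
  obtain ⟨c1, c2, c3⟩ := polarMat_inj (expRadius_nonneg c.2.1) (expRadius_nonneg c'.2.1) hC
  obtain rfl : b = b' := by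
    obtain ⟨h2, h1⟩ := exp_pair_inj a1 a2
    exact Subtype.ext (Prod.ext (neg_injective h1) (neg_injective h2))
  obtain rfl : c = c' := by
    obtain ⟨h1, h2⟩ := exp_pair_inj c1 c2
    exact Subtype.ext (Prod.ext h1 h2)
  have hb : b.OnDiagonal ∨ -angleMod α₁ + θ = -angleMod β₁ :=
    a3.imp_left fun h => (neg_injective (expRadius_eq_zero_iff.1 h)).symm
  have hc : c.OnDiagonal ∨ (θ : Real.Angle) = 0 :=
    c3.imp_left fun h => expRadius_eq_zero_iff.1 h
  have hu := (Matrix.isUnit_iff_isUnit_det _).2 (sqrtC_isUnit c)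
  have hu' : IsUnit (sqrtC c)ᵀ := (Matrix.isUnit_transpose _).2 hu
  -- The conjugate of `matD` by the rotation, in polar form relative to `matC`.
  have hrot : ∀ m ρ : ℝ, ∀ φ : Real.Angle,
      rot θ * (sqrtC c * polarMat m ρ φ * (sqrtC c)ᵀ) * (rot θ)ᵀ =
        sqrtC c * polarMat m ρ (φ + θ) * (sqrtC c)ᵀ := by
    intro m ρ φ
    rcases hc with hc | hc
    · rw [conj_mul_mul_of_commute (rot_sqrtC hc θ), rot_polarMat]
    · obtain ⟨m', ρ', φ', -, e⟩ := exists_polarMat (S := sqrtC c * polarMat m ρ φ * (sqrtC c)ᵀ) (by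
        have : (polarMat m ρ φ)ᵀ = polarMat m ρ φ := by
          ext i j
          fin_cases i <;> fin_cases j <;> simp [polarMat]
        rw [Matrix.transpose_mul, Matrix.transpose_mul, Matrix.transpose_transpose, this,
          mul_assoc])
      rw [hc, add_zero, e, rot_polarMat, hc, add_zero]
  rw [hrot] at hD
  obtain ⟨d1, d2, d3⟩ := polarMat_inj (expRadius_nonneg d.2.1) (expRadius_nonneg d'.2.1)
    (hu.mul_left_cancel (hu'.mul_right_cancel hD))
  obtain rfl : d = d' := by
    obtain ⟨h1, h2⟩ := exp_pair_inj d1 d2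
    exact Subtype.ext (Prod.ext h1 h2)
  have hd : d.OnDiagonal ∨ angleMod α₂ + θ = angleMod β₂ := by
    refine d3.imp (fun h => expRadius_eq_zero_iff.1 h) fun h => ?_
    rw [add_right_comm] at h
    exact add_right_cancel h
  obtain ⟨γ₁, hγ₁⟩ := exists_angleMod (angleMod α₁ - θ)
  obtain ⟨γ₂, hγ₂⟩ := exists_angleMod (angleMod α₂ + θ)
  have e : Quot.mk ArcRel ⟨b, c, d, α₁, α₂⟩ = Quot.mk ArcRel ⟨b, c, d, γ₁, γ₂⟩ := by
    rcases hc with hc | hc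
    · refine Quot.sound (.diag_c b c d α₁ α₂ γ₁ γ₂ hc ?_)
      rw [hγ₁, hγ₂]
      abel
    · rw [hc, sub_zero] at hγ₁
      rw [hc, add_zero] at hγ₂
      rw [angleMod_injective hγ₁, angleMod_injective hγ₂]
  rw [e]
  refine mk_eq_of_collapsed (hb.imp_right fun h => angleMod_injective ?_)
    (hd.imp_right fun h => angleMod_injective ?_)
  · rw [hγ₁, ← neg_inj, ← h]
    abel
  · rw [hγ₂, h]

theorem mk_eq_of_isConjBy {p p' : DecoratedArcCoordinates} {O : Mat2 ℝ} (hO : O * Oᵀ = 1)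
    (h : IsConjBy O p p') : Quot.mk ArcRel p = Quot.mk ArcRel p' := by
  obtain ⟨θ, rfl | rfl⟩ := orthogonal_cases hO
  · exact mk_eq_of_rot h
  · obtain ⟨b, c, d, α₁, α₂⟩ := p
    obtain ⟨β₁, hβ₁⟩ := exists_angleMod (-angleMod α₁)
    obtain ⟨β₂, hβ₂⟩ := exists_angleMod (-angleMod α₂)
    obtain ⟨f1, f2, f3⟩ := isConjBy_reflect b c d hβ₁ hβ₂
    obtain ⟨h1, h2, h3⟩ := h
    have e : ∀ S : Mat2 ℝ, rot θ * axisReflection * S * (rot θ * axisReflection)ᵀ =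
        rot θ * (axisReflection * S * axisReflectionᵀ) * (rot θ)ᵀ := fun S => by
      rw [Matrix.transpose_mul]
      noncomm_ring
    rw [e, f1] at h1
    rw [e, f2] at h2
    rw [e, f3] at h3
    rw [Quot.sound (ArcRel.reflect b c d α₁ α₂ β₁ β₂ hβ₁ hβ₂)]
    exact mk_eq_of_rot ⟨h1, h2, h3⟩

/-- Every ordered triple is conjugate under `O(2)` to the matrices of some arc coordinates. -/
theorem IsOrdered.exists_arcCoordinates {A C D : Mat2 ℝ} (h : IsOrdered A C D) :
    ∃ (p : DecoratedArcCoordinates) (O : Mat2 ℝ), O * Oᵀ = 1 ∧ O * A * Oᵀ = matA p ∧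
      O * C * Oᵀ = matC p ∧ O * D * Oᵀ = matD p := by
  obtain ⟨hA, hA1, hC1, hDC⟩ := h
  have hC : C.PosDef := by simpa using hC1.add Matrix.PosDef.one
  obtain ⟨m, ρ, φ, hρ, rfl⟩ := exists_polarMat (posDef_symm hC)
  obtain ⟨θ, hθ⟩ : ∃ θ : ℝ, (θ : Real.Angle) = -φ := ⟨(-φ).toReal, Real.Angle.coe_toReal _⟩
  have hOC := rot_polarMat θ m ρ φ
  rw [hθ, add_neg_cancel] at hOC
  set O := rot θ
  have hO : O * Oᵀ = 1 := rot_mul_transpose θ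
  have hOu := isUnit_det_of_mul_transpose hO
  rw [polarMat_sub_one, polarMat_posDef_iff, abs_of_nonneg hρ] at hC1
  obtain ⟨c1, c2, hc, rfl, rfl⟩ := exists_exp_pair hρ (show ρ < m by linarith)
  have hc2 : 0 < c2 := by
    rw [← Real.one_lt_exp_iff, ← expMean_sub_expRadius c1 c2]
    linarith
  let c : Chamber := ⟨(c1, c2), hc, hc2⟩
  have sub_conj : ∀ X Y : Mat2 ℝ, O * (X - Y) * Oᵀ = O * X * Oᵀ - O * Y * Oᵀ :=
    fun X Y => by noncomm_ring
  have hA' := posDef_congr hA hOu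
  have hA1' := posDef_congr hA1 hOu
  rw [sub_conj, mul_one, hO] at hA1'
  obtain ⟨m, ρ, φA, hρ, hAeq⟩ := exists_polarMat (posDef_symm hA')
  rw [hAeq, polarMat_posDef_iff, abs_of_nonneg hρ] at hA'
  rw [hAeq, one_sub_polarMat, polarMat_posDef_iff, abs_neg, abs_of_nonneg hρ] at hA1'
  obtain ⟨x, y, hxy, rfl, rfl⟩ := exists_exp_pair hρ hA'
  have hx : x < 0 := by
    rw [← Real.exp_lt_one_iff, ← expMean_add_expRadius x y]
    linarith
  let b : Chamber := ⟨(-y, -x), neg_le_neg hxy, neg_pos.2 hx⟩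
  obtain ⟨α₁, hα₁⟩ := exists_angleMod (-φA)
  have hD' := posDef_congr hDC hOu
  rw [sub_conj, hOC, ← diagonal_eq_polarMat, ← sqrtC_mul_transpose c] at hD'
  have hLu := sqrtC_isUnit c
  have hLi : IsUnit ((sqrtC c)⁻¹).det := Matrix.isUnit_nonsing_inv_det _ hLu
  have hS := posDef_congr hD' hLi
  have l1 : (sqrtC c)⁻¹ * sqrtC c = 1 := Matrix.nonsing_inv_mul _ hLu
  have l1' : sqrtC c * (sqrtC c)⁻¹ = 1 := Matrix.mul_nonsing_inv _ hLu
  have l2 : (sqrtC c)ᵀ * ((sqrtC c)⁻¹)ᵀ = 1 := by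
    rw [← Matrix.transpose_mul, l1, Matrix.transpose_one]
  have l2' : ((sqrtC c)⁻¹)ᵀ * (sqrtC c)ᵀ = 1 := by
    rw [← Matrix.transpose_mul, l1', Matrix.transpose_one]
  set S := (sqrtC c)⁻¹ * (O * D * Oᵀ) * ((sqrtC c)⁻¹)ᵀ with hSdef
  have eS : (sqrtC c)⁻¹ * (O * D * Oᵀ - sqrtC c * (sqrtC c)ᵀ) * ((sqrtC c)⁻¹)ᵀ = S - 1 := by
    calc _ = S - ((sqrtC c)⁻¹ * sqrtC c) * ((sqrtC c)ᵀ * ((sqrtC c)⁻¹)ᵀ) := by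
          rw [hSdef]
          noncomm_ring
      _ = S - 1 := by rw [l1, l2, one_mul]
  have eD : O * D * Oᵀ = sqrtC c * S * (sqrtC c)ᵀ := by
    calc O * D * Oᵀ = (sqrtC c * (sqrtC c)⁻¹) * (O * D * Oᵀ) *
          (((sqrtC c)⁻¹)ᵀ * (sqrtC c)ᵀ) := by rw [l1', l2', one_mul, mul_one]
      _ = _ := by
        rw [hSdef]
        noncomm_ring
  rw [eS] at hS
  have hSp : S.PosDef := by simpa using hS.add Matrix.PosDef.one
  obtain ⟨m, ρ, φD, hρ, hSeq⟩ := exists_polarMat (posDef_symm hSp)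
  rw [hSeq, polarMat_sub_one, polarMat_posDef_iff, abs_of_nonneg hρ] at hS
  obtain ⟨d1, d2, hd, rfl, rfl⟩ := exists_exp_pair hρ (show ρ < m by linarith)
  have hd2 : 0 < d2 := by
    rw [← Real.one_lt_exp_iff, ← expMean_sub_expRadius d1 d2]
    linarith
  obtain ⟨α₂, hα₂⟩ := exists_angleMod (φD - Real.pi)
  refine ⟨⟨b, c, ⟨(d1, d2), hd, hd2⟩, α₁, α₂⟩, O, hO, ?_, ?_, ?_⟩
  · rw [matA_eq, hAeq, hα₁]
    simp [b]
  · rw [hOC, matC_eq]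
  · rw [eD, matD_eq, hSeq, hα₂, sub_add_cancel]

theorem sixTuple_equiv_iff {p p' : DecoratedArcCoordinates} :
    (∃ g : Sp4, ∀ i, sixTuple p' i = actLag g (sixTuple p i)) ↔
      Quot.mk ArcRel p = Quot.mk ArcRel p' := by
  constructor
  · intro h
    obtain ⟨O, hO, hp⟩ := normalTuple_equiv_iff.1 h
    exact mk_eq_of_isConjBy hO hp
  · intro h
    replace h := Quot.eqvGen_exact h
    induction h with
    | rel p p' h => exact normalTuple_equiv_iff.2 (exists_isConjBy_of_arcRel h)
    | refl p => exact ⟨1, fun i => (actLag_one _).symm⟩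
    | symm p p' h ih =>
      obtain ⟨g, hg⟩ := ih
      exact ⟨g⁻¹, fun i => by rw [hg, actLag_inv_actLag]⟩
    | trans p p' p'' h h' ih ih' =>
      obtain ⟨g, hg⟩ := ih
      obtain ⟨g', hg'⟩ := ih'
      exact ⟨g' * g, fun i => by rw [hg', hg, actLag_mul]⟩

theorem exists_hexagon_sixTuple (p : DecoratedArcCoordinates) :
    ∃ H : OrderedHexagon, H.HasSixTuple (sixTuple p) :=
  exists_hexagon (isOrdered_mat p)

/-- A hexagon with arc coordinates `p`. -/
def hexagonOf (p : DecoratedArcCoordinates) : OrderedHexagon :=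
  (exists_hexagon_sixTuple p).choose

theorem hexagonOf_spec (p : DecoratedArcCoordinates) : (hexagonOf p).HasSixTuple (sixTuple p) :=
  (exists_hexagon_sixTuple p).choose_spec

theorem mk_hexagonOf_eq_iff {p p' : DecoratedArcCoordinates} :
    Quot.mk OrderedHexagon.Isometric (hexagonOf p) =
      Quot.mk OrderedHexagon.Isometric (hexagonOf p') ↔
      Quot.mk ArcRel p = Quot.mk ArcRel p' := by
  rw [mk_isometric_eq_iff, isometric_iff (hexagonOf_spec p) (hexagonOf_spec p'),
    sixTuple_equiv_iff]

/-- The class of the hexagon with given arc coordinates. -/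
def hexagonClass : ArcCoordinates → HexagonClasses :=
  Quot.lift (fun p => Quot.mk _ (hexagonOf p)) fun _ _ h =>
    mk_hexagonOf_eq_iff.2 (Quot.sound h)

theorem hexagonClass_bijective : Function.Bijective hexagonClass := by
  constructor
  · rintro ⟨p⟩ ⟨p'⟩ h
    exact mk_hexagonOf_eq_iff.1 h
  · rintro ⟨H⟩
    obtain ⟨l, hl⟩ := H.exists_sixTuple
    obtain ⟨g, A, C, D, hord, hg⟩ := OrderedHexagon.exists_normalTuple hl
    obtain ⟨p, O, hO, hp⟩ := hord.exists_arcCoordinates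
    obtain ⟨k, hk⟩ := normalTuple_equiv_iff.2 ⟨O, hO, hp⟩
    refine ⟨Quot.mk _ p, mk_isometric_eq_iff.2 ?_⟩
    refine (isometric_iff (hexagonOf_spec p) hl).2 ⟨g * k⁻¹, fun i => ?_⟩
    have e : sixTuple p i = actLag k (normalTuple A C D i) := hk i
    rw [e, actLag_mul, actLag_inv_actLag, hg]

end SiegelHexagon

end

theorem theorem4p14 :
    (∀ p : SiegelHexagon.DecoratedArcCoordinates,
      ∃! H : SiegelHexagon.OrderedHexagon, H.HasSixTuple (SiegelHexagon.sixTuple p)) ∧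
    ∃ Φ : SiegelHexagon.ArcCoordinates → SiegelHexagon.HexagonClasses,
      Function.Bijective Φ ∧
      ∀ (p : SiegelHexagon.DecoratedArcCoordinates) (H : SiegelHexagon.OrderedHexagon),
        H.HasSixTuple (SiegelHexagon.sixTuple p) →
          Φ (Quot.mk SiegelHexagon.ArcRel p) = Quot.mk SiegelHexagon.OrderedHexagon.Isometric H := by
  refine ⟨fun p => ?_, SiegelHexagon.hexagonClass, SiegelHexagon.hexagonClass_bijective, ?_⟩
  · exact ⟨_, SiegelHexagon.hexagonOf_spec p, fun H hH =>
      SiegelHexagon.hexagon_unique (SiegelHexagon.hexagonOf_spec p) hH⟩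
  · intro p H hH
    rw [SiegelHexagon.hexagon_unique (SiegelHexagon.hexagonOf_spec p) hH]
    rfl
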